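/- Let $p$ be a prime, let $G$ be a compact $p$-adic Lie group with a closed normal subgroup $H$ such that $\Gamma=G/H$ is topologically isomorphic to $\mathbb Z_p$, fix a topological generator $\gamma$ of $\Gamma$, and let $\theta\colon G\to\Gamma\to\mathbb Z_p$ be the homomorphism with $\gamma\mapsto 1$. Write $\Lambda(G)=\mathbb Z_p[[G]]$. Let $L$ be a finite extension of $\mathbb Q_p$ with ring of integers $\mathcal O$ and residue field $\kappa_L$, let $\mathrm{ord}_L$ be the valuation of $L$ with value $1$ on uniformizers, and let $|\cdot|_p$ be the absolute value of $L$ with $|p|_p=p^{-1}$. Let $\rho\colon G\to \mathrm{GL}_n(\mathcal O)$ be a continuous representation; regard $\mathcal O^n$ as a right $\Lambda(G)$-module through the transpose of $\rho$, and likewise $L^n$. Let $A$ be a bounded complex of finitely generated projective left $\Lambda(G)$-modules. For $R\in\{\mathcal O,L\}$ let $\mathfrak B\colon H^i(R^n\otimes_{\Lambda(G)}A)\to H^{i+1}(R^n\otimes_{\Lambda(G)}A)$ be the Bockstein maps, i.e. the connecting homomorphisms of the sequence obtained by applying $R^n\otimes_{\Lambda(G)}-$ to $0\to A\to A\otimes_{\mathbb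 Z_p}E_\theta\to A\to 0$, where $E_\theta=\mathbb Z_p^2$ with $g\in G$ acting by $\begin{pmatrix}1&\theta(g)\\0&1\end{pmatrix}$ (diagonal action on the tensor product). They make $H^\cdot(R^n\otimes_{\Lambda(G)}A)$ into a complex; let $H^i_{\mathfrak B}$ be its cohomology in degree $i$ for $R=\mathcal O$. Assume that $A$ is semisimple at $\rho$, i.e. that every $H^i_{\mathfrak B}$ is $\mathbb Z_p$-torsion. Then every $H^i_{\mathfrak B}$ has finite length over $\mathcal O$; put $$\chi_{\rm add}=\sum_{i\in\mathbb Z}(-1)^i\,\mathrm{length}_{\mathcal O}(H^i_{\mathfrak B}),\qquad \chi_{\rm mult}=(\#\kappa_L)^{\chi_{\rm add}} .$$ Let $a\colon \mathbf 1_{\Lambda(G)}\to \mathbf d_{\Lambda(G)}(A)=\prod_i\mathbf d_{\Lambda(G)}(A^i)^{(-1)^i}$ be any morphism in the Picard category of $\Lambda(G)$, and $\mathcal L=[A,a]$. The leading term $\mathcal L^*(\rho)\in L^\times$ is $(-1)^{r}$ times the element of $L^\times=\mathrm{Aut}(\mathbf 1_L)$ given by the composite $$\mathbf 1_L\xrightarrow{\;L^n\otimes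 a\;}\mathbf d_L(L^n\otimes_{\Lambda(G)}A)\;\cong\;\mathbf d_L\big(H^\cdot(L^n\otimes_{\Lambda(G)}A)\big)\;\cong\;\mathbf 1_L,$$ where the second map is the canonical isomorphism from a complex to its cohomology, the last one comes from the acyclicity of $\big(H^\cdot(L^n\otimes_{\Lambda(G)} A),\mathfrak B\big)$, and $r=\sum_i(-1)^{i+1}\dim_L\big(H^i(A_\rho)^\Gamma\otimes_{\mathcal O}L\big)$ with $A_\rho=(\mathcal O[[\Gamma]]\otimes_{\mathcal O}\mathcal O^n)\otimes_{\Lambda(G)}A$ (right action of $g$ by $\tau\otimes o\mapsto\tau\bar g\otimes\rho(g)^{t}o$). (Normalization: for $A=[P\xrightarrow{\phi}P]$ in degrees $-1,0$, with $\phi$ an isomorphism after applying $L^n\otimes_{\Lambda(G)}-$ and with $a$ induced by $\mathrm{id}_P$, one has $\mathcal L^*(\rho)=\det(L^n\otimes\phi)^{-1}$.) Then $\mathcal L^*(\rho)$ is a well-defined element of $L^\times$ and $$\chi_{\rm add}=-\,\mathrm{ord}_L(\mathcal L^*(\rho)),\qquad \chi_{\rm mult}=|\mathcal L^*(\rho)|_p^{[L:\mathbb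 Q_p]} .$$ -/

import Mathlib

open CategoryTheory AbstractMeasure
open scoped NormedField Valued AbstractMeasure TensorProduct Manifold ContDiff

noncomputable section

namespace LeadingTerms

set_option linter.unusedSectionVars false

section IwasawaAlgebra

variable {R G : Type*} [CommRing R] [TopologicalSpace R] [IsTopologicalRing R]
  [Group G] [TopologicalSpace G] [IsTopologicalGroup G] [CompactSpace G] [T2Space G]

variable (R G) in
/-- The Iwasawa algebra `R[[G]]` of a profinite group `G`, as the algebra of `R`-valued measures on
`G` (continuous `R`-linear functionals on `C(G, R)`) under convolution. For `R = ℤ_p` this is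
`Λ(G) = lim ℤ_p[G/U]`, `U` running over the open normal subgroups; `g ∈ G` is the Dirac measure. -/
def Iwasawa : Type _ := D(G, R)

namespace Iwasawa

instance : AddCommGroup (Iwasawa R G) := inferInstanceAs (AddCommGroup D(G, R))
instance : Module R (Iwasawa R G) := inferInstanceAs (Module R D(G, R))
instance : FunLike (Iwasawa R G) C(G, R) R := inferInstanceAs (FunLike D(G, R) C(G, R) R)
instance : ContinuousLinearMapClass (Iwasawa R G) R C(G, R) R :=
  inferInstanceAs (ContinuousLinearMapClass D(G, R) R C(G, R) R)

@[ext]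
theorem ext {l m : Iwasawa R G} (h : ∀ f, l f = m f) : l = m := DFunLike.ext _ _ h

theorem add_apply (l m : Iwasawa R G) (f : C(G, R)) : (l + m) f = l f + m f := rfl
theorem zero_apply (f : C(G, R)) : (0 : Iwasawa R G) f = 0 := rfl
theorem smul_apply (c : R) (l : Iwasawa R G) (f : C(G, R)) : (c • l) f = c * l f := rfl

theorem sum_apply {ι : Type*} (s : Finset ι) (l : ι → Iwasawa R G) (f : C(G, R)) :
    (∑ i ∈ s, l i) f = ∑ i ∈ s, l i f := by
  classical
  induction s using Finset.induction_on with
  | empty => rfl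
  | insert a s ha ih => rw [Finset.sum_insert ha, Finset.sum_insert ha, add_apply, ih]

/-- The left translate `y ↦ f (x y)`. -/
def translate (f : C(G, R)) (x : G) : C(G, R) := ⟨fun y => f (x * y), by fun_prop⟩

/-- The function `x ↦ ∫ f (x y) dm(y)`. -/
def avg (m : Iwasawa R G) (f : C(G, R)) : C(G, R) :=
  contractSnd (X := G) (Y := G) m (f.comp ⟨fun z : G × G => z.1 * z.2, by fun_prop⟩)

theorem avg_apply (m : Iwasawa R G) (f : C(G, R)) (x : G) :
    avg m f x = m (translate f x) := rfl

/-- Convolution: `∫ f d(l * m) = ∫ ∫ f (x y) dm(y) dl(x)`. -/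
instance : Mul (Iwasawa R G) where
  mul l m := AbstractMeasure.map ⟨fun z : G × G => z.1 * z.2, by fun_prop⟩
    (prodMk' (X := G) (Y := G) l m)

theorem mul_apply (l m : Iwasawa R G) (f : C(G, R)) : (l * m) f = l (avg m f) := rfl

instance : One (Iwasawa R G) := ⟨dirac R (1 : G)⟩

theorem one_apply (f : C(G, R)) : (1 : Iwasawa R G) f = f 1 := rfl

instance : Ring (Iwasawa R G) :=
  { (inferInstance : AddCommGroup (Iwasawa R G)), (inferInstance : Mul (Iwasawa R G)),
    (inferInstance : One (Iwasawa R G)) with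
    left_distrib := fun a b c => by
      ext f
      rw [add_apply, mul_apply, mul_apply, mul_apply, ← map_add]
      rfl
    right_distrib := fun a b c => rfl
    zero_mul := fun a => rfl
    mul_zero := fun a => by
      ext f
      rw [mul_apply, zero_apply]
      exact map_zero a
    mul_assoc := fun a b c => by
      ext f
      rw [mul_apply, mul_apply, mul_apply]
      congr 1
      ext x
      rw [avg_apply, avg_apply, mul_apply]
      congr 1
      ext y
      rw [avg_apply]
      change c _ = c _
      congr 1
      ext z
      simp [translate, mul_assoc]
    one_mul := fun a => by
      ext f
      rw [mul_apply, one_apply, avg_apply]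
      congr 1
      ext z
      simp [translate]
    mul_one := fun a => by
      ext f
      rw [mul_apply]
      congr 1
      ext x
      rw [avg_apply, one_apply]
      simp [translate] }

instance : Algebra R (Iwasawa R G) :=
  Algebra.ofModule
    (fun r x y => rfl)
    (fun r x y => by
      ext f
      rw [smul_apply, mul_apply, mul_apply, ← smul_eq_mul, ← map_smul]
      rfl)

/-- The element `g ∈ G` of the Iwasawa algebra. -/
def of (g : G) : Iwasawa R G := dirac R g

/-- The measure `h · l`, i.e. `f ↦ ∫ h f dl`. -/
def weight (h : C(G, R)) (l : Iwasawa R G) : Iwasawa R G :=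
  toCLMEquiv.symm
    { toFun := fun f => l (h * f)
      map_add' := fun f g => by rw [mul_add, map_add]
      map_smul' := fun c f => by rw [mul_smul_comm, map_smul]; rfl
      cont := (map_continuous l).comp (continuous_const.mul continuous_id) }

theorem weight_apply (h f : C(G, R)) (l : Iwasawa R G) : weight h l f = l (h * f) := rfl

end Iwasawa
end IwasawaAlgebra

section Coefficients

variable (p : ℕ) [Fact p.Prime] (L : Type*) [NontriviallyNormedField L] [IsUltrametricDist L]
  [NormedAlgebra ℚ_[p] L]

/-- The inclusion of `ℤ_p` in the ring of integers of `L`. -/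
def padicIntHom : ℤ_[p] →+* 𝒪[L] :=
  ((algebraMap ℚ_[p] L).comp (algebraMap ℤ_[p] ℚ_[p])).codRestrict 𝒪[L] (fun x => by
    rw [Valued.integer.mem_iff]
    simpa using x.2)

instance instAlgebraInt : Algebra ℤ_[p] 𝒪[L] := (padicIntHom p L).toAlgebra

theorem coe_smul_int (c : ℤ_[p]) (x : 𝒪[L]) :
    ((c • x : 𝒪[L]) : L) = (c : ℚ_[p]) • (x : L) := by
  rw [Algebra.smul_def, Algebra.smul_def]
  rfl

theorem compactSpace_int (p : ℕ) [Fact p.Prime] (L : Type*) [NontriviallyNormedField L]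
    [IsUltrametricDist L] [NormedAlgebra ℚ_[p] L] [FiniteDimensional ℚ_[p] L] :
    CompactSpace 𝒪[L] := by
  have : ProperSpace L := FiniteDimensional.proper ℚ_[p] L
  rw [← isCompact_univ_iff, Subtype.isCompact_iff]
  have : (Subtype.val '' (Set.univ : Set 𝒪[L])) = Metric.closedBall (0 : L) 1 := by
    ext x
    simp [Valued.integer.mem_iff]
  rw [this]
  exact isCompact_closedBall 0 1

theorem isDiscreteValuationRing_int (p : ℕ) [Fact p.Prime] (L : Type*)
    [NontriviallyNormedField L] [IsUltrametricDist L] [NormedAlgebra ℚ_[p] L]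
    [FiniteDimensional ℚ_[p] L] : IsDiscreteValuationRing 𝒪[L] := by
  have := compactSpace_int p L
  have : (Valued.v : Valuation L NNReal).IsNontrivial := by
    obtain ⟨x, h0, h1⟩ := NormedField.exists_norm_lt_one L
    refine ⟨x, ?_, ?_⟩
    · simpa [NormedField.valuation_apply] using h0
    · intro h
      have h2 : ‖x‖ = 1 := by
        simpa [NormedField.valuation_apply, ← NNReal.coe_inj] using h
      exact absurd h2 h1.ne
  exact Valued.integer.isDiscreteValuationRing_of_compactSpace

variable [FiniteDimensional ℚ_[p] L]

theorem moduleFinite_int : Module.Finite ℤ_[p] 𝒪[L] := by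
  have := compactSpace_int p L
  let e : L ≃L[ℚ_[p]] (Fin (Module.finrank ℚ_[p] L) → ℚ_[p]) :=
    ContinuousLinearEquiv.ofFinrankEq (by simp)
  obtain ⟨C, hC⟩ := (isCompact_range (f := fun x : 𝒪[L] => ‖e (x : L)‖)
    (by fun_prop)).bddAbove
  have hC' : ∀ x : 𝒪[L], ‖e (x : L)‖ ≤ C := fun x => hC ⟨x, rfl⟩
  have hp : (1 : ℝ) < p := by exact_mod_cast (Fact.out : p.Prime).one_lt
  obtain ⟨k, hk⟩ := pow_unbounded_of_one_lt C hp
  have hb : ∀ (x : 𝒪[L]) i, ‖(p : ℚ_[p]) ^ k * e (x : L) i‖ ≤ 1 := fun x i => by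
    rw [norm_mul, norm_pow, Padic.norm_p, inv_pow]
    rw [inv_mul_le_iff₀ (by positivity), mul_one]
    exact ((norm_le_pi_norm _ i).trans (hC' x)).trans hk.le
  let φ : 𝒪[L] →ₗ[ℤ_[p]] (Fin (Module.finrank ℚ_[p] L) → ℤ_[p]) :=
    { toFun := fun x i => ⟨(p : ℚ_[p]) ^ k * e (x : L) i, hb x i⟩
      map_add' := fun x y => by
        funext i
        apply Subtype.ext
        change _ = (p : ℚ_[p]) ^ k * e (x : L) i + (p : ℚ_[p]) ^ k * e (y : L) i
        simp [mul_add]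
      map_smul' := fun c x => by
        funext i
        apply Subtype.ext
        change _ = (c : ℚ_[p]) * ((p : ℚ_[p]) ^ k * e (x : L) i)
        simp only [coe_smul_int, map_smul, Pi.smul_apply, smul_eq_mul]
        ring }
  refine Module.Finite.of_injective φ ?_
  rw [injective_iff_map_eq_zero]
  intro x hx
  have h0 : e (x : L) = 0 := by
    funext i
    have h1 : (p : ℚ_[p]) ^ k * e (x : L) i = 0 := congrArg Subtype.val (congrFun hx i)
    simpa [(Fact.out : p.Prime).ne_zero] using h1
  exact Subtype.ext (by simpa using h0)

theorem moduleFree_int : Module.Free ℤ_[p] 𝒪[L] := by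
  have := moduleFinite_int p L
  have : Module.IsTorsionFree ℤ_[p] 𝒪[L] := by
    refine Module.IsTorsionFree.of_smul_eq_zero fun c x h => ?_
    have h' := congrArg (Subtype.val) h
    rw [coe_smul_int] at h'
    rcases smul_eq_zero.mp h' with h1 | h1
    · exact Or.inl (Subtype.ext h1)
    · exact Or.inr (Subtype.ext h1)
  infer_instance

/-- A basis of the ring of integers of `L` over `ℤ_p`. -/
def intBasis : Module.Basis (Fin (Module.finrank ℤ_[p] 𝒪[L])) ℤ_[p] 𝒪[L] :=
  haveI := moduleFinite_int p L
  haveI := moduleFree_int p L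
  Module.finBasis ℤ_[p] 𝒪[L]

theorem continuous_smul_int (x : 𝒪[L]) : Continuous fun c : ℤ_[p] => c • x := by
  refine Continuous.subtype_mk (f := fun c : ℤ_[p] => (c : ℚ_[p]) • (x : L)) ?_ ?_ |>.congr ?_
  · fun_prop
  · intro c
    rw [← coe_smul_int]
    exact (c • x).2
  · intro c
    exact Subtype.ext (coe_smul_int p L c x).symm

theorem continuous_intBasis_repr : Continuous (intBasis p L).equivFun := by
  have h : Continuous (intBasis p L).equivFun.symm.toEquiv := by
    have : ⇑(intBasis p L).equivFun.symm.toEquiv = fun c => ∑ i, c i • intBasis p L i := by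
      funext c
      simp [Module.Basis.equivFun_symm_apply]
    rw [this]
    exact continuous_finsetSum _ fun i _ =>
      (continuous_smul_int p L _).comp (continuous_apply i)
  exact (Continuous.homeoOfEquivCompactToT2 h).symm.continuous

/-- A `ℤ_p`-linear functional on the ring of integers of `L` is continuous. -/
theorem continuous_functional (φ : 𝒪[L] →ₗ[ℤ_[p]] ℤ_[p]) : Continuous φ := by
  have : ⇑φ = fun x => ∑ i, (intBasis p L).equivFun x i * φ (intBasis p L i) := by
    funext x
    conv_lhs => rw [← (intBasis p L).sum_equivFun x, map_sum]
    simp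
  rw [this]
  exact continuous_finsetSum _ fun i _ =>
    ((continuous_apply i).comp (continuous_intBasis_repr p L)).mul continuous_const

theorem ext_functional {x y : 𝒪[L]} (h : ∀ φ : 𝒪[L] →ₗ[ℤ_[p]] ℤ_[p], φ x = φ y) : x = y :=
  (intBasis p L).ext_elem fun i => h ((intBasis p L).coord i)

variable {G : Type*} [Group G] [TopologicalSpace G] [IsTopologicalGroup G] [CompactSpace G]
  [T2Space G]

variable {p L} in
/-- The function `φ ∘ f` for a `ℤ_p`-linear functional `φ` on `𝒪`. -/
def compFun (φ : 𝒪[L] →ₗ[ℤ_[p]] ℤ_[p]) (f : C(G, 𝒪[L])) : C(G, ℤ_[p]) :=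
  (⟨φ, continuous_functional p L φ⟩ : C(𝒪[L], ℤ_[p])).comp f

/-- The integral of an `𝒪`-valued continuous function against a `ℤ_p`-valued measure, taken
coordinatewise in a `ℤ_p`-basis of `𝒪`. It is the unique element of `𝒪` that satisfies
`functional_integral`, so it does not depend on the basis. -/
def integral (l : Iwasawa ℤ_[p] G) (f : C(G, 𝒪[L])) : 𝒪[L] :=
  ∑ i, l (compFun ((intBasis p L).coord i) f) • intBasis p L i

theorem functional_integral (l : Iwasawa ℤ_[p] G) (f : C(G, 𝒪[L])) (φ : 𝒪[L] →ₗ[ℤ_[p]] ℤ_[p]) :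
    φ (integral p L l f) = l (compFun φ f) := by
  have : compFun φ f = ∑ i, φ (intBasis p L i) • compFun ((intBasis p L).coord i) f := by
    ext x
    conv_lhs => rw [compFun, ContinuousMap.comp_apply, ContinuousMap.coe_mk,
      ← (intBasis p L).sum_equivFun (f x), map_sum]
    simp [compFun, mul_comm, ContinuousMap.sum_apply]
  rw [this, integral, map_sum, map_sum]
  simp [mul_comm]

theorem integral_continuous (l : Iwasawa ℤ_[p] G) :
    Continuous fun f : C(G, 𝒪[L]) => integral p L l f :=
  continuous_finsetSum _ fun _ _ => (continuous_smul_int p L _).comp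
    ((map_continuous l).comp (ContinuousMap.continuous_postcomp _))

/-- The extension of a `ℤ_p`-valued measure on `G` to an `𝒪`-linear functional on `C(G, 𝒪)`. -/
def extendFun (l : Iwasawa ℤ_[p] G) : Iwasawa 𝒪[L] G := toCLMEquiv.symm
  { toFun := integral p L l
    map_add' := fun f g => ext_functional p L fun φ => by
      rw [map_add, functional_integral, functional_integral, functional_integral, ← map_add]
      congr 1
      refine ContinuousMap.ext fun x => ?_
      exact map_add φ (f x) (g x)
    map_smul' := fun c f => ext_functional p L fun φ => by
      have := functional_integral p L l f (φ.comp (LinearMap.mulLeft ℤ_[p] c))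
      simp only [LinearMap.comp_apply, LinearMap.mulLeft_apply] at this
      rw [functional_integral, RingHom.id_apply, smul_eq_mul, this]
      rfl
    cont := integral_continuous p L l }

theorem functional_extendFun (l : Iwasawa ℤ_[p] G) (f : C(G, 𝒪[L]))
    (φ : 𝒪[L] →ₗ[ℤ_[p]] ℤ_[p]) : φ (extendFun p L l f) = l (compFun φ f) :=
  functional_integral p L l f φ

/-- The canonical ring homomorphism `Λ(G) = ℤ_p[[G]] → Λ_𝒪(G) = 𝒪[[G]]`. -/
def extend : Iwasawa ℤ_[p] G →+* Iwasawa 𝒪[L] G where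
  toFun := extendFun p L
  map_zero' := Iwasawa.ext fun f => ext_functional p L fun φ => by
    rw [functional_extendFun, Iwasawa.zero_apply, Iwasawa.zero_apply, map_zero]
  map_add' l m := Iwasawa.ext fun f => ext_functional p L fun φ => by
    rw [functional_extendFun, Iwasawa.add_apply, Iwasawa.add_apply, map_add,
      functional_extendFun, functional_extendFun]
  map_one' := Iwasawa.ext fun f => ext_functional p L fun φ => by
    rw [functional_extendFun, Iwasawa.one_apply, Iwasawa.one_apply]
    rfl
  map_mul' l m := Iwasawa.ext fun f => ext_functional p L fun φ => by
    rw [functional_extendFun, Iwasawa.mul_apply, Iwasawa.mul_apply, functional_extendFun]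
    congr 1
    refine ContinuousMap.ext fun x => ?_
    exact (functional_extendFun p L m (Iwasawa.translate f x) φ).symm

end Coefficients

section Representations

variable {R : Type*} [CommRing R] [TopologicalSpace R] [IsTopologicalRing R]
  {G : Type*} [Group G] [TopologicalSpace G] [IsTopologicalGroup G] [CompactSpace G] [T2Space G]
  {Γ : Type*} [Group Γ] [TopologicalSpace Γ] [IsTopologicalGroup Γ] [CompactSpace Γ] [T2Space Γ]
  {n : ℕ}

/-- The matrix coefficient `g ↦ ρ(g)_{ij}`. -/
def coeff (ρ : G →ₜ* GL (Fin n) R) (i j : Fin n) : C(G, R) :=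
  ⟨fun g => (ρ g : Matrix (Fin n) (Fin n) R) i j,
    ((Units.continuous_val.comp (map_continuous ρ)).matrix_elem i j)⟩

theorem coeff_mul (ρ : G →ₜ* GL (Fin n) R) (i j : Fin n) (x y : G) :
    coeff ρ i j (x * y) = ∑ k, coeff ρ i k x * coeff ρ k j y := by
  simp [coeff, Matrix.mul_apply]

theorem coeff_one (ρ : G →ₜ* GL (Fin n) R) (i j : Fin n) :
    coeff ρ i j 1 = (1 : Matrix (Fin n) (Fin n) R) i j := by
  simp [coeff]

/-- The ring homomorphism `R[[G]] → M_n(R)` induced by `ρ : G → GL_n(R)`. -/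
def repHom (ρ : G →ₜ* GL (Fin n) R) : Iwasawa R G →+* Matrix (Fin n) (Fin n) R where
  toFun l := Matrix.of fun i j => l (coeff ρ i j)
  map_zero' := rfl
  map_add' _ _ := rfl
  map_one' := by
    ext i j
    exact coeff_one ρ i j
  map_mul' l m := by
    ext i j
    rw [Matrix.of_apply, Matrix.mul_apply, Iwasawa.mul_apply]
    have : Iwasawa.avg m (coeff ρ i j) = ∑ k, m (coeff ρ k j) • coeff ρ i k := by
      ext x
      rw [Iwasawa.avg_apply]
      have : Iwasawa.translate (coeff ρ i j) x = ∑ k, coeff ρ i k x • coeff ρ k j := by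
        ext y
        rw [ContinuousMap.sum_apply]
        exact coeff_mul ρ i j x y
      rw [this, map_sum, ContinuousMap.sum_apply]
      simp [mul_comm]
    rw [this, map_sum]
    simp [mul_comm]

/-- The image in `R[[Γ]]` of the measure `ρ_{ij} · l` on `G`, that is
`f ↦ ∫ ρ(g)_{ij} f(θ(g)) dl(g)`. -/
def pushCoeff (ρ : G →ₜ* GL (Fin n) R) (θ : G →ₜ* Γ) (i j : Fin n) (l : Iwasawa R G) :
    Iwasawa R Γ :=
  AbstractMeasure.map (X := G) (Y := Γ) (R := R) (E := R) ⟨θ, map_continuous θ⟩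
    (Iwasawa.weight (coeff ρ i j) l)

theorem pushCoeff_apply (ρ : G →ₜ* GL (Fin n) R) (θ : G →ₜ* Γ) (i j : Fin n) (l : Iwasawa R G)
    (f : C(Γ, R)) :
    pushCoeff ρ θ i j l f = l (coeff ρ i j * f.comp ⟨θ, map_continuous θ⟩) := rfl

/-- The ring homomorphism `R[[G]] → M_n(R[[Γ]])` with `g ↦ ρ(g) θ(g)`. -/
def repHomΓ (ρ : G →ₜ* GL (Fin n) R) (θ : G →ₜ* Γ) :
    Iwasawa R G →+* Matrix (Fin n) (Fin n) (Iwasawa R Γ) where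
  toFun l := Matrix.of fun i j => pushCoeff ρ θ i j l
  map_zero' := rfl
  map_add' _ _ := rfl
  map_one' := by
    ext i j f
    change coeff ρ i j 1 * f (θ 1) = _
    rw [coeff_one, map_one, Matrix.one_apply, Matrix.one_apply]
    split_ifs
    · rw [one_mul, Iwasawa.one_apply]
    · rw [zero_mul, Iwasawa.zero_apply]
  map_mul' l m := by
    ext i j f
    rw [Matrix.of_apply, Matrix.mul_apply, pushCoeff_apply, Iwasawa.mul_apply,
      Iwasawa.sum_apply]
    simp only [Matrix.of_apply, Iwasawa.mul_apply, pushCoeff_apply]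
    rw [← map_sum]
    congr 1
    ext x
    rw [ContinuousMap.sum_apply, Iwasawa.avg_apply]
    have : Iwasawa.translate (coeff ρ i j * f.comp ⟨θ, map_continuous θ⟩) x =
        ∑ k, coeff ρ i k x •
          (coeff ρ k j * (Iwasawa.translate f (θ x)).comp ⟨θ, map_continuous θ⟩) := by
      ext y
      rw [ContinuousMap.sum_apply]
      change coeff ρ i j (x * y) * f (θ (x * y)) = _
      rw [coeff_mul, map_mul, Finset.sum_mul]
      exact Finset.sum_congr rfl fun k _ => mul_assoc _ _ _
    rw [this, map_sum]
    exact Finset.sum_congr rfl fun k _ => map_smul _ _ _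

end Representations


section Tensor

universe u v w

variable {Λ : Type u} [Ring Λ] {S : Type w} [Ring S] {n : ℕ}
  (Φ : Λ →+* Matrix (Fin n) (Fin n) S)

/-- The submodule of `S^n ⊗_ℤ M` generated by all `vλ ⊗ m - v ⊗ λm`. -/
def balanced (M : Type v) [AddCommGroup M] [Module Λ M] : Submodule S ((Fin n → S) ⊗[ℤ] M) :=
  Submodule.span S {z | ∃ (v : Fin n → S) (l : Λ) (m : M),
    z = (Matrix.vecMul v (Φ l)) ⊗ₜ[ℤ] m - v ⊗ₜ[ℤ] (l • m)}

/-- The tensor product `S^n ⊗_Λ M`, as a left `S`-module. Here `S^n` consists of row vectors and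
is a right `Λ`-module through `Φ : Λ → M_n(S)`; equivalently, `λ` acts on column vectors by the
transpose of `Φ(λ)`. -/
abbrev Tens (M : Type v) [AddCommGroup M] [Module Λ M] : Type (max v w) :=
  ((Fin n → S) ⊗[ℤ] M) ⧸ balanced Φ M

/-- The map `S^n ⊗_ℤ M → S^n ⊗_ℤ N` induced by `f : M → N`. -/
def preMap {M N : Type*} [AddCommGroup M] [Module Λ M] [AddCommGroup N] [Module Λ N]
    (f : M →ₗ[Λ] N) : (Fin n → S) ⊗[ℤ] M →ₗ[S] (Fin n → S) ⊗[ℤ] N :=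
  TensorProduct.AlgebraTensorModule.map (LinearMap.id : (Fin n → S) →ₗ[S] (Fin n → S))
    f.toAddMonoidHom.toIntLinearMap

theorem balanced_le {M N : Type*} [AddCommGroup M] [Module Λ M] [AddCommGroup N] [Module Λ N]
    (f : M →ₗ[Λ] N) : balanced Φ M ≤ (balanced Φ N).comap (preMap f) := by
  refine Submodule.span_le.mpr ?_
  rintro _ ⟨v, l, m, rfl⟩
  refine Submodule.subset_span ⟨v, l, f m, ?_⟩
  simp [preMap]

/-- The map `S^n ⊗_Λ M → S^n ⊗_Λ N` induced by `f : M → N`. -/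
def Tens.map {M N : Type*} [AddCommGroup M] [Module Λ M] [AddCommGroup N] [Module Λ N]
    (f : M →ₗ[Λ] N) : Tens Φ M →ₗ[S] Tens Φ N :=
  Submodule.mapQ _ _ (preMap f) (balanced_le Φ f)

theorem Tens.hom_ext {M : Type*} [AddCommGroup M] [Module Λ M] {N : Type*} [AddCommGroup N]
    [Module S N] {f g : Tens Φ M →ₗ[S] N}
    (h : ∀ v m, f (Submodule.Quotient.mk (v ⊗ₜ m)) = g (Submodule.Quotient.mk (v ⊗ₜ m))) :
    f = g := by
  refine Submodule.linearMap_qext _ (LinearMap.ext fun z => ?_)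
  induction z using TensorProduct.induction_on with
  | zero => simp
  | tmul v m => exact h v m
  | add x y hx hy => rw [map_add, map_add, hx, hy]

theorem Tens.map_mk {M N : Type*} [AddCommGroup M] [Module Λ M] [AddCommGroup N] [Module Λ N]
    (f : M →ₗ[Λ] N) (v : Fin n → S) (m : M) :
    Tens.map Φ f (Submodule.Quotient.mk (v ⊗ₜ m)) = Submodule.Quotient.mk (v ⊗ₜ f m) := rfl

/-- The functor `S^n ⊗_Λ -`. -/
def tensFunctor : ModuleCat.{v} Λ ⥤ ModuleCat.{max v w} S where
  obj M := ModuleCat.of S (Tens Φ M)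
  map f := ModuleCat.ofHom (Tens.map Φ f.hom)
  map_id M := by
    refine ModuleCat.hom_ext (Tens.hom_ext Φ fun v m => ?_)
    rfl
  map_comp f g := by
    refine ModuleCat.hom_ext (Tens.hom_ext Φ fun v m => ?_)
    rfl

instance : (tensFunctor.{u, v, w} Φ).Additive where
  map_add {M N f g} := by
    refine ModuleCat.hom_ext (Tens.hom_ext Φ fun v m => ?_)
    change (Submodule.Quotient.mk (v ⊗ₜ (f.hom m + g.hom m)) : Tens Φ N) = _
    rw [TensorProduct.tmul_add]
    rfl

end Tensor

section Twist

universe u v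

variable {p : ℕ} [Fact p.Prime] {G : Type u} [Group G] [TopologicalSpace G]
  [IsTopologicalGroup G] [CompactSpace G] [T2Space G]

/-- A homomorphism `θ : G → ℤ_p` as a continuous function on `G`. -/
def thetaFun (θ : G →ₜ* Multiplicative ℤ_[p]) : C(G, ℤ_[p]) :=
  ⟨fun g => (θ g).toAdd, continuous_toAdd.comp (map_continuous θ)⟩

theorem weight_theta_mul (θ : G →ₜ* Multiplicative ℤ_[p]) (l m : Iwasawa ℤ_[p] G) :
    Iwasawa.weight (thetaFun θ) (l * m) =
      Iwasawa.weight (thetaFun θ) l * m + l * Iwasawa.weight (thetaFun θ) m := by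
  ext f
  rw [Iwasawa.add_apply, Iwasawa.weight_apply, Iwasawa.mul_apply, Iwasawa.mul_apply,
    Iwasawa.mul_apply, Iwasawa.weight_apply, ← map_add]
  congr 1
  refine ContinuousMap.ext fun x => ?_
  rw [Iwasawa.avg_apply]
  have : Iwasawa.translate (thetaFun θ * f) x =
      thetaFun θ x • Iwasawa.translate f x + thetaFun θ * Iwasawa.translate f x := by
    refine ContinuousMap.ext fun y => ?_
    change (θ (x * y)).toAdd * f (x * y) =
      (θ x).toAdd * f (x * y) + (θ y).toAdd * f (x * y)
    rw [map_mul, toAdd_mul, add_mul]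
  rw [this, map_add, map_smul]
  rfl

/-- The `Λ(G)`-module `M ⊗_{ℤ_p} E_θ`, where `E_θ = ℤ_p²` with `g ∈ G` acting by the matrix
`(1, θ(g); 0, 1)`; the pair `(x, y)` stands for `x ⊗ e₁ + y ⊗ e₂`. The diagonal action of `g` is
`(x, y) ↦ (g x + θ(g) g y, g y)`, and by linearity and continuity `λ ∈ Λ(G)` acts by
`(x, y) ↦ (λ x + (θ λ) y, λ y)`, where `θ λ` is the measure `f ↦ ∫ θ f dλ`. -/
def Twist (_ : G →ₜ* Multiplicative ℤ_[p]) (M : Type v) : Type v := M × M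

variable (θ : G →ₜ* Multiplicative ℤ_[p])

instance (M : Type v) [AddCommGroup M] : AddCommGroup (Twist θ M) :=
  inferInstanceAs (AddCommGroup (M × M))

theorem Twist.ext {M : Type v} {x y : Twist θ M} (h₁ : x.1 = y.1) (h₂ : x.2 = y.2) : x = y :=
  Prod.ext h₁ h₂

variable (M : Type v) [AddCommGroup M] [Module (Iwasawa ℤ_[p] G) M]

instance : Module (Iwasawa ℤ_[p] G) (Twist θ M) where
  smul l x := (l • x.1 + Iwasawa.weight (thetaFun θ) l • x.2, l • x.2)
  one_smul x := by
    refine Twist.ext θ ?_ (one_smul _ _)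
    change (1 : Iwasawa ℤ_[p] G) • x.1 + Iwasawa.weight (thetaFun θ) 1 • x.2 = x.1
    have : Iwasawa.weight (thetaFun θ) (1 : Iwasawa ℤ_[p] G) = 0 := by
      ext f
      rw [Iwasawa.weight_apply, Iwasawa.one_apply, Iwasawa.zero_apply]
      change (θ 1).toAdd * f 1 = 0
      rw [map_one, toAdd_one, zero_mul]
    rw [this, one_smul, zero_smul, add_zero]
  mul_smul l m x := by
    refine Twist.ext θ ?_ (mul_smul _ _ _)
    change (l * m) • x.1 + Iwasawa.weight (thetaFun θ) (l * m) • x.2 =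
      l • (m • x.1 + Iwasawa.weight (thetaFun θ) m • x.2) +
        Iwasawa.weight (thetaFun θ) l • m • x.2
    rw [weight_theta_mul, add_smul, mul_smul, mul_smul, mul_smul, smul_add]
    abel
  smul_zero l := by
    refine Twist.ext θ ?_ (smul_zero _)
    change l • (0 : M) + Iwasawa.weight (thetaFun θ) l • (0 : M) = 0
    rw [smul_zero, smul_zero, add_zero]
  smul_add l x y := by
    refine Twist.ext θ ?_ (smul_add _ _ _)
    change l • (x.1 + y.1) + Iwasawa.weight (thetaFun θ) l • (x.2 + y.2) =
      (l • x.1 + Iwasawa.weight (thetaFun θ) l • x.2) +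
        (l • y.1 + Iwasawa.weight (thetaFun θ) l • y.2)
    rw [smul_add, smul_add]
    abel
  add_smul l m x := by
    refine Twist.ext θ ?_ (add_smul _ _ _)
    change (l + m) • x.1 + Iwasawa.weight (thetaFun θ) (l + m) • x.2 =
      (l • x.1 + Iwasawa.weight (thetaFun θ) l • x.2) +
        (m • x.1 + Iwasawa.weight (thetaFun θ) m • x.2)
    have : Iwasawa.weight (thetaFun θ) (l + m) =
      Iwasawa.weight (thetaFun θ) l + Iwasawa.weight (thetaFun θ) m := rfl
    rw [this, add_smul, add_smul]
    abel
  zero_smul x := by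
    refine Twist.ext θ ?_ (zero_smul _ _)
    change (0 : Iwasawa ℤ_[p] G) • x.1 + Iwasawa.weight (thetaFun θ) 0 • x.2 = 0
    have : Iwasawa.weight (thetaFun θ) (0 : Iwasawa ℤ_[p] G) = 0 := rfl
    rw [this, zero_smul, zero_smul, add_zero]

theorem Twist.smul_def (l : Iwasawa ℤ_[p] G) (x : Twist θ M) :
    l • x = (l • x.1 + Iwasawa.weight (thetaFun θ) l • x.2, l • x.2) := rfl

/-- The inclusion `M = M ⊗ e₁ → M ⊗ E_θ`. -/
def Twist.incl : M →ₗ[Iwasawa ℤ_[p] G] Twist θ M where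
  toFun x := (x, 0)
  map_add' x y := Twist.ext θ rfl (add_zero (0 : M)).symm
  map_smul' l x := by
    refine Twist.ext θ ?_ (smul_zero l).symm
    change l • x = l • x + Iwasawa.weight (thetaFun θ) l • (0 : M)
    rw [smul_zero, add_zero]

/-- The projection `M ⊗ E_θ → M`, `x ⊗ e₁ + y ⊗ e₂ ↦ y`. -/
def Twist.proj : Twist θ M →ₗ[Iwasawa ℤ_[p] G] M where
  toFun x := x.2
  map_add' _ _ := rfl
  map_smul' _ _ := rfl

variable {M} in
/-- The map `M ⊗ E_θ → N ⊗ E_θ` induced by `f : M → N`. -/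
def Twist.map {N : Type v} [AddCommGroup N] [Module (Iwasawa ℤ_[p] G) N]
    (f : M →ₗ[Iwasawa ℤ_[p] G] N) : Twist θ M →ₗ[Iwasawa ℤ_[p] G] Twist θ N where
  toFun x := (f x.1, f x.2)
  map_add' x y := Twist.ext θ (map_add f _ _) (map_add f _ _)
  map_smul' l x := by
    rw [Twist.smul_def]
    refine Twist.ext θ ?_ (map_smul f _ _)
    change f (l • x.1 + Iwasawa.weight (thetaFun θ) l • x.2) =
      l • f x.1 + Iwasawa.weight (thetaFun θ) l • f x.2
    rw [map_add, map_smul, map_smul]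

/-- The functor `M ↦ M ⊗ E_θ` on `Λ(G)`-modules. -/
def twistFunctor : ModuleCat.{v} (Iwasawa ℤ_[p] G) ⥤ ModuleCat.{v} (Iwasawa ℤ_[p] G) where
  obj M := ModuleCat.of _ (Twist θ M)
  map f := ModuleCat.ofHom (Twist.map θ f.hom)

instance : (twistFunctor.{u, v} θ).Additive where

/-- The complex `A ⊗ E_θ`. -/
abbrev twistComplex (A : CochainComplex (ModuleCat.{v} (Iwasawa ℤ_[p] G)) ℤ) :
    CochainComplex (ModuleCat.{v} (Iwasawa ℤ_[p] G)) ℤ :=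
  ((twistFunctor θ).mapHomologicalComplex _).obj A

/-- The sequence `0 → A → A ⊗ E_θ → A → 0` of complexes of `Λ(G)`-modules. -/
def thetaSequence (A : CochainComplex (ModuleCat.{v} (Iwasawa ℤ_[p] G)) ℤ) :
    ShortComplex (CochainComplex (ModuleCat.{v} (Iwasawa ℤ_[p] G)) ℤ) where
  X₁ := A
  X₂ := twistComplex θ A
  X₃ := A
  f := { f := fun i => ModuleCat.ofHom (Twist.incl θ (A.X i))
         comm' := fun i j _ => by
          refine ModuleCat.hom_ext (LinearMap.ext fun x => ?_)
          exact Twist.ext θ rfl (map_zero (A.d i j).hom) }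
  g := { f := fun i => ModuleCat.ofHom (Twist.proj θ (A.X i))
         comm' := fun i j _ => rfl }
  zero := rfl

end Twist

section Complexes

universe u v w

/-- `A` is a bounded complex of finitely generated projective left `Λ`-modules. -/
structure IsStrictlyPerfect {Λ : Type u} [Ring Λ] (A : CochainComplex (ModuleCat.{v} Λ) ℤ) :
    Prop where
  finite : ∀ i, Module.Finite Λ (A.X i)
  projective : ∀ i, Module.Projective Λ (A.X i)
  bounded : ∃ a b : ℤ, ∀ i, i < a ∨ b < i → Subsingleton (A.X i)

variable {p : ℕ} [Fact p.Prime] {G : Type u} [Group G] [TopologicalSpace G]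
  [IsTopologicalGroup G] [CompactSpace G] [T2Space G]
  {S : Type w} [Ring S] {n : ℕ} (Φ : Iwasawa ℤ_[p] G →+* Matrix (Fin n) (Fin n) S)
  (θ : G →ₜ* Multiplicative ℤ_[p])
  {A : CochainComplex (ModuleCat.{v} (Iwasawa ℤ_[p] G)) ℤ}

variable (A) in
/-- The complex `S^n ⊗_Λ(G) A`. -/
abbrev tensComplex : CochainComplex (ModuleCat.{max v w} S) ℤ :=
  ((tensFunctor Φ).mapHomologicalComplex _).obj A

variable (A) in
/-- The sequence `0 → S^n ⊗ A → S^n ⊗ (A ⊗ E_θ) → S^n ⊗ A → 0`. -/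
def tensThetaSequence : ShortComplex (CochainComplex (ModuleCat.{max v w} S) ℤ) :=
  (thetaSequence θ A).map ((tensFunctor Φ).mapHomologicalComplex _)

theorem tensThetaSequence_shortExact (hA : IsStrictlyPerfect A) :
    (tensThetaSequence Φ θ A).ShortExact := by
  refine HomologicalComplex.shortExact_of_degreewise_shortExact _ fun i => ?_
  have := hA.projective i
  obtain ⟨s, hs⟩ := Module.projective_lifting_property (Twist.proj θ (A.X i)) LinearMap.id
    (fun x => ⟨((0 : A.X i), x), rfl⟩)
  let T := (thetaSequence θ A).map (HomologicalComplex.eval _ _ i)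
  have hex : T.Exact := by
    rw [ShortComplex.moduleCat_exact_iff]
    intro x hx
    exact ⟨Prod.fst x, Twist.ext θ rfl (Eq.symm hx)⟩
  have hmono : Mono T.f := by
    rw [ModuleCat.mono_iff_injective]
    intro x y h
    exact congrArg Prod.fst h
  have spl : T.Splitting :=
    ShortComplex.Splitting.ofExactOfSection T hex (ModuleCat.ofHom s) (ModuleCat.hom_ext hs) hmono
  exact (spl.map (tensFunctor Φ)).shortExact

/-- The Bockstein map `H^i(S^n ⊗_Λ(G) A) → H^j(S^n ⊗_Λ(G) A)`, `j = i + 1`, induced by the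
morphism `A → A[1]` that belongs to `0 → A → A ⊗ E_θ → A → 0`: the connecting homomorphism of the
sequence `0 → S^n ⊗ A → S^n ⊗ (A ⊗ E_θ) → S^n ⊗ A → 0`. (It is set to `0` if `j ≠ i + 1`.) As `A`
consists of projective modules, `H^i(S^n ⊗_Λ(G) A)` is the hypertor group in homological degree
`-i`. -/
def bockstein (hA : IsStrictlyPerfect A) (i j : ℤ) :
    (tensComplex Φ A).homology i →ₗ[S] (tensComplex Φ A).homology j :=
  if h : i + 1 = j then ((tensThetaSequence_shortExact Φ θ hA).δ i j h).hom else 0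

/-- The cohomology in degree `i` of the complex `(H^·(S^n ⊗ A), 𝔅)`. -/
abbrev BocksteinCohomology (hA : IsStrictlyPerfect A) (i : ℤ) : Type (max v w) :=
  LinearMap.ker (bockstein Φ θ hA i (i + 1)) ⧸
    (LinearMap.range (bockstein Φ θ hA (i - 1) i)).submoduleOf
      (LinearMap.ker (bockstein Φ θ hA i (i + 1)))

end Complexes

section LeadingTerm

universe u v w

variable {p : ℕ} [Fact p.Prime] {L : Type w} [NontriviallyNormedField L] [IsUltrametricDist L]
  [NormedAlgebra ℚ_[p] L] [FiniteDimensional ℚ_[p] L]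
  {G : Type u} [Group G] [TopologicalSpace G] [IsTopologicalGroup G] [CompactSpace G] [T2Space G]
  {n : ℕ} (ρ : G →ₜ* GL (Fin n) 𝒪[L]) (θ : G →ₜ* Multiplicative ℤ_[p])
  {A : CochainComplex (ModuleCat.{v} (Iwasawa ℤ_[p] G)) ℤ}

variable (p) in
/-- The ring homomorphism `Λ(G) → M_n(𝒪)` induced by `ρ`. The associated complex
`𝒪^n ⊗_Λ(G) A` computes the hyperhomology `ℍ_{-i}(G, A(ρ^*)) = H^i(𝒪^n ⊗_Λ(G) A)`. -/
def intHom : Iwasawa ℤ_[p] G →+* Matrix (Fin n) (Fin n) 𝒪[L] :=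
  (repHom ρ).comp (extend p L)

variable (p) in
/-- The ring homomorphism `Λ(G) → M_n(𝒪) → M_n(L)` induced by `ρ`. -/
def fieldHom : Iwasawa ℤ_[p] G →+* Matrix (Fin n) (Fin n) L :=
  (algebraMap 𝒪[L] L).mapMatrix.comp (intHom p ρ)

variable (p) in
/-- The ring homomorphism `Λ(G) → M_n(Λ_𝒪(Γ))`, `g ↦ ρ(g) θ(g)`, where `Γ` is identified with
`ℤ_p`, with `γ` corresponding to `1`. The associated complex is
`A_ρ = (Λ_𝒪(Γ) ⊗_𝒪 𝒪^n) ⊗_Λ(G) A`, and `ℍ_{-i}(H, A(ρ^*)) = H^i(A_ρ)`. -/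
def gammaHom : Iwasawa ℤ_[p] G →+*
    Matrix (Fin n) (Fin n) (Iwasawa 𝒪[L] (Multiplicative ℤ_[p])) :=
  (repHomΓ ρ θ).comp (extend p L)

/-- `A` is semisimple at `ρ`: the cohomology of `(ℍ_·(G, A(ρ^*)), 𝔅_·)` is `ℤ_p`-torsion in each
degree. -/
def IsSemisimpleAt (hA : IsStrictlyPerfect A) : Prop :=
  ∀ (i : ℤ) (x : BocksteinCohomology (intHom p ρ) θ hA i), ∃ k : ℕ, (p : 𝒪[L]) ^ k • x = 0

/-- The generalized additive Euler-Poincare characteristic: the alternating sum of the lengths of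
the cohomology modules of `(ℍ_{-·}(G, A(ρ^*)), 𝔅_{-·})`. -/
def chiAdd (hA : IsStrictlyPerfect A) : ℤ :=
  ∑ᶠ i : ℤ, (i.negOnePow : ℤ) *
    (Module.length 𝒪[L] (BocksteinCohomology (intHom p ρ) θ hA i)).toNat

/-- The generalized multiplicative Euler-Poincare characteristic. -/
def chiMult (hA : IsStrictlyPerfect A) : ℝ :=
  (Nat.card (IsLocalRing.ResidueField 𝒪[L]) : ℝ) ^ chiAdd ρ θ hA

/-- The `𝒪`-module `M^Γ` of all `x ∈ M` with `(γ - 1) x = 0`. -/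
def gammaInvariants (p : ℕ) [Fact p.Prime] (L : Type w) [NontriviallyNormedField L]
    [IsUltrametricDist L] (M : Type*) [AddCommGroup M]
    [Module (Iwasawa 𝒪[L] (Multiplicative ℤ_[p])) M] :
    Submodule 𝒪[L] (RestrictScalars 𝒪[L] (Iwasawa 𝒪[L] (Multiplicative ℤ_[p])) M) where
  carrier := {x | (Iwasawa.of (R := 𝒪[L]) (Multiplicative.ofAdd (1 : ℤ_[p])) - 1) •
    (RestrictScalars.addEquiv 𝒪[L] (Iwasawa 𝒪[L] (Multiplicative ℤ_[p])) M x) = 0}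
  zero_mem' := by simp
  add_mem' {x y} hx hy := by
    simp only [Set.mem_ofPred_eq] at hx hy ⊢
    rw [map_add, smul_add, hx, hy, add_zero]
  smul_mem' c x hx := by
    simp only [Set.mem_ofPred_eq] at hx ⊢
    rw [RestrictScalars.addEquiv_map_smul, ← mul_smul, ← Algebra.commutes, mul_smul, hx,
      smul_zero]

variable (A) in
/-- The integer `r_G(A)(ρ) = ∑ (-1)^(i+1) dim_L (ℍ_i(H, A(ρ^*))^Γ ⊗_𝒪 L)`. -/
def rG : ℤ :=
  ∑ᶠ i : ℤ, ((i + 1).negOnePow : ℤ) *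
    Module.finrank L (L ⊗[𝒪[L]] gammaInvariants p L ((tensComplex (gammaHom p ρ θ) A).homology i))

/-- A trivialization `a : 1 → d(A)` of the determinant of `A`. In the Picard category of pairs
`(P, Q)` of finitely generated projective `Λ`-modules (with `(P, Q)` standing for `d(P) d(Q)⁻¹`)
one has `1 = (0, 0)` and `d(A) = (⨁ A^{2i}, ⨁ A^{2i+1})`, and a morphism `(P, Q) → (P', Q')` is
the class of an isomorphism `P ⊕ Q' ⊕ R ≃ P' ⊕ Q ⊕ R` for some finitely generated projective `R`,
two isomorphisms being identified if they differ by an automorphism with trivial class in `K₁(Λ)`.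
Enlarging `R` one may take `R = Λ^m`. Thus every morphism `1 → d(A)` is represented by an
isomorphism `⨁ A^{2i+1} ⊕ Λ^m ≃ ⨁ A^{2i} ⊕ Λ^m`, and this structure is such a representative. -/
structure Trivialization {Λ : Type u} [Ring Λ] (A : CochainComplex (ModuleCat.{v} Λ) ℤ) where
  m : ℕ
  equiv : ((DirectSum ℤ fun i => A.X (2 * i + 1)) × (Fin m → Λ)) ≃ₗ[Λ]
    ((DirectSum ℤ fun i => A.X (2 * i)) × (Fin m → Λ))

/-- Data that realize the canonical trivialization `d_L(C) ≅ d_L(H(C)) ≅ 1`, where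
`C = L^n ⊗_Λ(G) A`. The maps `c`, `π`, `s` split `C` into its cohomology `H(C)` and an acyclic
complex that is contracted by `s`; they realize the canonical isomorphism `d_L(C) ≅ d_L(H(C))`.
The map `σ` is a contraction of the complex `(H(C), 𝔅)`; it realizes the isomorphism
`d_L(H(C)) ≅ 1` that exists because `(H(C), 𝔅)` is acyclic. -/
structure Splitting (hA : IsStrictlyPerfect A) where
  c (i : ℤ) : (tensComplex (fieldHom p ρ) A).homology i →ₗ[L] (tensComplex (fieldHom p ρ) A).cycles i
  π (i : ℤ) : (tensComplex (fieldHom p ρ) A).X i →ₗ[L] (tensComplex (fieldHom p ρ) A).homology i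
  s (i j : ℤ) : (tensComplex (fieldHom p ρ) A).X i →ₗ[L] (tensComplex (fieldHom p ρ) A).X j
  σ (i j : ℤ) :
    (tensComplex (fieldHom p ρ) A).homology i →ₗ[L] (tensComplex (fieldHom p ρ) A).homology j
  homologyπ_c : ∀ i, ((tensComplex (fieldHom p ρ) A).homologyπ i).hom ∘ₗ c i = LinearMap.id
  π_iCycles : ∀ i, π i ∘ₗ ((tensComplex (fieldHom p ρ) A).iCycles i).hom =
    ((tensComplex (fieldHom p ρ) A).homologyπ i).hom
  s_shape : ∀ i j, j + 1 ≠ i → s i j = 0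
  s_homotopy : ∀ i, ((tensComplex (fieldHom p ρ) A).d (i - 1) i).hom ∘ₗ s i (i - 1) +
    s (i + 1) i ∘ₗ ((tensComplex (fieldHom p ρ) A).d i (i + 1)).hom =
      LinearMap.id - ((tensComplex (fieldHom p ρ) A).iCycles i).hom ∘ₗ c i ∘ₗ π i
  s_s : ∀ i j k, s j k ∘ₗ s i j = 0
  s_c : ∀ i j, s i j ∘ₗ ((tensComplex (fieldHom p ρ) A).iCycles i).hom ∘ₗ c i = 0
  π_s : ∀ i j, π j ∘ₗ s i j = 0
  σ_shape : ∀ i j, j + 1 ≠ i → σ i j = 0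
  σ_homotopy : ∀ i, bockstein (fieldHom p ρ) θ hA (i - 1) i ∘ₗ σ i (i - 1) +
    σ (i + 1) i ∘ₗ bockstein (fieldHom p ρ) θ hA i (i + 1) = LinearMap.id
  σ_σ : ∀ i j k, σ j k ∘ₗ σ i j = 0

namespace Splitting

variable {ρ θ} {hA : IsStrictlyPerfect A} (D : Splitting ρ θ hA)

/-- The component `C^i → C^j` of the isomorphism `d + s + (𝔅 + σ)` between the even and the odd
part of `C` (`d + s` on the acyclic summand, `𝔅 + σ` on the summand `H(C)`). Its restriction
`⨁ C^{2i} → ⨁ C^{2i+1}` represents the canonical trivialization `d_L(C) → 1`. -/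
def t (i j : ℤ) : Tens (fieldHom p ρ) (A.X i) →ₗ[L] Tens (fieldHom p ρ) (A.X j) :=
  ((tensComplex (fieldHom p ρ) A).d i j).hom + D.s i j +
    ((tensComplex (fieldHom p ρ) A).iCycles j).hom ∘ₗ D.c j ∘ₗ
      (bockstein (fieldHom p ρ) θ hA i j + D.σ i j) ∘ₗ D.π i

/-- The map `t ⊕ id` from `L^n ⊗ (⨁ A^{2i} ⊕ Λ(G)^m)` to `L^n ⊗ (⨁ A^{2i+1} ⊕ Λ(G)^m)`. -/
def total (m : ℕ) :
    Tens (fieldHom p ρ) ((DirectSum ℤ fun i => A.X (2 * i)) × (Fin m → Iwasawa ℤ_[p] G)) →ₗ[L]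
    Tens (fieldHom p ρ) ((DirectSum ℤ fun i => A.X (2 * i + 1)) × (Fin m → Iwasawa ℤ_[p] G)) :=
  (∑ᶠ (i : ℤ) (j : ℤ),
    Tens.map (fieldHom p ρ) (LinearMap.inl (Iwasawa ℤ_[p] G) _ _ ∘ₗ
      DirectSum.lof (Iwasawa ℤ_[p] G) ℤ (fun k => A.X (2 * k + 1)) j) ∘ₗ
    D.t (2 * i) (2 * j + 1) ∘ₗ
    Tens.map (fieldHom p ρ) (DirectSum.component (Iwasawa ℤ_[p] G) ℤ (fun k => A.X (2 * k)) i ∘ₗ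
      LinearMap.fst (Iwasawa ℤ_[p] G) _ _)) +
  Tens.map (fieldHom p ρ) (LinearMap.inr (Iwasawa ℤ_[p] G) _ _ ∘ₗ
    LinearMap.snd (Iwasawa ℤ_[p] G) _ _)

end Splitting

/-- `x` is the leading term `(A, a)^*(ρ)`: the product of `(-1)^{r_G(A)(ρ)}` and the element of
`L^× = Aut(1_L)` that is the composite of `L^n ⊗ a : 1 → d_L(L^n ⊗ A)` and the canonical
trivialization `d_L(L^n ⊗ A) → 1`. -/
def IsLeadingTerm (hA : IsStrictlyPerfect A) (a : Trivialization A) (x : L) : Prop :=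
  ∃ D : Splitting ρ θ hA,
    x = ((rG ρ θ A).negOnePow : ℤ) *
      LinearMap.det (D.total a.m ∘ₗ Tens.map (fieldHom p ρ) a.equiv.toLinearMap)

/-- The valuation of `L` that takes the value `1` on uniformizing parameters (and, by convention,
the value `0` at `0`). -/
def ordL (p : ℕ) [Fact p.Prime] {L : Type w} [NontriviallyNormedField L] [IsUltrametricDist L]
    [NormedAlgebra ℚ_[p] L] [FiniteDimensional ℚ_[p] L] (x : L) : ℤ :=
  haveI := isDiscreteValuationRing_int p L; -WithZero.log ((IsDiscreteValuationRing.maximalIdeal 𝒪[L]).valuation L x)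

/-- The homomorphism `θ : G → G/H ≅ ℤ_p`. -/
def quotientHom (H : Subgroup G) [H.Normal] (e : (G ⧸ H) ≃ₜ* Multiplicative ℤ_[p]) :
    G →ₜ* Multiplicative ℤ_[p] where
  toMonoidHom := e.toMulEquiv.toMonoidHom.comp (QuotientGroup.mk' H)
  continuous_toFun := e.continuous_toFun.comp continuous_quotient_mk'

end LeadingTerm
end LeadingTerms

end

open LeadingTerms

/-! Write `R = 𝒪`, `K = L` and `C = R^n ⊗ A`, a bounded complex of finite free `R`-modules. The
statement compares a determinant over `K` with lengths over `R`. It follows once the Bockstein map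
is realized by an integral operator on `C` itself, so that semisimplicity becomes the rational
acyclicity of a perturbed complex.

A projective `Λ(G)`-module carries a connection `∇` along the derivation `λ ↦ θλ`
(`nonempty_connection`). The operator `β = d∇ - ∇d` is `Λ(G)`-linear, anticommutes with `d`, and
induces the Bockstein map on cohomology (`bockstein_homologyπ`). A second-order companion of `∇`,
built from the function `θ(θ-1)/2`, gives a null-homotopy of `β²` (`Connection.beta_comp_beta`). All
this is functorial in the coefficients, so it holds over `R` and over `K` at once.

Over `K`, a trivialization of `d(C)` is a projector `e` onto the cohomology with a contraction `s`
of its complement, and a contraction `τ` of the cohomology with respect to `b = eβe`. The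
determinant in question is that of the even-to-odd block of `d + s + b + τ`. Two choices of data are
intertwined by an explicit unipotent operator (`comparison_mul`, `comparison_sub_one_pow`), so the
determinant does not depend on them. This proves that the leading term is well defined. It also
allows the projector to be chosen integral: over the principal ideal domain `R` there is an `e`
defined over `R` whose image is a complement of the saturated boundaries in the cycles
(`exists_projector`). Then `D = d + eβe` is an integral differential that is acyclic over `K`, and
the determinant is the one attached to this acyclic complex.

For an acyclic complex the Smith normal form gives the order of the determinant as the length of the
odd cohomology minus that of the even cohomology (`exists_ord_det_of_contraction`). It remains to
compare the cohomology of `D` with that of the Bockstein map. The two differ because `D` forgets the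
action of `β` on torsion classes. In each parity the length for `D` exceeds the length for the
Bockstein map by the same amount `t`, the total length of the torsion classes of either parity that
lie in the image of the Bockstein map (`relLength_D`). Hence `t` cancels in the difference, which is
`-χ_add`. The determinant is a quotient `x₁ / x₀` of nonzero elements of `R`, which also makes `t`
and all the lengths finite. The sign `(-1)^r` changes neither valuation nor absolute value, and the
multiplicative formula follows from `|ϖ|^[L:ℚ_p] = (#κ_L)⁻¹`. -/

noncomputable section

namespace LeadingTerms

/-! ### Trivializations as identities in a ring of endomorphisms, and their comparison -/

section RingSplitting

variable {R : Type*} [Ring R]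

/-- Elements `s`, `e`, `b`, `τ` of a ring of endomorphisms that trivialize the complex with
differential `d` and Bockstein operator `β`: `s` contracts the complement of the image of the
projector `e` onto the cohomology, `b = e β e` is the Bockstein operator on the cohomology, and `τ`
contracts the cohomology with respect to `b`. -/
structure RingSplitting (d β s e b τ : R) : Prop where
  d_e : d * e = 0
  e_d : e * d = 0
  s_e : s * e = 0
  e_s : e * s = 0
  homotopy : d * s + s * d = 1 - e
  s_s : s * s = 0
  b_eq : b = e * β * e
  e_τ : e * τ = τ
  τ_e : τ * e = τ
  τ_τ : τ * τ = 0
  b_τ : b * τ + τ * b = e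

namespace RingSplitting

variable {d β h s e b τ s' e' b' τ' : R}

theorem map {R' : Type*} [Ring R'] (f : R →+* R') (H : RingSplitting d β s e b τ) :
    RingSplitting (f d) (f β) (f s) (f e) (f b) (f τ) where
  d_e := by rw [← map_mul, H.d_e, map_zero]
  e_d := by rw [← map_mul, H.e_d, map_zero]
  s_e := by rw [← map_mul, H.s_e, map_zero]
  e_s := by rw [← map_mul, H.e_s, map_zero]
  homotopy := by
    rw [← map_mul, ← map_mul, ← map_add, H.homotopy, map_sub, map_one]
  s_s := by rw [← map_mul, H.s_s, map_zero]
  b_eq := by rw [H.b_eq, map_mul, map_mul]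
  e_τ := by rw [← map_mul, H.e_τ]
  τ_e := by rw [← map_mul, H.τ_e]
  τ_τ := by rw [← map_mul, H.τ_τ, map_zero]
  b_τ := by rw [← map_mul, ← map_mul, ← map_add, H.b_τ]

theorem eq_one_sub (H : RingSplitting d β s e b τ) : e = 1 - (d * s + s * d) := by
  rw [H.homotopy]; abel

theorem e_e (H : RingSplitting d β s e b τ) : e * e = e := by
  nth_rw 2 [H.eq_one_sub]
  rw [mul_sub, mul_add, ← mul_assoc, ← mul_assoc, H.e_d, H.e_s]
  simp

theorem e_b (H : RingSplitting d β s e b τ) : e * b = b := by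
  rw [H.b_eq, ← mul_assoc, ← mul_assoc, H.e_e]

theorem b_e (H : RingSplitting d β s e b τ) : b * e = b := by
  rw [H.b_eq, mul_assoc, H.e_e]

theorem d_b (H : RingSplitting d β s e b τ) : d * b = 0 := by
  rw [← H.e_b, ← mul_assoc, H.d_e, zero_mul]

theorem b_d (H : RingSplitting d β s e b τ) : b * d = 0 := by
  rw [← H.b_e, mul_assoc, H.e_d, mul_zero]

theorem s_b (H : RingSplitting d β s e b τ) : s * b = 0 := by
  rw [← H.e_b, ← mul_assoc, H.s_e, zero_mul]

theorem b_s (H : RingSplitting d β s e b τ) : b * s = 0 := by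
  rw [← H.b_e, mul_assoc, H.e_s, mul_zero]

theorem d_τ (H : RingSplitting d β s e b τ) : d * τ = 0 := by
  rw [← H.e_τ, ← mul_assoc, H.d_e, zero_mul]

theorem τ_d (H : RingSplitting d β s e b τ) : τ * d = 0 := by
  rw [← H.τ_e, mul_assoc, H.e_d, mul_zero]

theorem s_τ (H : RingSplitting d β s e b τ) : s * τ = 0 := by
  rw [← H.e_τ, ← mul_assoc, H.s_e, zero_mul]

theorem τ_s (H : RingSplitting d β s e b τ) : τ * s = 0 := by
  rw [← H.τ_e, mul_assoc, H.e_s, mul_zero]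

theorem d_s_d (H : RingSplitting d β s e b τ) (hd : d * d = 0) : d * s * d = d := by
  have := congrArg (d * ·) H.homotopy
  simp only [mul_add, mul_sub, ← mul_assoc, hd, H.d_e] at this
  simpa using this

/-- The projectors of two splittings satisfy `e e' e = e`. -/
theorem e_e'_e (H : RingSplitting d β s e b τ) (H' : RingSplitting d β s' e' b' τ') :
    e * e' * e = e := by
  rw [H'.eq_one_sub]
  simp only [mul_add, mul_sub, add_mul, sub_mul, ← mul_assoc, H.e_d, mul_one]
  rw [H.e_e, mul_assoc (e * s'), H.d_e]
  simp

/-- The operator `e β e` squares to zero, because `β²` is null-homotopic. -/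
theorem b_b (H : RingSplitting d β s e b τ) (hβ : d * β + β * d = 0)
    (hh : β * β = d * h + h * d) : b * b = 0 := by
  have h1 : d * β = -(β * d) := eq_neg_of_add_eq_zero_left hβ
  have h3 : β * d = -(d * β) := by rw [h1, neg_neg]
  -- Substitute `e = 1 - (ds + sd)` for the inner projector and move each `d` past `β` with a sign,
  -- towards the outer factors `e`, which annihilate it. What survives is `eβ²e`, and this vanishes
  -- because `β²` is a homotopy boundary.
  have h2 : β * e * β = β * β + d * β * s * β + β * s * (β * d) := by
    have : β * e * β = β * β - (β * d) * s * β - β * s * (d * β) := by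
      rw [H.eq_one_sub]; noncomm_ring
    rw [this, h3, h1, h3]; noncomm_ring
  calc b * b = e * β * (e * e) * β * e := by rw [H.b_eq]; noncomm_ring
    _ = e * (β * e * β) * e := by rw [H.e_e]; noncomm_ring
    _ = (e * d) * h * e + e * h * (d * e) + (e * d) * β * s * β * e +
        e * β * s * β * (d * e) := by
      rw [h2, hh]; noncomm_ring
    _ = 0 := by rw [H.e_d, H.d_e]; simp

/-- Both sides equal `e'βe`. The inner projector in `e'·eβe` or `e'βe'·e` differs from the identity
by terms containing `d`, and such a `d`, moved past `β` if necessary, meets `e'` on the left or `e`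
on the right. -/
theorem e_b' (H : RingSplitting d β s e b τ) (H' : RingSplitting d β s' e' b' τ')
    (hβ : d * β + β * d = 0) : e' * b = b' * e := by
  have h1 : d * β = -(β * d) := eq_neg_of_add_eq_zero_left hβ
  have h3 : β * d = -(d * β) := by rw [h1, neg_neg]
  have l : e' * b = e' * β * e := by
    have : e' * b = e' * β * e - (e' * d) * s * β * e - e' * s * (d * β) * e := by
      rw [H.b_eq]; nth_rw 1 [H.eq_one_sub]; noncomm_ring
    rw [this, h1, H'.e_d]
    have : e' * s * -(β * d) * e = -(e' * s * β * (d * e)) := by noncomm_ring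
    rw [this, H.d_e]; simp
  have r : b' * e = e' * β * e := by
    have : b' * e = e' * β * e - e' * (β * d) * s' * e - e' * β * s' * (d * e) := by
      rw [H'.b_eq]; nth_rw 2 [H'.eq_one_sub]; noncomm_ring
    rw [this, h3, H.d_e]
    have : e' * -(d * β) * s' * e = -((e' * d) * β * s' * e) := by noncomm_ring
    rw [this, H'.e_d]; simp
  rw [l, r]

theorem e'_b_e' (H : RingSplitting d β s e b τ) (H' : RingSplitting d β s' e' b' τ')
    (hβ : d * β + β * d = 0) : e' * b * e' = b' := by
  rw [H.e_b' H' hβ, ← H'.b_e, mul_assoc, mul_assoc, ← mul_assoc e', H'.e_e'_e H]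

/-- The operator that compares two splittings. -/
def comparison (d s b τ s' e' τ' : R) : R := d * s + s' * d + e' * b * τ + τ' * b

/-- The idempotents `ds`, `sd`, `bτ`, `τb` of the first splitting add up to `1`. The comparison
operator leaves the boundaries fixed, moves the second piece by `s'd`, the third by `e'`, and the
fourth by `τ'b`. It therefore carries each of the four operators `d`, `s`, `b`, `τ` separately to
its counterpart, and the proof checks these four identities one by one. -/
theorem comparison_mul (H : RingSplitting d β s e b τ) (H' : RingSplitting d β s' e' b' τ')
    (hd : d * d = 0) (hβ : d * β + β * d = 0) (hh : β * β = d * h + h * d) :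
    comparison d s b τ s' e' τ' * (d + s + b + τ) =
      (d + s' + b' + τ') * comparison d s b τ s' e' τ' := by
  have hbb := H.b_b hβ hh
  have heb := H.e_b' H' hβ
  have hb'b : b' * b = 0 := by
    rw [← H.e_b, ← mul_assoc, ← heb, mul_assoc, hbb, mul_zero]
  have hbτb : b * τ * b = b := by
    have := congrArg (· * b) H.b_τ
    simp only [add_mul, mul_assoc, hbb, H.e_b] at this
    simpa [mul_assoc] using this
  have gd : comparison d s b τ s' e' τ' * d = d := by
    simp only [comparison, add_mul]
    rw [H.d_s_d hd, mul_assoc s', hd, mul_assoc _ τ, H.τ_d, mul_assoc τ', H.b_d]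
    simp
  have dg : d * comparison d s b τ s' e' τ' = d := by
    simp only [comparison, mul_add]
    rw [← mul_assoc, hd, ← mul_assoc, H'.d_s_d hd, ← mul_assoc, ← mul_assoc, H'.d_e, ← mul_assoc,
      H'.d_τ]
    simp
  have gs : comparison d s b τ s' e' τ' * s = s' * d * s := by
    simp only [comparison, add_mul]
    rw [mul_assoc d, H.s_s, mul_assoc _ τ, H.τ_s, mul_assoc τ', H.b_s]
    simp
  have sg : s' * comparison d s b τ s' e' τ' = s' * d * s := by
    simp only [comparison, mul_add]
    rw [← mul_assoc, ← mul_assoc, H'.s_s, ← mul_assoc, ← mul_assoc, H'.s_e, ← mul_assoc, H'.s_τ]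
    simp
  have gb : comparison d s b τ s' e' τ' * b = e' * b := by
    simp only [comparison, add_mul]
    rw [mul_assoc d, H.s_b, mul_assoc s', H.d_b, mul_assoc τ', hbb, mul_assoc e', mul_assoc e',
      hbτb]
    simp
  have bg : b' * comparison d s b τ s' e' τ' = e' * b := by
    simp only [comparison, mul_add]
    have h1 : b' * (τ' * b) = e' * b := by
      rw [← mul_assoc, eq_sub_of_add_eq H'.b_τ, sub_mul, mul_assoc, hb'b, mul_zero, sub_zero]
    rw [h1, ← mul_assoc, H'.b_d, ← mul_assoc, H'.b_s, ← mul_assoc, ← mul_assoc, H'.b_e, hb'b]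
    simp
  have gτ : comparison d s b τ s' e' τ' * τ = τ' * b * τ := by
    simp only [comparison, add_mul]
    rw [mul_assoc d, H.s_τ, mul_assoc s', H.d_τ, mul_assoc _ τ, H.τ_τ]
    simp
  have τg : τ' * comparison d s b τ s' e' τ' = τ' * b * τ := by
    simp only [comparison, mul_add]
    rw [← mul_assoc, H'.τ_d, ← mul_assoc, H'.τ_s, ← mul_assoc, ← mul_assoc, H'.τ_e, ← mul_assoc,
      H'.τ_τ]
    simp
  simp only [mul_add, add_mul, gd, dg, gs, sg, gb, bg, gτ, τg]

/-- The two splittings induce the same map on cohomology up to the canonical identification, so the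
comparison operator `g` can differ from `1` only in a triangular way. Since `g - 1` is annihilated
by `d` on both sides, `(g - 1)²` factors through `e'`. On the image of `e'` the operator `g - 1`
squares to zero, and these two facts together give exponent four. -/
theorem comparison_sub_one_pow (H : RingSplitting d β s e b τ)
    (H' : RingSplitting d β s' e' b' τ')
    (hd : d * d = 0) (hβ : d * β + β * d = 0) (hh : β * β = d * h + h * d) :
    (comparison d s b τ s' e' τ' - 1) ^ 4 = 0 := by
  have hbb := H.b_b hβ hh
  have hbb' := H'.b_b hβ hh
  have hbτb : b * τ * b = b := by
    have := congrArg (· * b) H.b_τ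
    simp only [add_mul, mul_assoc, hbb, H.e_b] at this
    simpa [mul_assoc] using this
  have hbτb' : b' * τ' * b' = b' := by
    have := congrArg (· * b') H'.b_τ
    simp only [add_mul, mul_assoc, hbb', H'.e_b] at this
    simpa [mul_assoc] using this
  have gd : comparison d s b τ s' e' τ' * d = d := by
    simp only [comparison, add_mul]
    rw [H.d_s_d hd, mul_assoc s', hd, mul_assoc _ τ, H.τ_d, mul_assoc τ', H.b_d]
    simp
  have dg : d * comparison d s b τ s' e' τ' = d := by
    simp only [comparison, mul_add]
    rw [← mul_assoc, hd, ← mul_assoc, H'.d_s_d hd, ← mul_assoc, ← mul_assoc, H'.d_e, ← mul_assoc,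
      H'.d_τ]
    simp
  -- The action of `g - 1` on the cohomology, seen through `e'`. It measures the difference of the
  -- two contractions `τ'` and `τ`.
  have ν : e' * (comparison d s b τ s' e' τ' - 1) * e' = (τ' - e' * τ) * b' := by
    have h1 : e' * (comparison d s b τ s' e' τ') * e' = e' * b * τ * e' + τ' * b * e' := by
      simp only [comparison, mul_add, add_mul]
      rw [← mul_assoc e' d, H'.e_d, ← mul_assoc e' s', H'.e_s, ← mul_assoc e' (e' * b),
        ← mul_assoc e' e', H'.e_e, ← mul_assoc e' τ', H'.e_τ]
      simp
    have h2 : τ' * b * e' = τ' * b' := by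
      rw [← H.e'_b_e' H' hβ, ← mul_assoc, ← mul_assoc, H'.τ_e]
    have h3 : e' * b * τ * e' = e' - e' * τ * b' := by
      have h4 : τ * b' = τ * b * e' := by
        rw [← H.e'_b_e' H' hβ]
        nth_rw 1 [← H.τ_e, ← H.e_b]
        calc τ * e * (e' * (e * b) * e') = τ * (e * e' * e) * b * e' := by noncomm_ring
          _ = τ * b * e' := by rw [H.e_e'_e H', H.τ_e]
      rw [mul_assoc e' b, eq_sub_of_add_eq H.b_τ, mul_assoc e' τ, h4, mul_sub, sub_mul,
        H'.e_e'_e H]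
      noncomm_ring
    rw [mul_sub, sub_mul, h1, h2, h3, mul_one, H'.e_e]
    noncomm_ring
  -- Both `τ'` and the transported `τ` are pseudo-inverses of `b'`, so `b'(τ' - e'τ)b' = b' - b' =
  -- 0`.
  have ν2 : ((τ' - e' * τ) * b') * ((τ' - e' * τ) * b') = 0 := by
    have h1 : b' * (e' * τ) * b' = b' := by
      calc b' * (e' * τ) * b' = (b' * e') * τ * b' := by noncomm_ring
        _ = e' * b * e' * τ * (e' * b * e') := by rw [H'.b_e, H.e'_b_e' H' hβ]
        _ = e' * (b * e) * e' * (e * τ * e) * e' * (e * b) * e' := by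
          rw [H.b_e, H.e_τ, H.τ_e, H.e_b]; noncomm_ring
        _ = e' * b * (e * e' * e) * τ * (e * e' * e) * b * e' := by noncomm_ring
        _ = e' * (b * e) * (τ * e) * b * e' := by rw [H.e_e'_e H']; noncomm_ring
        _ = e' * (b * τ * b) * e' := by rw [H.b_e, H.τ_e]; noncomm_ring
        _ = b' := by rw [hbτb, H.e'_b_e' H' hβ]
    calc ((τ' - e' * τ) * b') * ((τ' - e' * τ) * b')
        = (τ' - e' * τ) * (b' * τ' * b' - b' * (e' * τ) * b') := by noncomm_ring
      _ = 0 := by rw [hbτb', h1]; simp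
  generalize comparison d s b τ s' e' τ' = g at *
  have hNd : (g - 1) * d = 0 := by rw [sub_mul, gd, one_mul, sub_self]
  have hdN : d * (g - 1) = 0 := by rw [mul_sub, dg, mul_one, sub_self]
  -- Insert `1 = e' + ds' + s'd` between the factors. The last two terms disappear because `d` kills
  -- `g - 1` from either side.
  have hN2 : (g - 1) * (g - 1) = (g - 1) * e' * (g - 1) := by
    rw [H'.eq_one_sub]
    calc (g - 1) * (g - 1) = (g - 1) * (g - 1) - ((g - 1) * d) * s' * (g - 1) -
          (g - 1) * s' * (d * (g - 1)) := by rw [hNd, hdN]; simp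
      _ = _ := by noncomm_ring
  generalize g - 1 = N at *
  calc N ^ 4 = (N * N) * (N * N) := by noncomm_ring
    _ = (N * e' * N) * (N * e' * N) := by rw [hN2]
    _ = N * e' * (N * N) * e' * N := by noncomm_ring
    _ = N * e' * (N * e' * N) * e' * N := by rw [hN2]
    _ = N * e' * N * (e' * e') * N * e' * N := by rw [H'.e_e]; noncomm_ring
    _ = N * ((e' * N * e') * (e' * N * e')) * N := by noncomm_ring
    _ = 0 := by rw [ν, ν2]; simp

/-- Replacing the projector onto the cohomology in a splitting. -/
theorem change (H' : RingSplitting d β s' e' b' τ') (hβ : d * β + β * d = 0)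
    (d_e : d * e = 0) (e_d : e * d = 0) (s_e : s * e = 0) (e_s : e * s = 0)
    (homotopy : d * s + s * d = 1 - e) (s_s : s * s = 0) :
    RingSplitting d β s e (e * β * e) (e * τ' * e) := by
  have ee : e * e = e := by
    have h1 : e = 1 - (d * s + s * d) := by rw [homotopy]; abel
    nth_rw 2 [h1]
    rw [mul_sub, mul_add, ← mul_assoc, ← mul_assoc, e_d, e_s]
    simp
  have e'ee' : e' * e * e' = e' := by
    have h1 : e = 1 - (d * s + s * d) := by rw [homotopy]; abel
    rw [h1]
    simp only [mul_add, mul_sub, add_mul, sub_mul, ← mul_assoc, H'.e_d, mul_one]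
    rw [H'.e_e, mul_assoc (e' * s), H'.d_e]
    simp
  have ee'e : e * e' * e = e := by
    rw [H'.eq_one_sub]
    simp only [mul_add, mul_sub, add_mul, sub_mul, ← mul_assoc, e_d, mul_one]
    rw [ee, mul_assoc (e * s'), d_e]
    simp
  have h1 : d * β = -(β * d) := eq_neg_of_add_eq_zero_left hβ
  have h3 : β * d = -(d * β) := by rw [h1, neg_neg]
  -- Compressing `b'` by `e` gives again the Bockstein operator of `e`. Every correction term
  -- contains a `d` that reaches `e` or `e'` after anticommuting with `β`.
  have hb : e * b' * e = e * β * e := by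
    have : e * b' * e = e * β * e - (e * d) * s' * β * e - e * s' * (d * β) * e
        - e * (1 - (d * s' + s' * d)) * (β * d) * s' * e
        - e * (1 - (d * s' + s' * d)) * β * s' * (d * e) := by
      rw [H'.b_eq, H'.eq_one_sub]; noncomm_ring
    rw [this, h1, e_d, d_e]
    have h4 : e * s' * -(β * d) * e = -(e * s' * β * (d * e)) := by noncomm_ring
    have h5 : e * (1 - (d * s' + s' * d)) * (β * d) * s' * e = 0 := by
      rw [h3, ← H'.eq_one_sub]
      have : e * e' * -(d * β) * s' * e = - (e * (e' * d) * β * s' * e) := by noncomm_ring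
      rw [this, H'.e_d]; simp
    rw [h4, h5, d_e]; simp
  refine ⟨d_e, e_d, s_e, e_s, homotopy, s_s, rfl, ?_, ?_, ?_, ?_⟩
  · rw [← mul_assoc, ← mul_assoc, ee]
  · rw [mul_assoc, ee]
  · calc e * τ' * e * (e * τ' * e) = e * τ' * (e * e) * τ' * e := by noncomm_ring
      _ = e * (τ' * e') * e * (e' * τ') * e := by rw [ee, H'.τ_e, H'.e_τ]
      _ = e * τ' * (e' * e * e') * τ' * e := by noncomm_ring
      _ = e * ((τ' * e') * τ') * e := by rw [e'ee']; noncomm_ring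
      _ = 0 := by rw [H'.τ_e, H'.τ_τ]; simp
  · rw [← hb]
    calc e * b' * e * (e * τ' * e) + e * τ' * e * (e * b' * e)
        = e * b' * (e * e) * τ' * e + e * τ' * (e * e) * b' * e := by noncomm_ring
      _ = e * (b' * e') * e * (e' * τ') * e + e * (τ' * e') * e * (e' * b') * e := by
        rw [ee, H'.τ_e, H'.e_τ, H'.e_b, H'.b_e]
      _ = e * b' * (e' * e * e') * τ' * e + e * τ' * (e' * e * e') * b' * e := by noncomm_ring
      _ = e * ((b' * e') * τ' + (τ' * e') * b') * e := by rw [e'ee']; noncomm_ring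
      _ = e := by rw [H'.b_e, H'.τ_e, H'.b_τ, ee'e]

/-- A splitting for `d` and `β` is a contraction of the differential `d + b`. -/
theorem contraction (H : RingSplitting d β s e b τ) :
    RingSplitting (d + b) 0 (s + τ) 0 0 0 where
  d_e := mul_zero _
  e_d := zero_mul _
  s_e := mul_zero _
  e_s := zero_mul _
  homotopy := by
    have : (d + b) * (s + τ) + (s + τ) * (d + b) = (d * s + s * d) + (b * τ + τ * b) + d * τ +
      b * s + s * b + τ * d := by noncomm_ring
    rw [this, H.d_τ, H.b_s, H.s_b, H.τ_d, H.homotopy, H.b_τ]; abel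
  s_s := by
    have : (s + τ) * (s + τ) = s * s + τ * τ + s * τ + τ * s := by noncomm_ring
    rw [this, H.s_s, H.τ_τ, H.s_τ, H.τ_s]; simp
  b_eq := by simp
  e_τ := by simp
  τ_e := by simp
  τ_τ := by simp
  b_τ := by simp

end RingSplitting
end RingSplitting

/-! ### Even and odd endomorphisms of a `ℤ/2`-graded module -/

section BlockMatrices

variable {K V₀ V₁ : Type*} [CommRing K] [AddCommGroup V₀] [Module K V₀] [AddCommGroup V₁] [Module K V₁]

/-- The endomorphism of `V₀ × V₁` with off-diagonal components `x₀ : V₀ → V₁`, `x₁ : V₁ → V₀`. -/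
def offDiag {R M₀ M₁ : Type*} [CommRing R] [AddCommGroup M₀] [Module R M₀] [AddCommGroup M₁]
    [Module R M₁] (x₀ : M₀ →ₗ[R] M₁) (x₁ : M₁ →ₗ[R] M₀) : Module.End R (M₀ × M₁) :=
  LinearMap.prod (x₁ ∘ₗ LinearMap.snd R M₀ M₁) (x₀ ∘ₗ LinearMap.fst R M₀ M₁)

/-- The component `V₀ → V₁` of an endomorphism of `V₀ × V₁`. -/
def block₀₁ (x : Module.End K (V₀ × V₁)) : V₀ →ₗ[K] V₁ :=
  LinearMap.snd K V₀ V₁ ∘ₗ x ∘ₗ LinearMap.inl K V₀ V₁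

/-- The projector of `V₀ × V₁` onto `V₀`. -/
def evenProj : Module.End K (V₀ × V₁) := LinearMap.inl K V₀ V₁ ∘ₗ LinearMap.fst K V₀ V₁

/-- An endomorphism of `V₀ × V₁` is odd if its diagonal components vanish. -/
def IsOddEnd (x : Module.End K (V₀ × V₁)) : Prop := x * evenProj = (1 - evenProj) * x

/-- An endomorphism of `V₀ × V₁` is even if its off-diagonal components vanish. -/
def IsEvenEnd (x : Module.End K (V₀ × V₁)) : Prop := x * evenProj = evenProj * x

theorem IsOddEnd.add {x y : Module.End K (V₀ × V₁)} (hx : IsOddEnd x) (hy : IsOddEnd y) :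
    IsOddEnd (x + y) := by
  unfold IsOddEnd at *; rw [add_mul, mul_add, hx, hy]

theorem IsEvenEnd.add {x y : Module.End K (V₀ × V₁)} (hx : IsEvenEnd x) (hy : IsEvenEnd y) :
    IsEvenEnd (x + y) := by
  unfold IsEvenEnd at *; rw [add_mul, mul_add, hx, hy]

theorem IsEvenEnd.sub {x y : Module.End K (V₀ × V₁)} (hx : IsEvenEnd x) (hy : IsEvenEnd y) :
    IsEvenEnd (x - y) := by
  unfold IsEvenEnd at *; rw [sub_mul, mul_sub, hx, hy]

theorem IsEvenEnd.one : IsEvenEnd (1 : Module.End K (V₀ × V₁)) := by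
  unfold IsEvenEnd; rw [one_mul, mul_one]

theorem IsOddEnd.mul {x y : Module.End K (V₀ × V₁)} (hx : IsOddEnd x) (hy : IsOddEnd y) :
    IsEvenEnd (x * y) := by
  unfold IsOddEnd IsEvenEnd at *
  calc x * y * evenProj = x * y - (x * evenProj) * y := by
          rw [mul_assoc, hy, sub_mul, one_mul, mul_sub, mul_assoc x]
    _ = evenProj * (x * y) := by
      rw [hx, sub_mul, one_mul, sub_mul, sub_sub_cancel, mul_assoc]

theorem IsEvenEnd.mul_odd {x y : Module.End K (V₀ × V₁)} (hx : IsEvenEnd x) (hy : IsOddEnd y) :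
    IsOddEnd (x * y) := by
  unfold IsOddEnd IsEvenEnd at *
  calc x * y * evenProj = x * y - (x * evenProj) * y := by
          rw [mul_assoc, hy, sub_mul, one_mul, mul_sub, mul_assoc x]
    _ = (1 - evenProj) * (x * y) := by rw [hx, sub_mul, one_mul, mul_assoc]

theorem isOddEnd_offDiag (x₀ : V₀ →ₗ[K] V₁) (x₁ : V₁ →ₗ[K] V₀) : IsOddEnd (offDiag x₀ x₁) := by
  refine LinearMap.ext fun v => ?_
  simp [offDiag, evenProj]

theorem block₀₁_offDiag (x₀ : V₀ →ₗ[K] V₁) (x₁ : V₁ →ₗ[K] V₀) : block₀₁ (offDiag x₀ x₁) = x₀ := by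
  ext v
  simp [block₀₁, offDiag]

theorem IsEvenEnd.apply_inl {x : Module.End K (V₀ × V₁)} (hx : IsEvenEnd x) (v : V₀) :
    x (v, 0) = ((x (v, 0)).1, 0) := by
  simpa [evenProj] using LinearMap.congr_fun hx (v, 0)

theorem IsEvenEnd.apply_inr {x : Module.End K (V₀ × V₁)} (hx : IsEvenEnd x) (v : V₁) :
    x (0, v) = (0, (x (0, v)).2) := by
  have h1 : x (0, 0) = ((x (0, v)).1, 0) := by
    simpa [evenProj] using LinearMap.congr_fun hx (0, v)
  rw [Prod.mk_zero_zero, map_zero] at h1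
  exact Prod.ext (congrArg Prod.fst h1).symm rfl

theorem IsOddEnd.apply_inl {x : Module.End K (V₀ × V₁)} (hx : IsOddEnd x) (v : V₀) :
    x (v, 0) = (0, (x (v, 0)).2) := by
  have h1 : x (v, 0) = x (v, 0) - ((x (v, 0)).1, 0) := by
    simpa [evenProj] using LinearMap.congr_fun hx (v, 0)
  refine Prod.ext ?_ rfl
  simpa using congrArg Prod.fst h1

/-- The component `V₁ → V₀` of an endomorphism of `V₀ × V₁`. -/
def block₁₀ (x : Module.End K (V₀ × V₁)) : V₁ →ₗ[K] V₀ :=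
  LinearMap.fst K V₀ V₁ ∘ₗ x ∘ₗ LinearMap.inr K V₀ V₁

theorem IsOddEnd.offDiag_block {x : Module.End K (V₀ × V₁)} (hx : IsOddEnd x) :
    offDiag (block₀₁ x) (block₁₀ x) = x := by
  have h2 : ∀ v : V₁, (x (0, v)).2 = 0 := fun v => by
    have h1 : x (0, 0) = x (0, v) - ((x (0, v)).1, 0) := by
      simpa [evenProj] using LinearMap.congr_fun hx (0, v)
    rw [Prod.mk_zero_zero, map_zero] at h1
    simpa using (congrArg Prod.snd h1).symm
  refine LinearMap.ext fun v => ?_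
  have h3 : x v = x (v.1, 0) + x (0, v.2) := by rw [← map_add]; simp
  rw [h3, hx.apply_inl]
  refine Prod.ext ?_ ?_
  · simp [offDiag, block₁₀]
  · simp [offDiag, block₀₁, h2]

end BlockMatrices

/-! ### Independence of the determinant from the splitting -/

section BlockDeterminants

variable {K V₀ V₁ : Type*} [Field K] [AddCommGroup V₀] [Module K V₀] [AddCommGroup V₁] [Module K V₁]

/-- The characteristic polynomial of the nilpotent map `1 - g` is a power of `X`. Its value at `1`
is the determinant of `1 - (1 - g) = g`. -/
theorem det_eq_one_of_sub_one_pow {V : Type*} [AddCommGroup V] [Module K V] [FiniteDimensional K V]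
    {g : Module.End K V} {k : ℕ} (h : (g - 1) ^ k = 0) : LinearMap.det g = 1 := by
  have h1 := IsNilpotent.charpoly_eq_X_pow_finrank (φ := 1 - g)
    ⟨k, by rw [← neg_sub, neg_pow, h, mul_zero]⟩
  have h2 := LinearMap.eval_charpoly (1 - g) 1
  rw [h1] at h2
  simpa using h2.symm

/-- Two splittings of the same complex give the same determinant. -/
theorem RingSplitting.det_block_eq [FiniteDimensional K V₀] [FiniteDimensional K V₁]
    {d β h s e b τ s' e' b' τ' : Module.End K (V₀ × V₁)}
    (H : RingSplitting d β s e b τ) (H' : RingSplitting d β s' e' b' τ')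
    (hd : d * d = 0) (hβ : d * β + β * d = 0) (hh : β * β = d * h + h * d)
    (od : IsOddEnd d) (os : IsOddEnd s) (ob : IsOddEnd b) (oτ : IsOddEnd τ)
    (os' : IsOddEnd s') (oτ' : IsOddEnd τ') (α : V₁ ≃ₗ[K] V₀) :
    LinearMap.det (block₀₁ (d + s + b + τ) ∘ₗ α.toLinearMap) =
      LinearMap.det (block₀₁ (d + s' + b' + τ') ∘ₗ α.toLinearMap) := by
  have oe' : IsEvenEnd e' := by
    rw [H'.eq_one_sub]
    exact IsEvenEnd.one.sub ((od.mul os').add (os'.mul od))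
  have og : IsEvenEnd (comparison d s b τ s' e' τ') :=
    (((od.mul os).add (os'.mul od)).add ((oe'.mul_odd ob).mul oτ)).add (oτ'.mul ob)
  have hg := H.comparison_mul H' hd hβ hh
  have hN := H.comparison_sub_one_pow H' hd hβ hh
  have oT : IsOddEnd (d + s + b + τ) := ((od.add os).add ob).add oτ
  generalize comparison d s b τ s' e' τ' = g at *
  generalize d + s + b + τ = T at *
  generalize d + s' + b' + τ' = T' at *
  let g₀ : Module.End K V₀ := LinearMap.fst K V₀ V₁ ∘ₗ g ∘ₗ LinearMap.inl K V₀ V₁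
  let g₁ : Module.End K V₁ := LinearMap.snd K V₀ V₁ ∘ₗ g ∘ₗ LinearMap.inr K V₀ V₁
  have e₀ : ∀ v, g (v, 0) = (g₀ v, 0) := fun v => og.apply_inl v
  have e₁ : ∀ v, g (0, v) = (0, g₁ v) := fun v => og.apply_inr v
  have n₀ : (g₀ - 1) ^ 4 = 0 := by
    have : ∀ (k : ℕ) v, ((g - 1) ^ k) (v, 0) = (((g₀ - 1) ^ k) v, 0) := by
      intro k
      induction k with
      | zero => intro v; simp
      | succ k ih =>
        intro v
        rw [pow_succ, pow_succ, Module.End.mul_apply, Module.End.mul_apply, ← ih]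
        simp [e₀]
    ext v
    have h1 := this 4 v
    rw [hN] at h1
    exact (congrArg Prod.fst h1).symm
  have n₁ : (g₁ - 1) ^ 4 = 0 := by
    have : ∀ (k : ℕ) v, ((g - 1) ^ k) (0, v) = (0, ((g₁ - 1) ^ k) v) := by
      intro k
      induction k with
      | zero => intro v; simp
      | succ k ih =>
        intro v
        rw [pow_succ, pow_succ, Module.End.mul_apply, Module.End.mul_apply, ← ih]
        simp [e₁]
    ext v
    have h1 := this 4 v
    rw [hN] at h1
    exact (congrArg Prod.snd h1).symm
  have comm : g₁ ∘ₗ block₀₁ T = block₀₁ T' ∘ₗ g₀ := by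
    ext v
    have h1 := LinearMap.congr_fun hg (v, 0)
    rw [Module.End.mul_apply, Module.End.mul_apply, e₀, oT.apply_inl, e₁] at h1
    exact (Prod.ext_iff.mp h1).2
  -- The even operator `g` restricts to unipotent maps `g₀`, `g₁` of the two halves. After
  -- conjugating `g₀` by `α` the intertwining relation becomes one between endomorphisms of `V₁`,
  -- and both unipotent factors have determinant one.
  have h2 : g₁ ∘ₗ (block₀₁ T ∘ₗ α.toLinearMap) =
      (block₀₁ T' ∘ₗ α.toLinearMap) ∘ₗ (α.symm.toLinearMap ∘ₗ g₀ ∘ₗ α.symm.symm.toLinearMap) := by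
    rw [← LinearMap.comp_assoc, comm]
    ext v
    simp
  have h3 := congrArg LinearMap.det h2
  rw [LinearMap.det_comp, LinearMap.det_comp, LinearMap.det_conj, det_eq_one_of_sub_one_pow n₀,
    det_eq_one_of_sub_one_pow n₁, one_mul, mul_one] at h3
  exact h3

end BlockDeterminants

/-! ### Lengths of subquotients -/

section RelLength

variable {R M N : Type*} [CommRing R] [AddCommGroup M] [Module R M] [AddCommGroup N] [Module R N]

/-- The length of `B / A`. -/
def relLength (A B : Submodule R M) : ℕ∞ := Module.length R (B ⧸ A.submoduleOf B)

/-- The map `B / A → B' / A'` induced by `f` is surjective by `hB` and injective by `hA`. All later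
comparisons of lengths are instances of this. -/
theorem relLength_eq_of_map {A B : Submodule R M} {A' B' : Submodule R N} (f : M →ₗ[R] N)
    (hB : B.map f ⊔ A' = B') (hA : ∀ x ∈ B, f x ∈ A' ↔ x ∈ A) : relLength A B = relLength A' B' := by
  have hf : ∀ x ∈ B, f x ∈ B' := fun x hx => hB ▸ Submodule.mem_sup_left ⟨x, hx, rfl⟩
  let F : B →ₗ[R] B' ⧸ A'.submoduleOf B' := (A'.submoduleOf B').mkQ ∘ₗ f.restrict hf
  have hker : LinearMap.ker F = A.submoduleOf B := by
    ext x
    rw [LinearMap.mem_ker, LinearMap.comp_apply, Submodule.mkQ_apply,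
      Submodule.Quotient.mk_eq_zero]
    exact hA x x.2
  have hsurj : Function.Surjective F := by
    intro y
    obtain ⟨⟨y, hy⟩, rfl⟩ := Submodule.mkQ_surjective _ y
    obtain ⟨_, ⟨x, hx, rfl⟩, a, ha, rfl⟩ := Submodule.mem_sup.mp (hB ▸ hy : y ∈ B.map f ⊔ A')
    refine ⟨⟨x, hx⟩, (Submodule.Quotient.eq _).mpr ?_⟩
    change f x - (f x + a) ∈ A'
    simpa using ha
  unfold relLength
  rw [← hker]
  exact (F.quotKerEquivOfSurjective hsurj).length_eq

theorem relLength_add {A B C : Submodule R M} (hAB : A ≤ B) (hBC : B ≤ C) :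
    relLength A C = relLength A B + relLength B C := by
  let f : (B ⧸ A.submoduleOf B) →ₗ[R] (C ⧸ A.submoduleOf C) :=
    Submodule.mapQ _ _ (Submodule.inclusion hBC) (fun x hx => hx)
  let g : (C ⧸ A.submoduleOf C) →ₗ[R] (C ⧸ B.submoduleOf C) :=
    Submodule.mapQ _ _ LinearMap.id (fun x hx => hAB hx)
  refine Module.length_eq_add_of_exact f g ?_ ?_ ?_
  · rw [← LinearMap.ker_eq_bot, LinearMap.ker_eq_bot']
    intro x hx
    obtain ⟨x, rfl⟩ := Submodule.mkQ_surjective _ x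
    exact (Submodule.Quotient.mk_eq_zero _).mpr ((Submodule.Quotient.mk_eq_zero (A.submoduleOf C)
      (x := Submodule.inclusion hBC x)).mp hx)
  · intro x
    obtain ⟨x, rfl⟩ := Submodule.mkQ_surjective _ x
    exact ⟨Submodule.Quotient.mk x, rfl⟩
  · intro x
    obtain ⟨x, rfl⟩ := Submodule.mkQ_surjective _ x
    constructor
    · intro hx
      have hx' : (x : M) ∈ B := (Submodule.Quotient.mk_eq_zero (B.submoduleOf C)
        (x := x)).mp hx
      exact ⟨Submodule.Quotient.mk ⟨x, hx'⟩, rfl⟩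
    · rintro ⟨y, hy⟩
      obtain ⟨y, rfl⟩ := Submodule.mkQ_surjective _ y
      rw [← hy]
      exact (Submodule.Quotient.mk_eq_zero _).mpr y.2

end RelLength

/-! ### `ℤ/2`-graded complexes with a Bockstein operator; lengths after perturbing the differential
-/

section BocksteinPair

/-- A `ℤ/2`-graded complex with differential `d` and an operator `β` that anticommutes with `d` and
whose square is homotopic to zero. -/
structure BocksteinPair (R C₀ C₁ : Type*) [CommRing R] [AddCommGroup C₀] [Module R C₀]
    [AddCommGroup C₁] [Module R C₁] where
  d₀ : C₀ →ₗ[R] C₁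
  d₁ : C₁ →ₗ[R] C₀
  β₀ : C₀ →ₗ[R] C₁
  β₁ : C₁ →ₗ[R] C₀
  h₀ : C₀ →ₗ[R] C₁
  h₁ : C₁ →ₗ[R] C₀
  d_d₀ : d₁ ∘ₗ d₀ = 0
  d_d₁ : d₀ ∘ₗ d₁ = 0
  d_β₀ : d₁ ∘ₗ β₀ + β₁ ∘ₗ d₀ = 0
  d_β₁ : d₀ ∘ₗ β₁ + β₀ ∘ₗ d₁ = 0
  β_β₀ : β₁ ∘ₗ β₀ = d₁ ∘ₗ h₀ + h₁ ∘ₗ d₀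
  β_β₁ : β₀ ∘ₗ β₁ = d₀ ∘ₗ h₁ + h₀ ∘ₗ d₁

namespace BocksteinPair

variable {R C₀ C₁ : Type*} [CommRing R] [AddCommGroup C₀] [Module R C₀] [AddCommGroup C₁]
  [Module R C₁] (X : BocksteinPair R C₀ C₁)

/-- The same complex with the roles of even and odd degrees exchanged. -/
def swap : BocksteinPair R C₁ C₀ where
  d₀ := X.d₁
  d₁ := X.d₀
  β₀ := X.β₁
  β₁ := X.β₀
  h₀ := X.h₁
  h₁ := X.h₀
  d_d₀ := X.d_d₁
  d_d₁ := X.d_d₀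
  d_β₀ := X.d_β₁
  d_β₁ := X.d_β₀
  β_β₀ := X.β_β₁
  β_β₁ := X.β_β₀

/-- The even cycles that represent classes in the kernel of the Bockstein map. -/
def kerB : Submodule R C₀ := LinearMap.ker X.d₀ ⊓ (LinearMap.range X.d₀).comap X.β₀

/-- The even cycles that represent classes in the image of the Bockstein map. -/
def imB : Submodule R C₀ := LinearMap.range X.d₁ ⊔ (LinearMap.ker X.d₁).map X.β₁

theorem d_d₀_apply (x : C₀) : X.d₁ (X.d₀ x) = 0 := LinearMap.congr_fun X.d_d₀ x

theorem d_β₀_apply (x : C₀) : X.d₁ (X.β₀ x) = -X.β₁ (X.d₀ x) :=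
  eq_neg_of_add_eq_zero_left (LinearMap.congr_fun X.d_β₀ x)

theorem β_d₀_apply (x : C₀) : X.β₁ (X.d₀ x) = -X.d₁ (X.β₀ x) := by
  rw [X.d_β₀_apply, neg_neg]

theorem d_d₁_apply (x : C₁) : X.d₀ (X.d₁ x) = 0 := LinearMap.congr_fun X.d_d₁ x

theorem d_β₁_apply (x : C₁) : X.d₀ (X.β₁ x) = -X.β₀ (X.d₁ x) := X.swap.d_β₀_apply x

theorem β_d₁_apply (x : C₁) : X.β₀ (X.d₁ x) = -X.d₀ (X.β₁ x) := X.swap.β_d₀_apply x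

theorem β_β₁_apply (x : C₁) : X.β₀ (X.β₁ x) = X.d₀ (X.h₁ x) + X.h₀ (X.d₁ x) :=
  LinearMap.congr_fun X.β_β₁ x

/-- For boundaries this is the anticommutation of `β` with `d`. For images `β y` of cycles `y` it is
the null-homotopy of `β²`, which exhibits `β(β y)` as the boundary of `h y`. -/
theorem imB_le_kerB : X.imB ≤ X.kerB := by
  refine sup_le ?_ ?_
  · rintro _ ⟨y, rfl⟩
    exact ⟨X.d_d₁_apply y, ⟨-X.β₁ y, by rw [map_neg, X.β_d₁_apply]⟩⟩
  · rintro _ ⟨y, hy, rfl⟩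
    have hy : X.d₁ y = 0 := hy
    refine ⟨?_, X.h₁ y, ?_⟩
    · change X.d₀ (X.β₁ y) = 0
      rw [X.d_β₁_apply, hy, map_zero, neg_zero]
    · rw [X.β_β₁_apply, hy, map_zero, add_zero]

/-- A pair of projectors of the complex onto a complement of the saturated boundaries in the
cycles. -/
structure Projector where
  e₀ : C₀ →ₗ[R] C₀
  e₁ : C₁ →ₗ[R] C₁
  e_e₀ : e₀ ∘ₗ e₀ = e₀
  e_e₁ : e₁ ∘ₗ e₁ = e₁
  e_d₀ : e₁ ∘ₗ X.d₀ = 0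
  e_d₁ : e₀ ∘ₗ X.d₁ = 0
  d_e₀ : X.d₀ ∘ₗ e₀ = 0
  d_e₁ : X.d₁ ∘ₗ e₁ = 0
  sat₀ : ∀ z, X.d₀ z = 0 → e₀ z = 0 → ∃ a ∈ nonZeroDivisors R, a • z ∈ LinearMap.range X.d₁
  sat₁ : ∀ z, X.d₁ z = 0 → e₁ z = 0 → ∃ a ∈ nonZeroDivisors R, a • z ∈ LinearMap.range X.d₀

namespace Projector

variable {X} (E : X.Projector)

/-- The projectors with the roles of even and odd degrees exchanged. -/
def swap : X.swap.Projector where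
  e₀ := E.e₁
  e₁ := E.e₀
  e_e₀ := E.e_e₁
  e_e₁ := E.e_e₀
  e_d₀ := E.e_d₁
  e_d₁ := E.e_d₀
  d_e₀ := E.d_e₁
  d_e₁ := E.d_e₀
  sat₀ := E.sat₁
  sat₁ := E.sat₀

/-- The differential `d + e β e` in even degrees. -/
def D₀ : C₀ →ₗ[R] C₁ := X.d₀ + E.e₁ ∘ₗ X.β₀ ∘ₗ E.e₀

/-- The differential `d + e β e` in odd degrees. -/
def D₁ : C₁ →ₗ[R] C₀ := X.d₁ + E.e₀ ∘ₗ X.β₁ ∘ₗ E.e₁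

/-- The saturation of the even boundaries. -/
def satB : Submodule R C₀ := LinearMap.ker X.d₀ ⊓ LinearMap.ker E.e₀

/-- The length of the torsion of the even cohomology that is in the image of the Bockstein map. -/
def torsionDefect : ℕ∞ := relLength (LinearMap.range X.d₁)
  (LinearMap.range X.d₁ ⊔ ((LinearMap.ker X.d₁).map X.β₁ ⊓ E.satB))

theorem sub_e_mem {z : C₀} (hz : X.d₀ z = 0) : z - E.e₀ z ∈ E.satB := by
  constructor
  · change X.d₀ (z - E.e₀ z) = 0
    rw [map_sub, hz, zero_sub, neg_eq_zero]
    exact LinearMap.congr_fun E.d_e₀ z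
  · change E.e₀ (z - E.e₀ z) = 0
    rw [map_sub, sub_eq_zero]
    exact (LinearMap.congr_fun E.e_e₀ z).symm

theorem range_le_satB : LinearMap.range X.d₁ ≤ E.satB := by
  rintro _ ⟨y, rfl⟩
  exact ⟨X.d_d₁_apply y, LinearMap.congr_fun E.e_d₁ y⟩

/-- The submodule `satB` consists of the cycles with torsion class, and a linear map sends torsion
classes to torsion classes. Concretely, a multiple of `z` is a boundary, so the same multiple of `e
(β z)` is `e` of a boundary, hence zero. -/
theorem β_mem_satB (htf : ∀ a ∈ nonZeroDivisors R, ∀ x : C₁, a • x = 0 → x = 0) {z : C₀}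
    (hz : z ∈ E.satB) : X.β₀ z ∈ E.swap.satB := by
  obtain ⟨a, ha, y, hy⟩ := E.sat₀ z hz.1 hz.2
  have hz1 : X.d₀ z = 0 := hz.1
  constructor
  · change X.d₁ (X.β₀ z) = 0
    rw [X.d_β₀_apply, hz1, map_zero, neg_zero]
  · refine htf a ha _ ?_
    change a • E.e₁ (X.β₀ z) = 0
    rw [← map_smul, ← map_smul, ← hy, X.β_d₁_apply, map_neg, neg_eq_zero]
    exact LinearMap.congr_fun E.e_d₀ _

theorem D₀_apply (x : C₀) : E.D₀ x = X.d₀ x + E.e₁ (X.β₀ (E.e₀ x)) := rfl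

theorem D₁_apply (x : C₁) : E.D₁ x = X.d₁ x + E.e₀ (X.β₁ (E.e₁ x)) := rfl

/-- On cycles the inner projector may be dropped, because `z - e z` has torsion class and so has its
image under `β`, which `e` annihilates. -/
theorem e_β_e (htf : ∀ a ∈ nonZeroDivisors R, ∀ x : C₁, a • x = 0 → x = 0) {z : C₀}
    (hz : X.d₀ z = 0) : E.e₁ (X.β₀ (E.e₀ z)) = E.e₁ (X.β₀ z) := by
  have h1 : E.e₁ (X.β₀ (z - E.e₀ z)) = 0 := (E.β_mem_satB htf (E.sub_e_mem hz)).2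
  rw [map_sub, map_sub, sub_eq_zero] at h1
  exact h1.symm

/-- The two summands of `D₀ x` are independent: applying `e₁` kills `d x` and fixes the other one.
Thus `D₀ x = 0` says that `x` is a cycle whose Bockstein class is torsion. -/
theorem ker_D₀ (htf : ∀ a ∈ nonZeroDivisors R, ∀ x : C₁, a • x = 0 → x = 0) :
    LinearMap.ker E.D₀ = LinearMap.ker X.d₀ ⊓ E.swap.satB.comap X.β₀ := by
  ext x
  rw [LinearMap.mem_ker, E.D₀_apply]
  constructor
  · intro h
    have h1 : E.e₁ (X.β₀ (E.e₀ x)) = 0 := by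
      have := congrArg E.e₁ h
      rw [map_add, map_zero] at this
      rwa [show E.e₁ (X.d₀ x) = 0 from LinearMap.congr_fun E.e_d₀ x, zero_add,
        show E.e₁ (E.e₁ (X.β₀ (E.e₀ x))) = _ from LinearMap.congr_fun E.e_e₁ _] at this
    have h2 : X.d₀ x = 0 := by rwa [h1, add_zero] at h
    refine ⟨h2, ?_, ?_⟩
    · change X.d₁ (X.β₀ x) = 0
      rw [X.d_β₀_apply, h2, map_zero, neg_zero]
    · change E.e₁ (X.β₀ x) = 0
      rw [← E.e_β_e htf h2, h1]
  · rintro ⟨h1, h2⟩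
    have h1 : X.d₀ x = 0 := h1
    have h2 : E.e₁ (X.β₀ x) = 0 := h2.2
    rw [h1, E.e_β_e htf h1, h2, add_zero]

/-- Evaluation of `D₁` at `y - e y` isolates the summand `d y`, since `d e = 0` and `e (y - e y) =
0`. The next lemma isolates the other summand by evaluation at `e y`. -/
theorem d_mem_range_D₁ (y : C₁) : X.d₁ y ∈ LinearMap.range E.D₁ := by
  refine ⟨y - E.e₁ y, ?_⟩
  rw [E.D₁_apply, map_sub, map_sub, show E.e₁ (E.e₁ y) = _ from LinearMap.congr_fun E.e_e₁ y,
    show X.d₁ (E.e₁ y) = 0 from LinearMap.congr_fun E.d_e₁ y]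
  simp

theorem e_β_e_mem_range_D₁ (y : C₁) : E.e₀ (X.β₁ (E.e₁ y)) ∈ LinearMap.range E.D₁ := by
  refine ⟨E.e₁ y, ?_⟩
  rw [E.D₁_apply, show E.e₁ (E.e₁ y) = _ from LinearMap.congr_fun E.e_e₁ y,
    show X.d₁ (E.e₁ y) = 0 from LinearMap.congr_fun E.d_e₁ y, zero_add]

/-- The even cohomology of `d + e β e` compared with the cohomology of the Bockstein map. -/
theorem relLength_D (htf₀ : ∀ a ∈ nonZeroDivisors R, ∀ x : C₀, a • x = 0 → x = 0)
    (htf₁ : ∀ a ∈ nonZeroDivisors R, ∀ x : C₁, a • x = 0 → x = 0) :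
    relLength (LinearMap.range E.D₁) (LinearMap.ker E.D₀) =
      relLength X.imB X.kerB + (E.torsionDefect + E.swap.torsionDefect) := by
  -- In terms of the cohomology `H` and its torsion `T`, the submodule `W` is the preimage of the
  -- classes with torsion image under the Bockstein map `𝔅`. The count below uses the chains from
  -- `range D₁`, and from `imB`, through `satB ⊔ βZ` to `W`, together with `imB ≤ kerB ≤ W`.
  set W := LinearMap.ker E.D₀ with hW
  rw [E.ker_D₀ htf₁] at hW
  set βZ := (LinearMap.ker X.d₁).map X.β₁ with hβZ
  have hdW : E.satB ≤ W := by
    intro z hz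
    rw [hW]
    exact ⟨hz.1, E.β_mem_satB htf₁ hz⟩
  have hUW : X.kerB ≤ W := by
    rintro z ⟨h1, h2⟩
    rw [hW]
    exact ⟨h1, E.swap.range_le_satB h2⟩
  have hβU : βZ ≤ X.kerB := le_sup_right.trans X.imB_le_kerB
  have hβker : ∀ x ∈ βZ, X.d₀ x = 0 := fun x hx => (hβU hx).1
  -- The operator `β` identifies `W / kerB` with the odd torsion classes in the image of `𝔅`.
  have h1 : relLength X.kerB W = E.swap.torsionDefect := by
    refine relLength_eq_of_map X.β₀ ?_ ?_
    · rw [sup_comm]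
      change LinearMap.range X.d₀ ⊔ _ = LinearMap.range X.d₀ ⊔ _
      congr 1
      ext y
      constructor
      · rintro ⟨x, hx, rfl⟩
        rw [hW] at hx
        exact ⟨⟨x, hx.1, rfl⟩, hx.2⟩
      · rintro ⟨⟨x, hx, rfl⟩, hy⟩
        refine ⟨x, ?_, rfl⟩
        rw [hW]
        exact ⟨hx, hy⟩
    · intro x hx
      rw [hW] at hx
      exact ⟨fun h => ⟨hx.1, h⟩, fun h => h.2⟩
  -- Second isomorphism theorem with the modular law: `(T + im 𝔅) / im 𝔅 = T / (T ∩ im 𝔅)`.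
  have h2 : relLength X.imB (E.satB ⊔ βZ) =
      relLength (LinearMap.range X.d₁ ⊔ (βZ ⊓ E.satB)) E.satB := by
    symm
    refine relLength_eq_of_map LinearMap.id ?_ ?_
    · rw [Submodule.map_id]
      change E.satB ⊔ (LinearMap.range X.d₁ ⊔ βZ) = _
      rw [← sup_assoc, sup_eq_left.mpr E.range_le_satB]
    · intro x hx
      have : X.imB ⊓ E.satB = LinearMap.range X.d₁ ⊔ (βZ ⊓ E.satB) :=
        (sup_inf_assoc_of_le _ E.range_le_satB)
      rw [← this]
      exact ⟨fun h => ⟨h, hx⟩, fun h => h.1⟩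
  -- The images of `D₁` and of `β` on cycles agree modulo `satB`, and `range D₁` meets `satB`
  -- exactly in the boundaries. So this quotient has the length of `T`.
  have h3 : relLength (LinearMap.range E.D₁) (E.satB ⊔ βZ) =
      relLength (LinearMap.range X.d₁) E.satB := by
    symm
    refine relLength_eq_of_map LinearMap.id ?_ ?_
    · rw [Submodule.map_id]
      refine le_antisymm (sup_le le_sup_left ?_) (sup_le le_sup_left ?_)
      · rintro _ ⟨y, rfl⟩
        rw [E.D₁_apply]
        refine add_mem (Submodule.mem_sup_left (E.range_le_satB ⟨y, rfl⟩)) ?_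
        have hy : X.β₁ (E.e₁ y) ∈ βZ := ⟨E.e₁ y, LinearMap.congr_fun E.d_e₁ y, rfl⟩
        have := sub_mem (Submodule.mem_sup_right hy)
          (Submodule.mem_sup_left (T := βZ) (E.sub_e_mem (hβker _ hy)))
        rwa [sub_sub_cancel] at this
      · rintro _ ⟨z, hz, rfl⟩
        have hz : X.d₁ z = 0 := hz
        have hy : X.β₁ (E.e₁ z) ∈ βZ := ⟨E.e₁ z, LinearMap.congr_fun E.d_e₁ z, rfl⟩
        have k1 : X.β₁ (z - E.e₁ z) ∈ E.satB := E.swap.β_mem_satB htf₀ (E.swap.sub_e_mem hz)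
        have k2 := E.sub_e_mem (hβker _ hy)
        have : X.β₁ z = (X.β₁ (z - E.e₁ z) + (X.β₁ (E.e₁ z) - E.e₀ (X.β₁ (E.e₁ z)))) +
            E.e₀ (X.β₁ (E.e₁ z)) := by rw [map_sub]; abel
        rw [this]
        exact add_mem (Submodule.mem_sup_left (add_mem k1 k2))
          (Submodule.mem_sup_right (E.e_β_e_mem_range_D₁ z))
    · intro x hx
      constructor
      · rintro ⟨y, hy⟩
        have hy : E.D₁ y = x := hy
        have hx2 : E.e₀ x = 0 := hx.2
        rw [← hy, E.D₁_apply, map_add,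
          show E.e₀ (E.e₀ (X.β₁ (E.e₁ y))) = _ from LinearMap.congr_fun E.e_e₀ _,
          show E.e₀ (X.d₁ y) = 0 from LinearMap.congr_fun E.e_d₁ y, zero_add] at hx2
        rw [E.D₁_apply, hx2, add_zero] at hy
        exact ⟨y, hy⟩
      · rintro ⟨y, rfl⟩
        exact E.d_mem_range_D₁ y
  have h4 : LinearMap.range E.D₁ ≤ E.satB ⊔ βZ := by
    rintro _ ⟨y, rfl⟩
    rw [E.D₁_apply]
    refine add_mem (Submodule.mem_sup_left (E.range_le_satB ⟨y, rfl⟩)) ?_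
    have hy : X.β₁ (E.e₁ y) ∈ βZ := ⟨E.e₁ y, LinearMap.congr_fun E.d_e₁ y, rfl⟩
    have := sub_mem (Submodule.mem_sup_right hy)
      (Submodule.mem_sup_left (T := βZ) (E.sub_e_mem (hβker _ hy)))
    rwa [sub_sub_cancel] at this
  have h5 : E.satB ⊔ βZ ≤ W := sup_le hdW (hβU.trans hUW)
  have h6 : X.imB ≤ E.satB ⊔ βZ := sup_le_sup_right E.range_le_satB _
  have h7 : relLength (LinearMap.range X.d₁) E.satB = E.torsionDefect +
      relLength (LinearMap.range X.d₁ ⊔ (βZ ⊓ E.satB)) E.satB :=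
    relLength_add le_sup_left (sup_le E.range_le_satB inf_le_right)
  -- By `h3` and `h7` the quotient `(satB ⊔ βZ) / range D₁` exceeds `(satB ⊔ βZ) / imB` by the even
  -- defect. Completing both up to `W`, and then splitting `W / imB` at `kerB`, adds the odd defect
  -- from `h1`.
  rw [relLength_add h4 h5, h3, h7, ← h2, add_assoc, ← relLength_add h6 h5,
    relLength_add X.imB_le_kerB hUW, h1]
  ring

end Projector
end BocksteinPair
end BocksteinPair

/-! ### Determinants, projectors and contractions over a principal ideal domain -/

section PrincipalIdealDomain

set_option linter.unusedSectionVars false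

variable {R : Type*} [CommRing R] [IsDomain R] [IsPrincipalIdealRing R]

/-- The length of the cokernel of an injective endomorphism of a finite free module is the order of
its determinant. -/
theorem length_quotient_range_eq_ord_det {M : Type*} [AddCommGroup M] [Module R M]
    [Module.Free R M] [Module.Finite R M] (f : M →ₗ[R] M) (hf : Function.Injective f) :
    Module.length R (M ⧸ LinearMap.range f) = Ring.ord R (LinearMap.det f) := by
  classical
  let b := Module.Free.chooseBasis R M
  have h : Module.finrank R (LinearMap.range f) = Module.finrank R M :=
    LinearMap.finrank_range_of_inj hf
  let a := Submodule.smithNormalFormCoeffs b h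
  let b' := Submodule.smithNormalFormTopBasis b h
  let ab := Submodule.smithNormalFormBotBasis b h
  have hab : ∀ i, (ab i : M) = a i • b' i := Submodule.smithNormalFormBotBasis_def b h
  let ε := LinearEquiv.ofInjective f hf
  -- The automorphism that makes `f ∘ ψ` diagonal in the basis `b'`, with the Smith coefficients as
  -- entries. Being invertible it changes the determinant only by a unit.
  let ψ : M ≃ₗ[R] M := b'.equiv ab (Equiv.refl _) ≪≫ₗ ε.symm
  have hψ : f ∘ₗ ψ.toLinearMap = Matrix.toLin b' b' (Matrix.diagonal a) := by
    refine b'.ext fun i => ?_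
    have h1 : f (ψ (b' i)) = ab i := by
      have : f (ψ (b' i)) = ε (ψ (b' i)) := rfl
      rw [this]
      simp [ψ]
    rw [LinearMap.comp_apply, Matrix.toLin_self]
    change f (ψ (b' i)) = _
    rw [h1, hab, Finset.sum_eq_single i]
    · simp
    · intro j _ hj; simp [Matrix.diagonal_apply_ne _ hj]
    · simp
  have hdet : LinearMap.det f * LinearMap.det ψ.toLinearMap = ∏ i, a i := by
    rw [← LinearMap.det_comp, hψ, LinearMap.det_toLin, Matrix.det_diagonal]
  have ha : ∀ i, a i ≠ 0 := by
    intro i h0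
    have : (ab i : M) = 0 := by rw [hab, h0, zero_smul]
    exact ab.ne_zero i (Subtype.ext this)
  have hprod : ∀ s : Finset (Module.Free.ChooseBasisIndex R M),
      Ring.ord R (∏ i ∈ s, a i) = ∑ i ∈ s, Ring.ord R (a i) := by
    intro s
    induction s using Finset.induction_on with
    | empty => simp
    | insert i s hi ih =>
      rw [Finset.prod_insert hi, Finset.sum_insert hi, ← ih]
      exact Ring.ord_mul R (mem_nonZeroDivisors_of_ne_zero (Finset.prod_ne_zero_iff.mpr
        fun j _ => ha j))
  have e := Submodule.quotientEquivPiSpan (LinearMap.range f) b h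
  rw [e.length_eq, Module.length_pi_of_fintype]
  change ∑ i, Ring.ord R (a i) = _
  rw [← hprod, ← hdet]
  exact Ring.ord_mul_of_isUnit_right (LinearEquiv.isUnit_det' ψ) _

/-- The image of `f` is a finitely generated torsion-free module over a principal ideal domain,
hence free, so the surjection of `M` onto it splits. -/
theorem exists_proj_ker {M N : Type*} [AddCommGroup M] [Module R M] [AddCommGroup N] [Module R N]
    [Module.Finite R N] [Module.IsTorsionFree R N] (f : M →ₗ[R] N) :
    ∃ p : M →ₗ[R] M, f ∘ₗ p = 0 ∧ ∀ x, f x = 0 → p x = x := by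
  have : Module.IsTorsionFree R (LinearMap.range f) := inferInstance
  have : Module.Free R (LinearMap.range f) := inferInstance
  obtain ⟨s, hs⟩ := Module.projective_lifting_property f.rangeRestrict LinearMap.id
    f.surjective_rangeRestrict
  refine ⟨LinearMap.id - s ∘ₗ f.rangeRestrict, ?_, ?_⟩
  · ext x
    have := congrArg Subtype.val (LinearMap.congr_fun hs (f.rangeRestrict x))
    simp only [LinearMap.comp_apply, LinearMap.id_apply] at this
    simp only [LinearMap.comp_apply, LinearMap.sub_apply, LinearMap.id_apply, map_sub,
      LinearMap.zero_apply, sub_eq_zero]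
    exact this.symm
  · intro x hx
    have : f.rangeRestrict x = 0 := Subtype.ext hx
    simp [this]

/-- The saturation of the image of `g` is the kernel of the map from `M` to the torsion-free
quotient of `M / im g`, so `exists_proj_ker` applies to that map. -/
theorem exists_proj_saturation {M N : Type*} [AddCommGroup M] [Module R M] [AddCommGroup N]
    [Module R N] [Module.Finite R M] (g : N →ₗ[R] M) :
    ∃ q : M →ₗ[R] M, q ∘ₗ g = g ∧ q ∘ₗ q = q ∧
      ∀ x, ∃ a ∈ nonZeroDivisors R, a • q x ∈ LinearMap.range g := by
  let T := Submodule.torsion R (M ⧸ LinearMap.range g)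
  let φ : M →ₗ[R] ((M ⧸ LinearMap.range g) ⧸ T) := T.mkQ ∘ₗ (LinearMap.range g).mkQ
  obtain ⟨q, h1, h2⟩ := exists_proj_ker φ
  refine ⟨q, ?_, ?_, ?_⟩
  · ext x
    refine h2 _ ?_
    have : (LinearMap.range g).mkQ (g x) = 0 := by simp
    simp only [φ, LinearMap.comp_apply, this, map_zero]
  · ext x
    exact h2 _ (LinearMap.congr_fun h1 x)
  · intro x
    have h3 : T.mkQ ((LinearMap.range g).mkQ (q x)) = 0 := LinearMap.congr_fun h1 x
    rw [Submodule.mkQ_apply, Submodule.Quotient.mk_eq_zero] at h3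
    obtain ⟨a, ha⟩ := (Submodule.mem_torsion_iff _).mp h3
    refine ⟨a, a.2, ?_⟩
    rw [← Submodule.Quotient.mk_eq_zero]
    exact ha

/-- A section of `f` over the saturation exists only up to denominators. On each basis vector a
multiple `a i` suffices, and the product of these finitely many constants works for all of them.
Composition with `P` normalizes the values. -/
theorem exists_quasi_inverse {M N : Type*} [AddCommGroup M] [Module R M] [AddCommGroup N]
    [Module R N] [Module.Finite R N] [Module.Free R N] (f : M →ₗ[R] N) (P : M →ₗ[R] M)
    (q : N →ₗ[R] N) (hfP : f ∘ₗ P = f) (hPP : P ∘ₗ P = P)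
    (hq : ∀ y, ∃ a ∈ nonZeroDivisors R, a • q y ∈ LinearMap.range f) :
    ∃ a : R, a ≠ 0 ∧ ∃ u : N →ₗ[R] M, f ∘ₗ u = a • q ∧ P ∘ₗ u = u := by
  classical
  let b := Module.Free.chooseBasis R N
  choose a ha x hx using fun i => hq (b i)
  let c := ∏ i, a i
  have hc : ∀ i, ∃ r, c = r * a i := fun i => by
    obtain ⟨r, hr⟩ := Finset.dvd_prod_of_mem a (Finset.mem_univ i)
    exact ⟨r, by rw [mul_comm]; exact hr⟩
  choose r hr using hc
  refine ⟨c, Finset.prod_ne_zero_iff.mpr fun i _ => nonZeroDivisors.ne_zero (ha i),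
    b.constr R fun i => P (r i • x i), b.ext fun i => ?_, b.ext fun i => ?_⟩
  · rw [LinearMap.comp_apply, Module.Basis.constr_basis,
      show f (P (r i • x i)) = f (r i • x i) from LinearMap.congr_fun hfP _, map_smul, hx,
      LinearMap.smul_apply, hr i, mul_smul]
  · rw [LinearMap.comp_apply, Module.Basis.constr_basis]
    exact LinearMap.congr_fun hPP _

/-- Compatible projections of a module `M` in a complex `N → M → N`: `P` has the kernel of `f`, and
`q` has the saturation of the image of `g` as its image. -/
theorem exists_projections {M N : Type*} [AddCommGroup M] [Module R M] [AddCommGroup N]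
    [Module R N] [Module.Finite R M] [Module.Finite R N] [Module.IsTorsionFree R N]
    (f : M →ₗ[R] N) (g : N →ₗ[R] M) (hfg : f ∘ₗ g = 0) :
    ∃ P q : M →ₗ[R] M, f ∘ₗ P = f ∧ P ∘ₗ P = P ∧ (∀ x, f x = 0 → P x = 0) ∧ q ∘ₗ g = g ∧
      f ∘ₗ q = 0 ∧ P ∘ₗ q = 0 ∧ q ∘ₗ P = 0 ∧ q ∘ₗ q = q ∧
      ∀ x, ∃ a ∈ nonZeroDivisors R, a • q x ∈ LinearMap.range g := by
  obtain ⟨p, hfp, hp⟩ := exists_proj_ker f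
  obtain ⟨q, hqg, hqq, hq⟩ := exists_proj_saturation g
  have hfp' : ∀ x, f (p x) = 0 := fun x => LinearMap.congr_fun hfp x
  have hpp : ∀ x, p (p x) = p x := fun x => hp _ (hfp' x)
  have hfq : ∀ x, f (q x) = 0 := by
    intro x
    obtain ⟨a, ha, y, hy⟩ := hq x
    have h1 : a • f (q x) = 0 := by
      rw [← map_smul, ← hy]
      exact LinearMap.congr_fun hfg y
    exact (smul_eq_zero.mp h1).resolve_left (nonZeroDivisors.ne_zero ha)
  have hpq : ∀ x, p (q x) = q x := fun x => hp _ (hfq x)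
  have hqq' : ∀ x, q (q x) = q x := fun x => LinearMap.congr_fun hqq x
  -- The projector `q` is replaced by `q ∘ p`, which has the same image and in addition annihilates
  -- the image of `1 - p`. This makes the two projectors orthogonal.
  refine ⟨LinearMap.id - p, q ∘ₗ p, ?_, ?_, ?_, ?_, ?_, ?_, ?_, ?_, fun x => hq (p x)⟩
  · ext x; simp [hfp']
  · ext x; simp [hpp]
  · intro x hx; simp [hp x hx]
  · ext x
    have : f (g x) = 0 := LinearMap.congr_fun hfg x
    rw [LinearMap.comp_apply, LinearMap.comp_apply, hp _ this]
    exact LinearMap.congr_fun hqg x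
  · ext x; simp [hfq]
  · ext x; simp [hpq]
  · ext x; simp [hpp]
  · ext x; simp [hpq, hqq']

namespace BocksteinPair

/-- A contraction of the complement of the image of a projector, multiplied by a nonzero constant
`a` so that it is integral. -/
structure Projector.Contraction {R C₀ C₁ : Type*} [CommRing R] [AddCommGroup C₀] [Module R C₀]
    [AddCommGroup C₁] [Module R C₁] {X : BocksteinPair R C₀ C₁} (E : X.Projector) where
  a : R
  a_ne_zero : a ≠ 0
  u₀ : C₀ →ₗ[R] C₁
  u₁ : C₁ →ₗ[R] C₀
  P₀ : C₀ →ₗ[R] C₀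
  P₁ : C₁ →ₗ[R] C₁
  u_d₀ : u₁ ∘ₗ X.d₀ = a • P₀
  u_d₁ : u₀ ∘ₗ X.d₁ = a • P₁
  d_u₀ : X.d₁ ∘ₗ u₀ = a • (LinearMap.id - E.e₀ - P₀)
  d_u₁ : X.d₀ ∘ₗ u₁ = a • (LinearMap.id - E.e₁ - P₁)
  u_u₀ : u₁ ∘ₗ u₀ = 0
  u_u₁ : u₀ ∘ₗ u₁ = 0
  u_e₀ : u₀ ∘ₗ E.e₀ = 0
  u_e₁ : u₁ ∘ₗ E.e₁ = 0
  e_u₀ : E.e₁ ∘ₗ u₀ = 0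
  e_u₁ : E.e₀ ∘ₗ u₁ = 0
  P_P₀ : P₀ ∘ₗ P₀ = P₀
  P_P₁ : P₁ ∘ₗ P₁ = P₁

variable {C₀ C₁ : Type*} [AddCommGroup C₀] [Module R C₀] [AddCommGroup C₁] [Module R C₁]
  [Module.Finite R C₀] [Module.Finite R C₁] [Module.Free R C₀] [Module.Free R C₁]

/-- With `P` a projector along the cycles and `q` an orthogonal projector onto the saturated
boundaries, the complementary projector `1 - q - P` maps onto a complement of the saturated
boundaries in the cycles. The quasi-inverses of the differentials supply the contraction. -/
theorem exists_projector (X : BocksteinPair R C₀ C₁) : ∃ E : X.Projector, Nonempty E.Contraction := by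
  obtain ⟨P₀, q₀, fP₀, PP₀, kP₀, qg₀, fq₀, Pq₀, qP₀, qq₀, hs₀⟩ :=
    exists_projections X.d₀ X.d₁ X.d_d₁
  obtain ⟨P₁, q₁, fP₁, PP₁, kP₁, qg₁, fq₁, Pq₁, qP₁, qq₁, hs₁⟩ :=
    exists_projections X.d₁ X.d₀ X.d_d₀
  obtain ⟨a₁, ha₁, u₁, du₁, Pu₁⟩ := exists_quasi_inverse X.d₀ P₀ q₁ fP₀ PP₀ hs₁
  obtain ⟨a₀, ha₀, u₀, du₀, Pu₀⟩ := exists_quasi_inverse X.d₁ P₁ q₀ fP₁ PP₁ hs₀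
  simp only [LinearMap.ext_iff, LinearMap.comp_apply, LinearMap.zero_apply,
    LinearMap.smul_apply] at *
  have Pd₀ : ∀ x, P₁ (X.d₀ x) = 0 := fun x => kP₁ _ (X.d_d₀_apply x)
  have Pd₁ : ∀ x, P₀ (X.d₁ x) = 0 := fun x => kP₀ _ (X.d_d₁_apply x)
  -- Both sides are fixed by `P₀` and have the same image under `d`, and `d` is injective on the
  -- image of `P₀`. The next identities are obtained in the same way.
  have ud₁ : ∀ x, u₁ (X.d₀ x) = a₁ • P₀ x := by
    intro x
    have h1 := kP₀ (u₁ (X.d₀ x) - a₁ • P₀ x) (by rw [map_sub, du₁, map_smul, fP₀, qg₁, sub_self])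
    rwa [map_sub, map_smul, PP₀, Pu₁, sub_eq_zero] at h1
  have ud₀ : ∀ x, u₀ (X.d₁ x) = a₀ • P₁ x := by
    intro x
    have h1 := kP₁ (u₀ (X.d₁ x) - a₀ • P₁ x) (by rw [map_sub, du₀, map_smul, fP₁, qg₀, sub_self])
    rwa [map_sub, map_smul, PP₁, Pu₀, sub_eq_zero] at h1
  have uq₁ : ∀ x, u₁ (q₁ x) = u₁ x := by
    intro x
    have h1 := kP₀ (u₁ (q₁ x) - u₁ x) (by rw [map_sub, du₁, du₁, qq₁, sub_self])
    rwa [map_sub, Pu₁, Pu₁, sub_eq_zero] at h1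
  have uq₀ : ∀ x, u₀ (q₀ x) = u₀ x := by
    intro x
    have h1 := kP₁ (u₀ (q₀ x) - u₀ x) (by rw [map_sub, du₀, du₀, qq₀, sub_self])
    rwa [map_sub, Pu₀, Pu₀, sub_eq_zero] at h1
  have uP₁ : ∀ x, u₁ (P₁ x) = 0 := fun x => by rw [← uq₁, qP₁, map_zero]
  have uP₀ : ∀ x, u₀ (P₀ x) = 0 := fun x => by rw [← uq₀, qP₀, map_zero]
  have qu₁ : ∀ x, q₀ (u₁ x) = 0 := fun x => by rw [← Pu₁, qP₀]
  have qu₀ : ∀ x, q₁ (u₀ x) = 0 := fun x => by rw [← Pu₀, qP₁]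
  exact ⟨{
    e₀ := LinearMap.id - q₀ - P₀
    e₁ := LinearMap.id - q₁ - P₁
    e_e₀ := by ext x; simp [qq₀, qP₀, Pq₀, PP₀]
    e_e₁ := by ext x; simp [qq₁, qP₁, Pq₁, PP₁]
    e_d₀ := by ext x; simp [qg₁, Pd₀]
    e_d₁ := by ext x; simp [qg₀, Pd₁]
    d_e₀ := by ext x; simp [fq₀, fP₀]
    d_e₁ := by ext x; simp [fq₁, fP₁]
    sat₀ := fun z hz hez => by
      have : q₀ z = z := 
        (sub_eq_zero.mp (by simpa [kP₀ z hz] using hez)).symm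
      exact this ▸ hs₀ z
    sat₁ := fun z hz hez => by
      have : q₁ z = z := 
        (sub_eq_zero.mp (by simpa [kP₁ z hz] using hez)).symm
      exact this ▸ hs₁ z }, ⟨{
    -- The two quasi-inverses come with different constants. Rescaling each by the constant of the
    -- other gives a common one.
    a := a₀ * a₁
    a_ne_zero := mul_ne_zero ha₀ ha₁
    u₀ := a₁ • u₀
    u₁ := a₀ • u₁
    P₀ := P₀
    P₁ := P₁
    u_d₀ := by ext x; simp [ud₁, mul_smul]
    u_d₁ := by ext x; simp [ud₀, smul_smul, mul_comm a₀ a₁]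
    d_u₀ := by
      ext x
      simp only [LinearMap.comp_apply, LinearMap.smul_apply, map_smul, du₀, LinearMap.sub_apply,
        LinearMap.id_apply]
      rw [smul_smul, mul_comm]
      congr 1
      abel
    d_u₁ := by
      ext x
      simp only [LinearMap.comp_apply, LinearMap.smul_apply, map_smul, du₁, LinearMap.sub_apply,
        LinearMap.id_apply]
      rw [smul_smul]
      congr 1
      abel
    u_u₀ := by
      ext x
      simp only [LinearMap.comp_apply, LinearMap.smul_apply, map_smul, LinearMap.zero_apply]
      rw [← Pu₀, uP₁, smul_zero, smul_zero]
    u_u₁ := by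
      ext x
      simp only [LinearMap.comp_apply, LinearMap.smul_apply, map_smul, LinearMap.zero_apply]
      rw [← Pu₁, uP₀, smul_zero, smul_zero]
    u_e₀ := by ext x; simp [uq₀, uP₀]
    u_e₁ := by ext x; simp [uq₁, uP₁]
    e_u₀ := by ext x; simp [qu₀, Pu₀]
    e_u₁ := by ext x; simp [qu₁, Pu₁]
    P_P₀ := by ext x; simp [PP₀]
    P_P₁ := by ext x; simp [PP₁] }⟩⟩

end BocksteinPair
end PrincipalIdealDomain

/-! ### Extension of scalars for endomorphisms of a product -/

section BaseChange

variable {R : Type*} [CommRing R] (K : Type*) [Field K] [Algebra R K]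
  {C₀ C₁ : Type*} [AddCommGroup C₀] [Module R C₀] [AddCommGroup C₁] [Module R C₁]

/-- Extension of scalars for endomorphisms of `C₀ × C₁`. -/
def bcHom : Module.End R (C₀ × C₁) →+* Module.End K ((K ⊗[R] C₀) × (K ⊗[R] C₁)) :=
  ((TensorProduct.prodRight R K K C₀ C₁).conjRingEquiv.toRingHom).comp
    (Module.End.baseChangeHom R K (C₀ × C₁)).toRingHom

theorem bcHom_apply (x : Module.End R (C₀ × C₁)) (v) :
    bcHom K x v = TensorProduct.prodRight R K K C₀ C₁
      (x.baseChange K ((TensorProduct.prodRight R K K C₀ C₁).symm v)) := rfl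

theorem bcHom_offDiag (x₀ : C₀ →ₗ[R] C₁) (x₁ : C₁ →ₗ[R] C₀) :
    bcHom K (offDiag x₀ x₁) = offDiag (x₀.baseChange K) (x₁.baseChange K) := by
  ext v <;> simp [bcHom_apply, offDiag, TensorProduct.prodRight]

theorem bcHom_smul (a : R) (x : Module.End R (C₀ × C₁)) :
    bcHom K (a • x) = algebraMap R K a • bcHom K x := by
  refine LinearMap.ext fun v => ?_
  rw [bcHom_apply, LinearMap.baseChange_smul, LinearMap.smul_apply, ← algebraMap_smul K a, map_smul]
  rfl

/-- This brings an identity between integral operators back from `K` to `R`. It is used for the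
vanishing of a projector. -/
theorem bcHom_injective [IsDomain R] [IsFractionRing R K] [Module.Free R C₀] [Module.Free R C₁] :
    Function.Injective (bcHom K : Module.End R (C₀ × C₁) →+* _) := by
  have : FaithfulSMul R K :=
    (faithfulSMul_iff_algebraMap_injective R K).mpr (IsFractionRing.injective R K)
  exact (TensorProduct.prodRight R K K C₀ C₁).conjRingEquiv.injective.comp
    (LinearMap.baseChangeHom_injective (R := R) (S := K) (M := C₀ × C₁) (N := C₀ × C₁))

theorem offDiag_mul (x₀ y₀ : C₀ →ₗ[R] C₁) (x₁ y₁ : C₁ →ₗ[R] C₀) :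
    offDiag x₀ x₁ * offDiag y₀ y₁ = LinearMap.prodMap (x₁ ∘ₗ y₀) (x₀ ∘ₗ y₁) := by
  ext v <;> simp [offDiag]

theorem offDiag_mul_prodMap (x₀ : C₀ →ₗ[R] C₁) (x₁ : C₁ →ₗ[R] C₀) (y₀ : C₀ →ₗ[R] C₀)
    (y₁ : C₁ →ₗ[R] C₁) :
    offDiag x₀ x₁ * LinearMap.prodMap y₀ y₁ = offDiag (x₀ ∘ₗ y₀) (x₁ ∘ₗ y₁) := by
  ext v <;> simp [offDiag]

theorem prodMap_mul_offDiag (x₀ : C₀ →ₗ[R] C₁) (x₁ : C₁ →ₗ[R] C₀) (y₀ : C₀ →ₗ[R] C₀)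
    (y₁ : C₁ →ₗ[R] C₁) :
    LinearMap.prodMap y₀ y₁ * offDiag x₀ x₁ = offDiag (y₁ ∘ₗ x₀) (y₀ ∘ₗ x₁) := by
  ext v <;> simp [offDiag]

theorem offDiag_zero : (offDiag 0 0 : Module.End R (C₀ × C₁)) = 0 := by
  ext v <;> simp [offDiag]

theorem offDiag_add (x₀ y₀ : C₀ →ₗ[R] C₁) (x₁ y₁ : C₁ →ₗ[R] C₀) :
    offDiag x₀ x₁ + offDiag y₀ y₁ = offDiag (x₀ + y₀) (x₁ + y₁) := by
  ext v <;> simp [offDiag]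

theorem offDiag_smul (a : R) (x₀ : C₀ →ₗ[R] C₁) (x₁ : C₁ →ₗ[R] C₀) :
    a • offDiag x₀ x₁ = offDiag (a • x₀) (a • x₁) := by
  ext v <;> simp [offDiag]

theorem prodMap_id_sub (x₀ : C₀ →ₗ[R] C₀) (x₁ : C₁ →ₗ[R] C₁) :
    LinearMap.prodMap (LinearMap.id - x₀) (LinearMap.id - x₁) =
      (1 - LinearMap.prodMap x₀ x₁ : Module.End R (C₀ × C₁)) := by
  ext v <;> simp

theorem prodMap_smul' (a : R) (x₀ : C₀ →ₗ[R] C₀) (x₁ : C₁ →ₗ[R] C₁) :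
    a • (LinearMap.prodMap x₀ x₁ : Module.End R (C₀ × C₁)) =
      LinearMap.prodMap (a • x₀) (a • x₁) := by
  ext v <;> simp

end BaseChange

/-! ### The determinant of a rationally acyclic complex -/

section AcyclicPair

set_option linter.unusedSectionVars false

variable {R : Type*} [CommRing R] [IsDomain R] [IsPrincipalIdealRing R] (K : Type*) [Field K]
  [Algebra R K] [IsFractionRing R K]
  {C₀ C₁ : Type*} [AddCommGroup C₀] [Module R C₀] [AddCommGroup C₁] [Module R C₁]
  [Module.Finite R C₀] [Module.Finite R C₁] [Module.Free R C₀] [Module.Free R C₁]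

/-- Since `M = Z ⊕ Y` and `B ≤ Z`, dividing by `B ⊔ Y` leaves `Z / B`. -/
theorem length_quotient_eq_relLength_of_isCompl {M : Type*} [AddCommGroup M] [Module R M]
    {Z B Y : Submodule R M} (hBZ : B ≤ Z) (h : IsCompl Z Y) :
    Module.length R (M ⧸ (B ⊔ Y)) = relLength B Z := by
  have h1 : Module.length R (M ⧸ (B ⊔ Y)) = relLength (B ⊔ Y) ⊤ := by
    let F : (⊤ : Submodule R M) →ₗ[R] M ⧸ (B ⊔ Y) := (B ⊔ Y).mkQ ∘ₗ Submodule.subtype ⊤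
    have hker : LinearMap.ker F = (B ⊔ Y).submoduleOf ⊤ := by
      ext x
      rw [LinearMap.mem_ker, LinearMap.comp_apply, Submodule.mkQ_apply,
        Submodule.Quotient.mk_eq_zero]
      rfl
    have hsurj : Function.Surjective F := fun y => by
      obtain ⟨y, rfl⟩ := Submodule.mkQ_surjective _ y
      exact ⟨⟨y, trivial⟩, rfl⟩
    unfold relLength
    rw [← hker]
    exact (F.quotKerEquivOfSurjective hsurj).length_eq.symm
  rw [h1]
  symm
  refine relLength_eq_of_map LinearMap.id ?_ ?_
  · rw [Submodule.map_id, ← sup_assoc, sup_eq_left.mpr hBZ, h.sup_eq_top]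
  · intro x hx
    refine ⟨fun hx' => ?_, fun hx' => Submodule.mem_sup_left hx'⟩
    obtain ⟨b, hb, y, hy, hxy⟩ := Submodule.mem_sup.mp (show x ∈ B ⊔ Y from hx')
    have : y ∈ Z := by
      have : y = x - b := by rw [← hxy]; abel
      rw [this]
      exact sub_mem hx (hBZ hb)
    have hy0 : y = 0 := by
      have : y ∈ Z ⊓ Y := ⟨this, hy⟩
      rwa [h.inf_eq_bot, Submodule.mem_bot] at this
    rw [← hxy, hy0, add_zero]
    exact hb

/-- The determinant of the trivialization of an acyclic complex. -/
theorem exists_ord_det_of_contraction (D₀ u₀ : C₀ →ₗ[R] C₁) (D₁ u₁ : C₁ →ₗ[R] C₀)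
    (P₀ : C₀ →ₗ[R] C₀) (P₁ : C₁ →ₗ[R] C₁) {a : R} (ha : a ≠ 0)
    (hDD₀ : D₁ ∘ₗ D₀ = 0) (hDD₁ : D₀ ∘ₗ D₁ = 0)
    (uD₀ : u₁ ∘ₗ D₀ = a • P₀) (uD₁ : u₀ ∘ₗ D₁ = a • P₁)
    (Du₀ : D₁ ∘ₗ u₀ = a • (LinearMap.id - P₀)) (Du₁ : D₀ ∘ₗ u₁ = a • (LinearMap.id - P₁))
    (uu₁ : u₀ ∘ₗ u₁ = 0) (PP₀ : P₀ ∘ₗ P₀ = P₀) (PP₁ : P₁ ∘ₗ P₁ = P₁) (α : C₁ ≃ₗ[R] C₀) :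
    ∃ x₀ x₁ : R, x₀ ≠ 0 ∧ x₁ ≠ 0 ∧
      Ring.ord R x₀ = relLength (LinearMap.range D₁) (LinearMap.ker D₀) ∧
      Ring.ord R x₁ = relLength (LinearMap.range D₀) (LinearMap.ker D₁) ∧
      LinearMap.det ((D₀.baseChange K + (algebraMap R K a)⁻¹ • u₀.baseChange K) ∘ₗ
        α.toLinearMap.baseChange K) * algebraMap R K x₀ = algebraMap R K x₁ := by
  simp only [LinearMap.ext_iff, LinearMap.comp_apply, LinearMap.zero_apply,
    LinearMap.smul_apply, LinearMap.sub_apply, LinearMap.id_apply] at hDD₀ hDD₁ uD₀ uD₁ Du₀ Du₁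
  simp only [LinearMap.ext_iff, LinearMap.comp_apply, LinearMap.zero_apply] at uu₁ PP₀ PP₁
  have cancel₀ : ∀ x y : C₀, a • x = a • y → x = y := fun x y h => smul_right_injective C₀ ha h
  have cancel₁ : ∀ x y : C₁, a • x = a • y → x = y := fun x y h => smul_right_injective C₁ ha h
  -- These identities hold after multiplication by `a`, which can be cancelled because the modules
  -- are torsion-free. They say that `P₀` and `P₁` are projectors along the kernels of `D₀` and
  -- `D₁`, and that they kill boundaries.
  have DP₀ : ∀ x, D₀ (P₀ x) = D₀ x := fun x => cancel₁ _ _ (by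
    rw [← map_smul, ← uD₀, Du₁, smul_sub, ← uD₁, hDD₀, map_zero, sub_zero])
  have DP₁ : ∀ x, D₁ (P₁ x) = D₁ x := fun x => cancel₀ _ _ (by
    rw [← map_smul, ← uD₁, Du₀, smul_sub, ← uD₀, hDD₁, map_zero, sub_zero])
  have PD₀ : ∀ x, P₁ (D₀ x) = 0 := fun x => cancel₁ _ _ (by
    rw [← uD₁, hDD₀, map_zero, smul_zero])
  have PD₁ : ∀ x, P₀ (D₁ x) = 0 := fun x => cancel₀ _ _ (by
    rw [← uD₀, hDD₁, map_zero, smul_zero])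
  have uP₀ : ∀ x, u₀ (P₀ x) = 0 := fun x => cancel₁ _ _ (by
    rw [← map_smul, ← uD₀, uu₁, smul_zero])
  have ker₀ : ∀ x, D₀ x = 0 → P₀ x = 0 := fun x hx => cancel₀ _ _ (by
    rw [← uD₀, hx, map_zero, smul_zero])
  have ker₁ : ∀ x, D₁ x = 0 → P₁ x = 0 := fun x hx => cancel₁ _ _ (by
    rw [← uD₁, hx, map_zero, smul_zero])
  have compl₀ : IsCompl (LinearMap.ker D₀) (LinearMap.range P₀) := by
    refine IsCompl.of_eq ?_ ?_
    · rw [Submodule.eq_bot_iff]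
      rintro _ ⟨h, y, rfl⟩
      rw [← PP₀]
      exact ker₀ _ h
    · rw [Submodule.eq_top_iff']
      intro x
      refine Submodule.mem_sup.mpr ⟨x - P₀ x, ?_, P₀ x, ⟨x, rfl⟩, by abel⟩
      rw [LinearMap.mem_ker, map_sub, DP₀, sub_self]
  have compl₁ : IsCompl (LinearMap.ker D₁) (LinearMap.range P₁) := by
    refine IsCompl.of_eq ?_ ?_
    · rw [Submodule.eq_bot_iff]
      rintro _ ⟨h, y, rfl⟩
      rw [← PP₁]
      exact ker₁ _ h
    · rw [Submodule.eq_top_iff']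
      intro x
      refine Submodule.mem_sup.mpr ⟨x - P₁ x, ?_, P₁ x, ⟨x, rfl⟩, by abel⟩
      rw [LinearMap.mem_ker, map_sub, DP₁, sub_self]
  -- Rationally `D₀` identifies the image of `P₀` with the kernel of `D₁`. Integrally there are
  -- injections both ways, through `D₀` and through the quasi-inverse `u₁`, and these suffice for
  -- equal ranks.
  have hrank : Module.finrank R (LinearMap.ker D₁) = Module.finrank R (LinearMap.range P₀) := by
    refine le_antisymm ?_ ?_
    · let f : LinearMap.ker D₁ →ₗ[R] LinearMap.range P₀ :=
        P₀.rangeRestrict ∘ₗ u₁ ∘ₗ (LinearMap.ker D₁).subtype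
      refine LinearMap.finrank_le_finrank_of_injective (f := f) ?_
      rw [injective_iff_map_eq_zero]
      rintro ⟨x, hx⟩ h
      have h1 : P₀ (u₁ x) = 0 := congrArg Subtype.val h
      have h2 : a • x = a • 0 := by
        have := Du₁ x
        rw [← DP₀, h1, map_zero, ker₁ x hx, sub_zero] at this
        rw [← this, smul_zero]
      exact Subtype.ext (cancel₁ _ _ h2)
    · let f : LinearMap.range P₀ →ₗ[R] LinearMap.ker D₁ :=
        (D₀.codRestrict _ fun x => hDD₀ x) ∘ₗ (LinearMap.range P₀).subtype
      refine LinearMap.finrank_le_finrank_of_injective (f := f) ?_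
      rw [injective_iff_map_eq_zero]
      rintro ⟨_, y, rfl⟩ h
      have h1 : D₀ (P₀ y) = 0 := congrArg Subtype.val h
      refine Subtype.ext ?_
      have := ker₀ _ h1
      rwa [PP₀] at this
  let φ : LinearMap.ker D₁ ≃ₗ[R] LinearMap.range P₀ := LinearEquiv.ofFinrankEq _ _ hrank
  let p₁ : C₁ →ₗ[R] LinearMap.ker D₁ := (LinearMap.id - P₁).codRestrict _ fun x => by
    simp [DP₁]
  have p₁_ker : ∀ x : LinearMap.ker D₁, p₁ x = x := fun x => Subtype.ext (by
    simp [p₁, ker₁ x x.2])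
  have p₁_P : ∀ x, p₁ (P₁ x) = 0 := fun x => Subtype.ext (by simp [p₁, PP₁])
  have p₁_zero : ∀ x, p₁ x = 0 → x = P₁ x := fun x h => by
    have : x - P₁ x = 0 := congrArg Subtype.val h
    exact sub_eq_zero.mp this
  -- Projection onto the cycles followed by an arbitrary isomorphism of free modules of equal rank.
  -- It is an integral substitute for the contraction, which has denominators.
  let f : C₁ →ₗ[R] C₀ := (LinearMap.range P₀).subtype ∘ₗ φ.toLinearMap ∘ₗ p₁
  have f_P : ∀ x, f (P₁ x) = 0 := fun x => by simp [f, p₁_P]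
  have P_f : ∀ x, P₀ (f x) = f x := fun x => by
    obtain ⟨y, hy⟩ := (φ (p₁ x)).2
    change P₀ (φ (p₁ x) : C₀) = (φ (p₁ x) : C₀)
    rw [← hy, PP₀]
  have f_zero : ∀ x, f x = 0 → x = P₁ x := fun x h => by
    have h1 : φ (p₁ x) = 0 := Subtype.ext h
    exact p₁_zero x ((LinearEquiv.map_eq_zero_iff φ).mp h1)
  have f_surj : ∀ y, ∃ x, D₁ x = 0 ∧ f x = P₀ y := fun y => by
    refine ⟨φ.symm ⟨P₀ y, y, rfl⟩, (φ.symm ⟨P₀ y, y, rfl⟩).2, ?_⟩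
    simp only [f, LinearMap.comp_apply, p₁_ker]
    simp
  -- Two injective integral maps whose cokernels are the even and the odd cohomology: the image of
  -- `M` is `range D₁ ⊕ range P₀`, that of `N` is `range D₀ ⊕ range P₁`, and `range P₀`, `range P₁`
  -- are complements of the cycles. Over `K` they satisfy `(D₀ + u₀/a) ∘ M = N`.
  let M : C₁ →ₗ[R] C₀ := f + D₁
  let N : C₁ →ₗ[R] C₁ := D₀ ∘ₗ f + P₁
  have M_inj : Function.Injective M := by
    rw [injective_iff_map_eq_zero]
    intro x hx
    have hx : f x + D₁ x = 0 := hx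
    have h1 := congrArg P₀ hx
    rw [map_add, P_f, PD₁, add_zero, map_zero] at h1
    rw [h1, zero_add] at hx
    rw [f_zero x h1, ker₁ x hx]
  have N_inj : Function.Injective N := by
    rw [injective_iff_map_eq_zero]
    intro x hx
    have hx : D₀ (f x) + P₁ x = 0 := hx
    have h1 := congrArg P₁ hx
    rw [map_add, PD₀, zero_add, PP₁, map_zero] at h1
    rw [h1, add_zero] at hx
    have h2 := ker₀ _ hx
    rw [P_f] at h2
    rw [f_zero x h2, h1]
  have M_range : LinearMap.range M = LinearMap.range D₁ ⊔ LinearMap.range P₀ := by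
    refine le_antisymm ?_ (sup_le ?_ ?_)
    · rintro _ ⟨x, rfl⟩
      change f x + D₁ x ∈ _
      rw [← P_f]
      exact add_mem (Submodule.mem_sup_right ⟨_, rfl⟩) (Submodule.mem_sup_left ⟨_, rfl⟩)
    · rintro _ ⟨x, rfl⟩
      refine ⟨P₁ x, ?_⟩
      change f (P₁ x) + D₁ (P₁ x) = _
      rw [f_P, DP₁, zero_add]
    · rintro _ ⟨y, rfl⟩
      obtain ⟨x, hx, hfx⟩ := f_surj y
      refine ⟨x, ?_⟩
      change f x + D₁ x = _
      rw [hx, hfx, add_zero]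
  have N_range : LinearMap.range N = LinearMap.range D₀ ⊔ LinearMap.range P₁ := by
    refine le_antisymm ?_ (sup_le ?_ ?_)
    · rintro _ ⟨x, rfl⟩
      exact add_mem (Submodule.mem_sup_left ⟨_, rfl⟩) (Submodule.mem_sup_right ⟨_, rfl⟩)
    · rintro _ ⟨y, rfl⟩
      obtain ⟨x, hx, hfx⟩ := f_surj y
      refine ⟨x, ?_⟩
      change D₀ (f x) + P₁ x = _
      rw [hfx, ker₁ x hx, DP₀, add_zero]
    · rintro _ ⟨x, rfl⟩
      refine ⟨P₁ x, ?_⟩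
      change D₀ (f (P₁ x)) + P₁ (P₁ x) = _
      rw [f_P, map_zero, zero_add, PP₁]
  let M' : C₁ →ₗ[R] C₁ := α.symm.toLinearMap ∘ₗ M
  have M'_inj : Function.Injective M' := α.symm.injective.comp M_inj
  have M'_len : Module.length R (C₁ ⧸ LinearMap.range M') =
      Module.length R (C₀ ⧸ LinearMap.range M) := by
    refine (Submodule.Quotient.equiv _ _ α ?_).length_eq
    ext y
    constructor
    · rintro ⟨_, ⟨x, rfl⟩, rfl⟩
      exact ⟨x, by simp [M']⟩
    · rintro ⟨x, rfl⟩
      exact ⟨M' x, ⟨x, rfl⟩, by simp [M']⟩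
  refine ⟨LinearMap.det M', LinearMap.det N, ?_, ?_, ?_, ?_, ?_⟩
  · intro h
    exact LinearMap.det_eq_zero_iff_ker_ne_bot.mp h (LinearMap.ker_eq_bot.mpr M'_inj)
  · intro h
    exact LinearMap.det_eq_zero_iff_ker_ne_bot.mp h (LinearMap.ker_eq_bot.mpr N_inj)
  · rw [← length_quotient_range_eq_ord_det _ M'_inj, M'_len, M_range]
    refine length_quotient_eq_relLength_of_isCompl ?_ compl₀
    rintro _ ⟨x, rfl⟩
    exact hDD₁ x
  · rw [← length_quotient_range_eq_ord_det _ N_inj, N_range]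
    refine length_quotient_eq_relLength_of_isCompl ?_ compl₁
    rintro _ ⟨x, rfl⟩
    exact hDD₀ x
  -- The relation `(D₀ + u₀/a) ∘ M = N`: the cross terms vanish because `D₀D₁ = 0` and `u₀ f = u₀ P₀
  -- f = 0`, while `u₀D₁ = aP₁`.
  · rw [← LinearMap.det_baseChange, ← LinearMap.det_baseChange, ← LinearMap.det_comp]
    congr 1
    have ha' : algebraMap R K a ≠ 0 := by
      rwa [ne_eq, FaithfulSMul.algebraMap_eq_zero_iff]
    refine TensorProduct.AlgebraTensorModule.curry_injective (LinearMap.ext_ring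
      (LinearMap.ext fun x => ?_))
    have h1 : D₀ (M x) = D₀ (f x) := by
      change D₀ (f x + D₁ x) = _
      rw [map_add, hDD₁, add_zero]
    have h2 : u₀ (M x) = a • P₁ x := by
      change u₀ (f x + D₁ x) = _
      rw [map_add, ← P_f, uP₀, zero_add, uD₁]
    have h3 : (algebraMap R K a)⁻¹ • ((1 : K) ⊗ₜ[R] (a • P₁ x)) = (1 : K) ⊗ₜ[R] P₁ x := by
      rw [TensorProduct.tmul_smul, ← algebraMap_smul K a, smul_smul, inv_mul_cancel₀ ha', one_smul]
    simp only [TensorProduct.AlgebraTensorModule.curry_apply, LinearMap.restrictScalars_apply,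
      TensorProduct.curry_apply, LinearMap.comp_apply, LinearMap.baseChange_tmul,
      LinearMap.add_apply, LinearMap.smul_apply, LinearEquiv.coe_coe, M',
      LinearEquiv.apply_symm_apply, h1, h2, h3, N, TensorProduct.tmul_add]

end AcyclicPair

/-- A projector annihilated by `D` on both sides is a direct summand of the cohomology, so it
vanishes when the identity is null-homotopic. -/
theorem eq_zero_of_homotopy {R : Type*} [Ring R] {D S ε : R} (k1 : D * S + S * D = 1 - 0)
    (k2 : ε * ε = ε) (k3 : ε * D = 0) (k4 : D * ε = 0) : ε = 0 := by
  calc ε = ε * (D * S + S * D) * ε := by rw [k1, sub_zero, mul_one, k2]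
    _ = (ε * D) * S * ε + ε * S * (D * ε) := by simp only [mul_add, add_mul, mul_assoc]
    _ = 0 := by rw [k3, k4]; simp


/-! ### Reduction to an integral projector and to the perturbed complex -/

section IntegralPair

set_option linter.unusedSectionVars false

variable {R : Type*} [CommRing R] [IsDomain R] [IsPrincipalIdealRing R] (K : Type*) [Field K]
  [Algebra R K] [IsFractionRing R K]
  {C₀ C₁ : Type*} [AddCommGroup C₀] [Module R C₀] [AddCommGroup C₁] [Module R C₁]
  [Module.Finite R C₀] [Module.Finite R C₁] [Module.Free R C₀] [Module.Free R C₁]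

namespace BocksteinPair

variable (X : BocksteinPair R C₀ C₁)

/-- The differential of the complex, as an endomorphism of `C₀ × C₁`. -/
def d : Module.End R (C₀ × C₁) := offDiag X.d₀ X.d₁

/-- The operator `β` of the complex, as an endomorphism of `C₀ × C₁`. -/
def β : Module.End R (C₀ × C₁) := offDiag X.β₀ X.β₁

/-- The null-homotopy of `β²`, as an endomorphism of `C₀ × C₁`. -/
def h : Module.End R (C₀ × C₁) := offDiag X.h₀ X.h₁

theorem d_mul_d : X.d * X.d = 0 := by
  rw [d, offDiag_mul, X.d_d₀, X.d_d₁, LinearMap.prodMap_zero]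

theorem d_mul_β : X.d * X.β + X.β * X.d = 0 := by
  rw [d, β, offDiag_mul, offDiag_mul, ← LinearMap.prodMap_add, X.d_β₀, X.d_β₁,
    LinearMap.prodMap_zero]

theorem β_mul_β : X.β * X.β = X.d * X.h + X.h * X.d := by
  rw [d, β, h, offDiag_mul, offDiag_mul, offDiag_mul, ← LinearMap.prodMap_add, X.β_β₀, X.β_β₁]

namespace Projector

variable {X} (E : X.Projector)

/-- The projector, as an endomorphism of `C₀ × C₁`. -/
def e : Module.End R (C₀ × C₁) := LinearMap.prodMap E.e₀ E.e₁

theorem isOdd_e_β_e : E.e * X.β * E.e =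
    offDiag (E.e₁ ∘ₗ X.β₀ ∘ₗ E.e₀) (E.e₀ ∘ₗ X.β₁ ∘ₗ E.e₁) := by
  rw [e, β, prodMap_mul_offDiag, offDiag_mul_prodMap]
  rfl

/-- The integral form of `(eβe)² = 0`. As `β (e x)` is a cycle, the inner projector can be omitted,
and `e β² e` vanishes by the null-homotopy of `β²`. The mixed terms contain `de` or `ed`. -/
theorem D₁_D₀ (x : C₀) : E.D₁ (E.D₀ x) = 0 := by
  have htf : ∀ a ∈ nonZeroDivisors R, ∀ x : C₀, a • x = 0 → x = 0 := fun a ha x h =>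
    (smul_eq_zero.mp h).resolve_left (nonZeroDivisors.ne_zero ha)
  have hde : X.d₀ (E.e₀ x) = 0 := LinearMap.congr_fun E.d_e₀ x
  have hz : X.d₁ (X.β₀ (E.e₀ x)) = 0 := by rw [X.d_β₀_apply, hde, map_zero, neg_zero]
  have h1 := E.swap.e_β_e htf hz
  change E.e₀ (X.β₁ (E.e₁ (X.β₀ (E.e₀ x)))) = E.e₀ (X.β₁ (X.β₀ (E.e₀ x))) at h1
  rw [E.D₁_apply, E.D₀_apply, map_add, map_add, X.d_d₀_apply,
    show X.d₁ (E.e₁ (X.β₀ (E.e₀ x))) = 0 from LinearMap.congr_fun E.d_e₁ _,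
    show E.e₁ (X.d₀ x) = 0 from LinearMap.congr_fun E.e_d₀ _, zero_add, zero_add, zero_add,
    show E.e₁ (E.e₁ (X.β₀ (E.e₀ x))) = _ from LinearMap.congr_fun E.e_e₁ _, h1,
    show X.β₁ (X.β₀ (E.e₀ x)) = _ from LinearMap.congr_fun X.β_β₀ _, LinearMap.add_apply,
    LinearMap.comp_apply, LinearMap.comp_apply, hde, map_zero, add_zero]
  exact LinearMap.congr_fun E.e_d₁ _

/-- The complex with differential `d + e β e`. -/
def perturbed : BocksteinPair R C₀ C₁ where
  d₀ := E.D₀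
  d₁ := E.D₁
  β₀ := 0
  β₁ := 0
  h₀ := 0
  h₁ := 0
  d_d₀ := LinearMap.ext E.D₁_D₀
  d_d₁ := LinearMap.ext E.swap.D₁_D₀
  d_β₀ := by simp
  d_β₁ := by simp
  β_β₀ := by simp
  β_β₁ := by simp

theorem perturbed_d : E.perturbed.d = X.d + E.e * X.β * E.e := by
  rw [isOdd_e_β_e, d, d, offDiag_add]
  rfl

namespace Contraction

variable {E} (U : E.Contraction)

/-- The contraction, as an endomorphism of `(K ⊗ C₀) × (K ⊗ C₁)`. -/
def s : Module.End K ((K ⊗[R] C₀) × (K ⊗[R] C₁)) :=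
  (algebraMap R K U.a)⁻¹ • bcHom K (offDiag U.u₀ U.u₁)

theorem isOddEnd_s : IsOddEnd (U.s K) := by
  rw [s, bcHom_offDiag, offDiag_smul]
  exact isOddEnd_offDiag _ _

/-- Division by the constant `a`, invertible in `K`, turns the integral quasi-contraction into an
honest contraction of the complement of `e`. -/
theorem relations : bcHom K X.d * bcHom K E.e = 0 ∧ bcHom K E.e * bcHom K X.d = 0 ∧
    U.s K * bcHom K E.e = 0 ∧ bcHom K E.e * U.s K = 0 ∧
    bcHom K X.d * U.s K + U.s K * bcHom K X.d = 1 - bcHom K E.e ∧ U.s K * U.s K = 0 := by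
  have ha : algebraMap R K U.a ≠ 0 := by
    rw [ne_eq, FaithfulSMul.algebraMap_eq_zero_iff]
    exact U.a_ne_zero
  refine ⟨?_, ?_, ?_, ?_, ?_, ?_⟩
  · rw [← map_mul, d, e, offDiag_mul_prodMap, E.d_e₀, E.d_e₁, offDiag_zero, map_zero]
  · rw [← map_mul, d, e, prodMap_mul_offDiag, E.e_d₀, E.e_d₁, offDiag_zero, map_zero]
  · rw [s, smul_mul_assoc, ← map_mul, e, offDiag_mul_prodMap, U.u_e₀, U.u_e₁, offDiag_zero,
      map_zero, smul_zero]
  · rw [s, mul_smul_comm, ← map_mul, e, prodMap_mul_offDiag, U.e_u₀, U.e_u₁, offDiag_zero,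
      map_zero, smul_zero]
  · rw [s, mul_smul_comm, smul_mul_assoc, ← smul_add, ← map_mul, ← map_mul, ← map_add, d,
      offDiag_mul, offDiag_mul, U.u_d₀, U.u_d₁, U.d_u₀, U.d_u₁, ← LinearMap.prodMap_add,
      ← smul_add, ← smul_add, sub_add_cancel, sub_add_cancel, ← prodMap_smul', prodMap_id_sub,
      bcHom_smul, smul_smul, inv_mul_cancel₀ ha, one_smul, map_sub, map_one]
    rfl
  · rw [s, smul_mul_assoc, mul_smul_comm, ← map_mul, offDiag_mul, U.u_u₀, U.u_u₁,
      LinearMap.prodMap_zero, map_zero, smul_zero, smul_zero]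

end Contraction
end Projector

/-- The order of the determinant of the trivialization of a complex by means of the Bockstein
map, in terms of the lengths of the cohomology modules of the Bockstein map. -/
theorem exists_ord_det_of_ringSplitting
    {s e b τ : Module.End K ((K ⊗[R] C₀) × (K ⊗[R] C₁))}
    (H : RingSplitting (bcHom K X.d) (bcHom K X.β) s e b τ)
    (os : IsOddEnd s) (ob : IsOddEnd b) (oτ : IsOddEnd τ) (α : C₁ ≃ₗ[R] C₀) :
    ∃ (x₀ x₁ : R) (t : ℕ∞), x₀ ≠ 0 ∧ x₁ ≠ 0 ∧
      Ring.ord R x₀ = relLength X.imB X.kerB + t ∧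
      Ring.ord R x₁ = relLength X.swap.imB X.swap.kerB + t ∧
      LinearMap.det (block₀₁ (bcHom K X.d + s + b + τ) ∘ₗ α.toLinearMap.baseChange K) *
        algebraMap R K x₀ = algebraMap R K x₁ := by
  have htf₀ : ∀ a ∈ nonZeroDivisors R, ∀ x : C₀, a • x = 0 → x = 0 := fun a ha x h =>
    (smul_eq_zero.mp h).resolve_left (nonZeroDivisors.ne_zero ha)
  have htf₁ : ∀ a ∈ nonZeroDivisors R, ∀ x : C₁, a • x = 0 → x = 0 := fun a ha x h =>
    (smul_eq_zero.mp h).resolve_left (nonZeroDivisors.ne_zero ha)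
  obtain ⟨E, ⟨U⟩⟩ := X.exists_projector
  obtain ⟨E', ⟨U'⟩⟩ := E.perturbed.exists_projector
  have hd : bcHom K X.d * bcHom K X.d = 0 := by rw [← map_mul, X.d_mul_d, map_zero]
  have hβ : bcHom K X.d * bcHom K X.β + bcHom K X.β * bcHom K X.d = 0 := by
    rw [← map_mul, ← map_mul, ← map_add, X.d_mul_β, map_zero]
  have hh : bcHom K X.β * bcHom K X.β = bcHom K X.d * bcHom K X.h + bcHom K X.h * bcHom K X.d := by
    rw [← map_mul, ← map_mul, ← map_mul, ← map_add, X.β_mul_β]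
  obtain ⟨r1, r2, r3, r4, r5, r6⟩ := U.relations K
  -- The given rational splitting is replaced by one with the integral projector. Its `τ` is the
  -- compression of the given `τ`, so it may still have denominators.
  have H1 := H.change hβ r1 r2 r3 r4 r5 r6
  have od : IsOddEnd (bcHom K X.d) := by
    rw [d, bcHom_offDiag]; exact isOddEnd_offDiag _ _
  have oE : IsEvenEnd (bcHom K E.e) := by
    rw [H1.eq_one_sub]
    exact IsEvenEnd.one.sub ((od.mul (U.isOddEnd_s K)).add ((U.isOddEnd_s K).mul od))
  have mul_even : ∀ {x y : Module.End K ((K ⊗[R] C₀) × (K ⊗[R] C₁))}, IsOddEnd x → IsEvenEnd y →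
      IsOddEnd (x * y) := by
    intro x y hx hy
    unfold IsOddEnd IsEvenEnd at *
    rw [mul_assoc, hy, ← mul_assoc, hx, mul_assoc]
  have ob1 : IsOddEnd (bcHom K E.e * bcHom K X.β * bcHom K E.e) := by
    rw [← map_mul, ← map_mul, E.isOdd_e_β_e, bcHom_offDiag]
    exact isOddEnd_offDiag _ _
  have oτ1 : IsOddEnd (bcHom K E.e * τ * bcHom K E.e) := mul_even (oE.mul_odd oτ) oE
  have det1 := H.det_block_eq H1 hd hβ hh od os ob oτ (U.isOddEnd_s K) oτ1
    (α.baseChange R K C₁ C₀)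
  -- For the perturbed differential `d + eβe` the whole operator `s + eτe` is a contraction. It is a
  -- splitting with zero cohomology and zero Bockstein operator, which makes the comparison theorem
  -- available a second time.
  have H2 := H1.contraction
  have hD : bcHom K X.d + bcHom K E.e * bcHom K X.β * bcHom K E.e = bcHom K E.perturbed.d := by
    rw [E.perturbed_d, map_add, map_mul, map_mul]
  rw [hD] at H2
  have hDD : bcHom K E.perturbed.d * bcHom K E.perturbed.d = 0 := by
    rw [← map_mul, d_mul_d, map_zero]
  obtain ⟨q1, q2, q3, q4, q5, q6⟩ := U'.relations K
  -- The perturbed complex is acyclic over `K`, so its projector onto cohomology vanishes there. It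
  -- vanishes over `R` as well, since base change is injective on endomorphisms of free modules.
  have hE' : bcHom K E'.e = 0 := by
    have h1 : bcHom K E'.e * bcHom K E'.e = bcHom K E'.e := by
      rw [← map_mul]
      congr 1
      change LinearMap.prodMap _ _ ∘ₗ LinearMap.prodMap _ _ = LinearMap.prodMap _ _
      rw [LinearMap.prodMap_comp, E'.e_e₀, E'.e_e₁]
    exact eq_zero_of_homotopy H2.homotopy h1 q2 q1
  have H3 : RingSplitting (bcHom K E.perturbed.d) 0 (U'.s K) 0 0 0 := by
    refine ⟨by simp, by simp, by simp, by simp, ?_, q6, by simp, by simp, by simp, by simp,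
      by simp⟩
    rw [q5, hE']
  have oD : IsOddEnd (bcHom K E.perturbed.d) := by
    rw [d, bcHom_offDiag]; exact isOddEnd_offDiag _ _
  have o0 : IsOddEnd (0 : Module.End K ((K ⊗[R] C₀) × (K ⊗[R] C₁))) := by simp [IsOddEnd]
  have det2 := H2.det_block_eq (h := 0) H3 hDD (by simp) (by simp) oD
    ((U.isOddEnd_s K).add oτ1) o0 o0 (U'.isOddEnd_s K) o0 (α.baseChange R K C₁ C₀)
  have hE0 : E'.e = 0 := bcHom_injective K (by rw [hE', map_zero])
  have e0 : E'.e₀ = 0 := by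
    ext x
    exact congrArg Prod.fst (LinearMap.congr_fun hE0 (x, 0))
  have e1 : E'.e₁ = 0 := by
    ext x
    exact congrArg Prod.snd (LinearMap.congr_fun hE0 (0, x))
  -- With the projector equal to zero, the integral quasi-contraction of the perturbed complex
  -- satisfies the hypotheses of the acyclic case.
  obtain ⟨x₀, x₁, h₀, h₁, l₀, l₁, hdet⟩ := exists_ord_det_of_contraction K E.D₀ U'.u₀ E.D₁ U'.u₁
    U'.P₀ U'.P₁ U'.a_ne_zero E.perturbed.d_d₀ E.perturbed.d_d₁ U'.u_d₀ U'.u_d₁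
    (by have := U'.d_u₀; rwa [e0, sub_zero] at this)
    (by have := U'.d_u₁; rwa [e1, sub_zero] at this) U'.u_u₁ U'.P_P₀ U'.P_P₁ α
  refine ⟨x₀, x₁, E.torsionDefect + E.swap.torsionDefect, h₀, h₁, ?_, ?_, ?_⟩
  · rw [l₀, E.relLength_D htf₀ htf₁]
  · have := E.swap.relLength_D htf₁ htf₀
    rw [add_comm E.swap.torsionDefect] at this
    rw [l₁]
    exact this
  · rw [← hdet]
    congr 1
    have hα : α.toLinearMap.baseChange K = (α.baseChange R K C₁ C₀).toLinearMap := rfl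
    rw [hα, det1, add_assoc, add_add_add_comm, hD]
    simp only [add_zero] at det2
    rw [det2]
    congr 2
    rw [Projector.Contraction.s, d, bcHom_offDiag, bcHom_offDiag, offDiag_smul, offDiag_add,
      block₀₁_offDiag]
    rfl

end BocksteinPair
end IntegralPair

/-! ### Connections on projective `Λ(G)`-modules and the cochain form of the Bockstein map -/

section Connection

variable {p : ℕ} [Fact p.Prime] {G : Type*} [Group G] [TopologicalSpace G]
  [IsTopologicalGroup G] [CompactSpace G] [T2Space G] (θ : G →ₜ* Multiplicative ℤ_[p])

/-- The function `g ↦ θ(g) (θ(g) - 1) / 2`. -/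
def thetaChoose : C(G, ℤ_[p]) := (mahler 2).comp (thetaFun θ)

/-- Vandermonde's identity for `x(x-1)/2`, checked after multiplication by two, which is not a zero
divisor in `ℤ_p` even for `p = 2`. -/
theorem choose_two_add (x y : ℤ_[p]) :
    mahler 2 (x + y) = mahler 2 x + x * y + mahler 2 y := by
  have h : ∀ z : ℤ_[p], 2 * mahler 2 z = z * (z - 1) := fun z => by
    rw [mahler_apply]
    have := Ring.descPochhammer_eq_factorial_smul_choose z 2
    simp only [descPochhammer_succ_right, descPochhammer_zero, one_mul, Nat.factorial] at this
    simp at this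
    rw [← this]
    simp [Polynomial.smeval_mul, Polynomial.smeval_sub]
  apply mul_left_cancel₀ (two_ne_zero : (2 : ℤ_[p]) ≠ 0)
  linear_combination h (x + y) - h x - h y

/-- The second-order Leibniz rule. The binomial function is used and not `θ²/2`, because it is
`ℤ_p`-valued for every `p` and its addition formula has the same cross term. -/
theorem weight_thetaChoose_mul (l m : Iwasawa ℤ_[p] G) :
    Iwasawa.weight (thetaChoose θ) (l * m) =
      Iwasawa.weight (thetaChoose θ) l * m +
        Iwasawa.weight (thetaFun θ) l * Iwasawa.weight (thetaFun θ) m +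
        l * Iwasawa.weight (thetaChoose θ) m := by
  ext f
  rw [Iwasawa.add_apply, Iwasawa.add_apply, Iwasawa.weight_apply, Iwasawa.mul_apply,
    Iwasawa.mul_apply, Iwasawa.mul_apply, Iwasawa.mul_apply, Iwasawa.weight_apply,
    Iwasawa.weight_apply, ← map_add, ← map_add]
  congr 1
  refine ContinuousMap.ext fun x => ?_
  rw [Iwasawa.avg_apply]
  have : Iwasawa.translate (thetaChoose θ * f) x =
      thetaChoose θ x • Iwasawa.translate f x +
        thetaFun θ x • (thetaFun θ * Iwasawa.translate f x) +
        thetaChoose θ * Iwasawa.translate f x := by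
    refine ContinuousMap.ext fun y => ?_
    change mahler 2 (θ (x * y)).toAdd * f (x * y) =
      mahler 2 (θ x).toAdd * f (x * y) + (θ x).toAdd * ((θ y).toAdd * f (x * y)) +
        mahler 2 (θ y).toAdd * f (x * y)
    rw [map_mul, toAdd_mul, choose_two_add]
    ring
  rw [this, map_add, map_add, map_smul, map_smul]
  rfl

/-- The additive map `weight h` on the Iwasawa algebra. -/
def weightHom (h : C(G, ℤ_[p])) : Iwasawa ℤ_[p] G →+ Iwasawa ℤ_[p] G where
  toFun := Iwasawa.weight h
  map_zero' := rfl
  map_add' _ _ := rfl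

variable (M : Type*) [AddCommGroup M] [Module (Iwasawa ℤ_[p] G) M]

/-- A connection on the `Λ(G)`-module `M` along the derivation `λ ↦ θ λ`, with a second-order
companion. -/
structure Connection where
  nabla : M →+ M
  mu : M →+ M
  nabla_smul : ∀ (l : Iwasawa ℤ_[p] G) (m : M),
    nabla (l • m) = Iwasawa.weight (thetaFun θ) l • m + l • nabla m
  mu_smul : ∀ (l : Iwasawa ℤ_[p] G) (m : M),
    mu (l • m) = Iwasawa.weight (thetaChoose θ) l • m +
      Iwasawa.weight (thetaFun θ) l • nabla m + l • mu m

variable {M}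

/-- The sum `∑ h c_x • x` over a finitely supported function `c` on `M`. -/
def weightSum (h : C(G, ℤ_[p])) : (M →₀ Iwasawa ℤ_[p] G) →+ M :=
  Finsupp.liftAddHom fun x => (AddMonoidHom.flip (smulAddHom _ M) x).comp (weightHom h)

theorem weightSum_single (h : C(G, ℤ_[p])) (x : M) (c : Iwasawa ℤ_[p] G) :
    weightSum h (Finsupp.single x c) = Iwasawa.weight h c • x := by
  simp only [weightSum, Finsupp.liftAddHom_apply_single]
  rfl

theorem weightSum_theta_smul (l : Iwasawa ℤ_[p] G) (c : M →₀ Iwasawa ℤ_[p] G) :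
    weightSum (thetaFun θ) (l • c) =
      Iwasawa.weight (thetaFun θ) l • Finsupp.linearCombination _ id c +
        l • weightSum (thetaFun θ) c := by
  induction c using Finsupp.induction_linear with
  | zero => simp
  | add f g hf hg => simp only [smul_add, map_add, hf, hg]; abel
  | single x c =>
    rw [Finsupp.smul_single, weightSum_single, weightSum_single, smul_eq_mul, weight_theta_mul,
      Finsupp.linearCombination_single, id, add_smul, mul_smul, mul_smul]

theorem weightSum_thetaChoose_smul (l : Iwasawa ℤ_[p] G) (c : M →₀ Iwasawa ℤ_[p] G) :
    weightSum (thetaChoose θ) (l • c) =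
      Iwasawa.weight (thetaChoose θ) l • Finsupp.linearCombination _ id c +
        Iwasawa.weight (thetaFun θ) l • weightSum (thetaFun θ) c +
        l • weightSum (thetaChoose θ) c := by
  induction c using Finsupp.induction_linear with
  | zero => simp
  | add f g hf hg => simp only [smul_add, map_add, hf, hg]; abel
  | single x c =>
    rw [Finsupp.smul_single, weightSum_single, weightSum_single, weightSum_single, smul_eq_mul,
      weight_thetaChoose_mul, Finsupp.linearCombination_single, id, add_smul, add_smul, mul_smul,
      mul_smul, mul_smul]

/-- A free module has a connection acting on coordinates. A projective module is a retract of one,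
and the connection is compressed along the retraction. The second-order operator is obtained from
the same section. -/
theorem nonempty_connection [Module.Projective (Iwasawa ℤ_[p] G) M] :
    Nonempty (Connection θ M) := by
  obtain ⟨s, hs⟩ := Module.projective_def'.mp ‹Module.Projective (Iwasawa ℤ_[p] G) M›
  have hs' : ∀ m, Finsupp.linearCombination (Iwasawa ℤ_[p] G) id (s m) = m :=
    fun m => LinearMap.congr_fun hs m
  refine ⟨⟨(weightSum (thetaFun θ)).comp s.toAddMonoidHom,
    (weightSum (thetaChoose θ)).comp s.toAddMonoidHom, fun l m => ?_, fun l m => ?_⟩⟩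
  · have := weightSum_theta_smul θ l (s m)
    rw [hs'] at this
    simpa using this
  · have := weightSum_thetaChoose_smul θ l (s m)
    rw [hs'] at this
    simpa using this

namespace Connection

variable {θ} {N : Type*} [AddCommGroup N] [Module (Iwasawa ℤ_[p] G) N]
  (a : Connection θ M) (b : Connection θ N)

/-- The commutator of a linear map with connections on its source and target. -/
def beta (d : M →ₗ[Iwasawa ℤ_[p] G] N) : M →ₗ[Iwasawa ℤ_[p] G] N where
  toFun m := d (a.nabla m) - b.nabla (d m)
  map_add' x y := by simp only [map_add]; abel
  map_smul' l x := by
    simp only [a.nabla_smul, b.nabla_smul, map_add, map_smul, RingHom.id_apply, smul_sub]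
    abel

theorem beta_apply (d : M →ₗ[Iwasawa ℤ_[p] G] N) (m : M) :
    a.beta b d m = d (a.nabla m) - b.nabla (d m) := rfl

/-- The second-order commutator, a homotopy from zero to the square of `beta`. -/
def eta (d : M →ₗ[Iwasawa ℤ_[p] G] N) : M →ₗ[Iwasawa ℤ_[p] G] N where
  toFun m := d (a.mu m) - b.mu (d m) - a.beta b d (a.nabla m)
  map_add' x y := by simp only [map_add]; abel
  map_smul' l x := by
    simp only [a.nabla_smul, a.mu_smul, b.mu_smul, map_add, map_smul, RingHom.id_apply, smul_sub,
      beta_apply]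
    abel

theorem eta_apply (d : M →ₗ[Iwasawa ℤ_[p] G] N) (m : M) :
    a.eta b d m = d (a.mu m) - b.mu (d m) - a.beta b d (a.nabla m) := rfl

theorem beta_zero : a.beta b 0 = 0 := by ext m; simp [beta_apply]

theorem eta_zero : a.eta b 0 = 0 := by ext m; simp [eta_apply, beta_zero]

variable {Q : Type*} [AddCommGroup Q] [Module (Iwasawa ℤ_[p] G) Q] (c : Connection θ Q)
  {d : M →ₗ[Iwasawa ℤ_[p] G] N} {d' : N →ₗ[Iwasawa ℤ_[p] G] Q}

/-- With `d'd = 0`, only `-d'∇d` survives in the first term and `+d'∇d` in the second. -/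
theorem comp_beta_add (h : d' ∘ₗ d = 0) : d' ∘ₗ a.beta b d + b.beta c d' ∘ₗ d = 0 := by
  have h' : ∀ m, d' (d m) = 0 := fun m => LinearMap.congr_fun h m
  ext m
  simp [beta_apply, h']

/-- The contributions of `mu` to the right-hand side cancel. They serve to make `eta` linear: `-β∇`
fails linearity by `-(θλ)β`, and this is exactly compensated by the commutator of `d` with `mu`. -/
theorem beta_comp_beta (h : d' ∘ₗ d = 0) :
    b.beta c d' ∘ₗ a.beta b d = d' ∘ₗ a.eta b d + b.eta c d' ∘ₗ d := by
  have h' : ∀ m, d' (d m) = 0 := fun m => LinearMap.congr_fun h m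
  ext m
  simp [beta_apply, eta_apply, h']
  abel

/-- The section `m ↦ (∇ m, m)` of the projection `M ⊗ E_θ → M`. -/
def lift : M →ₗ[Iwasawa ℤ_[p] G] Twist θ M where
  toFun m := (a.nabla m, m)
  map_add' x y := Twist.ext θ (map_add a.nabla x y) rfl
  map_smul' l x := by
    refine Twist.ext θ ?_ rfl
    change a.nabla (l • x) = l • a.nabla x + Iwasawa.weight (thetaFun θ) l • x
    rw [a.nabla_smul, add_comm]

end Connection
end Connection

/-! ### Cycles and cohomology classes of a cochain complex -/

section Cohomology

universe v w
variable {S : Type w} [Ring S] (C : CochainComplex (ModuleCat.{v} S) ℤ)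

theorem iCycles_injective (i : ℤ) : Function.Injective (C.iCycles i).hom :=
  (ModuleCat.mono_iff_injective _).mp inferInstance

theorem homologyπ_surjective (i : ℤ) : Function.Surjective (C.homologyπ i).hom :=
  (ModuleCat.epi_iff_surjective _).mp inferInstance

theorem range_iCycles (i j : ℤ) (h : i + 1 = j) :
    LinearMap.range (C.iCycles i).hom = LinearMap.ker (C.d i j).hom := by
  have hex := ShortComplex.exact_of_f_is_kernel
    (ShortComplex.mk (C.iCycles i) (C.d i j) (C.iCycles_d i j))
    (C.cyclesIsKernel i j ((ComplexShape.up ℤ).next_eq' h))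
  rw [ShortComplex.moduleCat_exact_iff_range_eq_ker] at hex
  exact hex

theorem ker_homologyπ (i j : ℤ) (h : i + 1 = j) :
    LinearMap.ker (C.homologyπ j).hom =
      (LinearMap.range (C.d i j).hom).comap (C.iCycles j).hom := by
  have hex := ShortComplex.exact_of_g_is_cokernel
    (ShortComplex.mk (C.toCycles i j) (C.homologyπ j) (C.toCycles_comp_homologyπ i j))
    (C.homologyIsCokernel i j ((ComplexShape.up ℤ).prev_eq' h))
  rw [ShortComplex.moduleCat_exact_iff_range_eq_ker] at hex
  refine hex.symm.trans ?_
  have h2 : (C.d i j).hom = (C.iCycles j).hom ∘ₗ (C.toCycles i j).hom := by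
    rw [← ModuleCat.hom_comp, C.toCycles_i]
  ext x
  simp only [Submodule.mem_comap, LinearMap.mem_range, h2, LinearMap.comp_apply]
  exact ⟨fun ⟨y, hy⟩ => ⟨y, congrArg _ hy⟩, fun ⟨y, hy⟩ => ⟨y, iCycles_injective C j hy⟩⟩

theorem d_iCycles (i j : ℤ) (z : C.cycles i) : (C.d i j).hom ((C.iCycles i).hom z) = 0 := by
  have := C.iCycles_d i j
  exact congrArg (fun f => f.hom z) this

theorem exists_cycle {i j : ℤ} (h : i + 1 = j) {x : C.X i} (hx : (C.d i j).hom x = 0) :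
    ∃ z, (C.iCycles i).hom z = x := by
  have : x ∈ LinearMap.range (C.iCycles i).hom := by rwa [range_iCycles C i j h]
  exact this

end Cohomology

/-! ### The connecting homomorphism in terms of a connection -/

section BocksteinFormula

universe u v w
variable {p : ℕ} [Fact p.Prime] {G : Type u} [Group G] [TopologicalSpace G]
  [IsTopologicalGroup G] [CompactSpace G] [T2Space G]
  {S : Type w} [Ring S] {n : ℕ} (Φ : Iwasawa ℤ_[p] G →+* Matrix (Fin n) (Fin n) S)
  {θ : G →ₜ* Multiplicative ℤ_[p]}
  {A : CochainComplex (ModuleCat.{v} (Iwasawa ℤ_[p] G)) ℤ}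
  (D : ∀ i, Connection θ (A.X i))

/-- The cocycle that represents the Bockstein morphism. -/
def bocksteinMap (i j : ℤ) : A.X i →ₗ[Iwasawa ℤ_[p] G] A.X j := (D i).beta (D j) (A.d i j).hom

/-- The degreewise sections `m ↦ (∇m, m)` do not commute with the differentials. Their defect lies
in the submodule `M ⊗ e₁` and equals `β`. -/
theorem tens_incl_eq (i j : ℤ) (x : Tens Φ (A.X i)) (y : Tens Φ (A.X j))
    (hx : Tens.map Φ (A.d i j).hom x = 0) (hy : y = Tens.map Φ (bocksteinMap D i j) x) :
    Tens.map Φ (Twist.incl θ (A.X j)) y =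
      Tens.map Φ (Twist.map θ (A.d i j).hom) (Tens.map Φ (D i).lift x) := by
  have h1 : Tens.map Φ (Twist.map θ (A.d i j).hom) ∘ₗ Tens.map Φ (D i).lift =
      Tens.map Φ (D j).lift ∘ₗ Tens.map Φ (A.d i j).hom +
        Tens.map Φ (Twist.incl θ (A.X j)) ∘ₗ Tens.map Φ (bocksteinMap D i j) := by
    refine Tens.hom_ext Φ fun v m => ?_
    simp only [LinearMap.add_apply, LinearMap.comp_apply, Tens.map_mk]
    rw [← Submodule.Quotient.mk_add, ← TensorProduct.tmul_add]
    congr 2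
    refine Twist.ext θ ?_ ?_
    · change (A.d i j).hom ((D i).nabla m) = (D j).nabla ((A.d i j).hom m) +
        ((A.d i j).hom ((D i).nabla m) - (D j).nabla ((A.d i j).hom m))
      abel
    · exact (add_zero _).symm
  have h2 := LinearMap.congr_fun h1 x
  rw [LinearMap.add_apply, LinearMap.comp_apply, LinearMap.comp_apply, LinearMap.comp_apply, hx,
    map_zero, zero_add, ← hy] at h2
  exact h2.symm

variable (hA : IsStrictlyPerfect A)

/-- The definition of the connecting homomorphism, carried out with the lift given by the
connection: the differential of the lifted cycle is the inclusion of `β z`. -/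
theorem bockstein_homologyπ {i j : ℤ} (h : i + 1 = j) (z : (tensComplex Φ A).cycles i)
    (y : (tensComplex Φ A).cycles j)
    (hy : ((tensComplex Φ A).iCycles j).hom y =
      Tens.map Φ (bocksteinMap D i j) (((tensComplex Φ A).iCycles i).hom z)) :
    bockstein Φ θ hA i j (((tensComplex Φ A).homologyπ i).hom z) =
      ((tensComplex Φ A).homologyπ j).hom y := by
  have hb : bockstein Φ θ hA i j = ((tensThetaSequence_shortExact Φ θ hA).δ i j h).hom :=
    dif_pos h
  refine (LinearMap.congr_fun hb _).trans ?_
  have hS := tensThetaSequence_shortExact Φ θ hA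
  let T := tensThetaSequence Φ θ A
  let x₂ : T.X₂.X i := Tens.map Φ (D i).lift (((tensComplex Φ A).iCycles i).hom z)
  have e1 : (T.g.f i).hom x₂ = (T.X₃.iCycles i).hom z := by
    have : Tens.map Φ (Twist.proj θ (A.X i)) ∘ₗ Tens.map Φ (D i).lift = LinearMap.id :=
      Tens.hom_ext Φ fun v m => rfl
    exact LinearMap.congr_fun this _
  have e2 : (T.f.f j).hom ((T.X₁.iCycles j).hom y) = (T.X₂.d i j).hom x₂ := by
    exact tens_incl_eq Φ D i j _ _ (d_iCycles (tensComplex Φ A) i j z) hy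
  refine hS.δ_apply' i j h (((tensComplex Φ A).homologyπ i).hom z) ((T.X₂.pOpcycles i).hom x₂) y
    ?_ ?_
  · change (HomologicalComplex.opcyclesMap T.g i).hom ((T.X₂.pOpcycles i).hom x₂) =
      (T.X₃.homologyι i).hom ((T.X₃.homologyπ i).hom z)
    have h1 : (T.X₂.pOpcycles i ≫ HomologicalComplex.opcyclesMap T.g i).hom x₂ =
      (T.g.f i ≫ T.X₃.pOpcycles i).hom x₂ := by rw [HomologicalComplex.p_opcyclesMap]
    have h2 : (T.X₃.homologyπ i ≫ T.X₃.homologyι i).hom z =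
      (T.X₃.iCycles i ≫ T.X₃.pOpcycles i).hom z := by rw [HomologicalComplex.homology_π_ι]
    refine h1.trans (Eq.trans ?_ h2.symm)
    exact congrArg (T.X₃.pOpcycles i).hom e1
  · apply iCycles_injective T.X₂ j
    have h1 : (HomologicalComplex.cyclesMap T.f j ≫ T.X₂.iCycles j).hom y =
      (T.X₁.iCycles j ≫ T.f.f j).hom y := by rw [HomologicalComplex.cyclesMap_i]
    have h2 : (T.X₂.pOpcycles i ≫ T.X₂.opcyclesToCycles i j ≫ T.X₂.iCycles j).hom x₂ =
      (T.X₂.d i j).hom x₂ := by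
        rw [HomologicalComplex.pOpcycles_opcyclesToCycles_assoc, HomologicalComplex.toCycles_i]
    exact h1.trans (e2.trans h2.symm)

end BocksteinFormula

/-! ### Graded complexes with a Bockstein operator, and their tensor products -/

/-- A complex with differential `d` and an operator `β` of degree one that anticommutes with `d`
and whose square is homotopic to zero. -/
structure GradedBockstein (R : Type*) [Ring R] (X : ℤ → Type*) [∀ i, AddCommGroup (X i)]
    [∀ i, Module R (X i)] where
  d (i j : ℤ) : X i →ₗ[R] X j
  β (i j : ℤ) : X i →ₗ[R] X j
  h (i j : ℤ) : X i →ₗ[R] X j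
  d_shape : ∀ i j, i + 1 ≠ j → d i j = 0
  β_shape : ∀ i j, i + 1 ≠ j → β i j = 0
  h_shape : ∀ i j, i + 1 ≠ j → h i j = 0
  d_d : ∀ i j k, d j k ∘ₗ d i j = 0
  d_β : ∀ i j k, d j k ∘ₗ β i j + β j k ∘ₗ d i j = 0
  β_β : ∀ i j k, β j k ∘ₗ β i j = d j k ∘ₗ h i j + h j k ∘ₗ d i j

namespace GradedBockstein

variable {R : Type*} [Ring R] {X : ℤ → Type*} [∀ i, AddCommGroup (X i)]
    [∀ i, Module R (X i)] (B : GradedBockstein R X)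

/-- The cycles whose classes lie in the kernel of the Bockstein map. -/
def kerB (i j : ℤ) : Submodule R (X i) :=
  LinearMap.ker (B.d i j) ⊓ (LinearMap.range (B.d i j)).comap (B.β i j)

/-- The cycles whose classes lie in the image of the Bockstein map. -/
def imB (i j : ℤ) : Submodule R (X j) :=
  LinearMap.range (B.d i j) ⊔ (LinearMap.ker (B.d i j)).map (B.β i j)

theorem d_d_apply (i j k : ℤ) (x : X i) : B.d j k (B.d i j x) = 0 :=
  LinearMap.congr_fun (B.d_d i j k) x

theorem d_β_apply (i j k : ℤ) (x : X i) : B.d j k (B.β i j x) = -B.β j k (B.d i j x) :=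
  eq_neg_of_add_eq_zero_left (LinearMap.congr_fun (B.d_β i j k) x)

theorem β_β_apply (i j k : ℤ) (x : X i) :
    B.β j k (B.β i j x) = B.d j k (B.h i j x) + B.h j k (B.d i j x) :=
  LinearMap.congr_fun (B.β_β i j k) x

theorem imB_le_kerB (i j k : ℤ) : B.imB i j ≤ B.kerB j k := by
  refine sup_le ?_ ?_
  · rintro _ ⟨x, rfl⟩
    refine ⟨B.d_d_apply _ _ _ _, -B.β i j x, ?_⟩
    rw [map_neg, B.d_β_apply, neg_neg]
  · rintro _ ⟨x, hx, rfl⟩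
    have hx' : B.d i j x = 0 := hx
    refine ⟨?_, B.h i j x, ?_⟩
    · change B.d j k (B.β i j x) = 0
      rw [B.d_β_apply, hx', map_zero, neg_zero]
    · rw [B.β_β_apply, hx', map_zero, add_zero]

end GradedBockstein

section TensBockstein

universe u v w

variable {p : ℕ} [Fact p.Prime] {G : Type u} [Group G] [TopologicalSpace G]
  [IsTopologicalGroup G] [CompactSpace G] [T2Space G] {θ : G →ₜ* Multiplicative ℤ_[p]}
  {A : CochainComplex (ModuleCat.{v} (Iwasawa ℤ_[p] G)) ℤ}
  (D : ∀ i, Connection θ (A.X i))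

/-- The complex `A` with the cocycle that represents the Bockstein morphism. -/
def connectionBockstein : GradedBockstein (Iwasawa ℤ_[p] G) fun i => A.X i where
  d i j := (A.d i j).hom
  β i j := bocksteinMap D i j
  h i j := (D i).eta (D j) (A.d i j).hom
  d_shape i j h := by rw [A.shape i j h]; rfl
  β_shape i j h := by rw [bocksteinMap, A.shape i j h]; exact Connection.beta_zero _ _
  h_shape i j h := by rw [A.shape i j h]; exact Connection.eta_zero _ _
  d_d i j k := by rw [← ModuleCat.hom_comp, A.d_comp_d]; rfl
  d_β i j k := Connection.comp_beta_add _ _ (D k)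
    (by rw [← ModuleCat.hom_comp, A.d_comp_d]; rfl)
  β_β i j k := Connection.beta_comp_beta _ _ (D k)
    (by rw [← ModuleCat.hom_comp, A.d_comp_d]; rfl)

end TensBockstein

section TensFunctoriality

variable {Λ : Type*} [Ring Λ] {S : Type*} [Ring S] {n : ℕ}
  (Φ : Λ →+* Matrix (Fin n) (Fin n) S) {M N Q : Type*} [AddCommGroup M] [Module Λ M]
  [AddCommGroup N] [Module Λ N] [AddCommGroup Q] [Module Λ Q]

theorem Tens.map_id : Tens.map Φ (LinearMap.id : M →ₗ[Λ] M) = LinearMap.id :=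
  Tens.hom_ext Φ fun _ _ => rfl

theorem Tens.map_comp (g : N →ₗ[Λ] Q) (f : M →ₗ[Λ] N) :
    Tens.map Φ (g ∘ₗ f) = Tens.map Φ g ∘ₗ Tens.map Φ f :=
  Tens.hom_ext Φ fun _ _ => rfl

theorem Tens.map_add (f g : M →ₗ[Λ] N) : Tens.map Φ (f + g) = Tens.map Φ f + Tens.map Φ g :=
  Tens.hom_ext Φ fun v m => by
    change (Submodule.Quotient.mk (v ⊗ₜ (f m + g m)) : Tens Φ N) = _
    rw [TensorProduct.tmul_add]
    rfl

theorem Tens.map_zero : Tens.map Φ (0 : M →ₗ[Λ] N) = 0 :=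
  Tens.hom_ext Φ fun v m => by
    change (Submodule.Quotient.mk (v ⊗ₜ (0 : N)) : Tens Φ N) = _
    rw [TensorProduct.tmul_zero]
    rfl

instance Tens.subsingleton [Subsingleton M] : Subsingleton (Tens Φ M) := by
  have h : (LinearMap.id : Tens Φ M →ₗ[S] Tens Φ M) = 0 := by
    rw [← Tens.map_id, ← Tens.map_zero]
    congr 1
    ext x
    exact Subsingleton.elim _ _
  exact ⟨fun x y => by
    rw [← LinearMap.id_apply (R := S) x, ← LinearMap.id_apply (R := S) y, h]; rfl⟩

/-- The functor `S^n ⊗_Λ -` applied to a complex with a Bockstein operator. -/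
def GradedBockstein.tens {X : ℤ → Type*} [∀ i, AddCommGroup (X i)] [∀ i, Module Λ (X i)]
    (B : GradedBockstein Λ X) : GradedBockstein S fun i => Tens Φ (X i) where
  d i j := Tens.map Φ (B.d i j)
  β i j := Tens.map Φ (B.β i j)
  h i j := Tens.map Φ (B.h i j)
  d_shape i j h := by rw [B.d_shape i j h, Tens.map_zero]
  β_shape i j h := by rw [B.β_shape i j h, Tens.map_zero]
  h_shape i j h := by rw [B.h_shape i j h, Tens.map_zero]
  d_d i j k := by rw [← Tens.map_comp, B.d_d, Tens.map_zero]
  d_β i j k := by rw [← Tens.map_comp, ← Tens.map_comp, ← Tens.map_add, B.d_β, Tens.map_zero]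
  β_β i j k := by rw [← Tens.map_comp, ← Tens.map_comp, ← Tens.map_comp, ← Tens.map_add, B.β_β]

end TensFunctoriality

/-! ### The kernel and the image of the Bockstein map in terms of cycles -/

section BocksteinCohomology

universe u v w

variable {p : ℕ} [Fact p.Prime] {G : Type u} [Group G] [TopologicalSpace G]
  [IsTopologicalGroup G] [CompactSpace G] [T2Space G] {θ : G →ₜ* Multiplicative ℤ_[p]}
  {S : Type w} [Ring S] {n : ℕ} (Φ : Iwasawa ℤ_[p] G →+* Matrix (Fin n) (Fin n) S)
  {A : CochainComplex (ModuleCat.{v} (Iwasawa ℤ_[p] G)) ℤ}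

variable (A) in
/-- The inclusion of the cycles of `S^n ⊗ A`. -/
def cyc (i : ℤ) : (tensComplex Φ A).cycles i →ₗ[S] Tens Φ (A.X i) :=
  ((tensComplex Φ A).iCycles i).hom

variable (A) in
/-- The projection from the cycles of `S^n ⊗ A` to the cohomology. -/
def cls (i : ℤ) : (tensComplex Φ A).cycles i →ₗ[S] (tensComplex Φ A).homology i :=
  ((tensComplex Φ A).homologyπ i).hom

theorem cyc_injective (i : ℤ) : Function.Injective (cyc Φ A i) :=
  iCycles_injective (tensComplex Φ A) i

theorem cls_surjective (i : ℤ) : Function.Surjective (cls Φ A i) :=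
  homologyπ_surjective (tensComplex Φ A) i

theorem exists_cyc_eq {i j : ℤ} (h : i + 1 = j) {x : Tens Φ (A.X i)}
    (hx : Tens.map Φ (A.d i j).hom x = 0) : ∃ z, cyc Φ A i z = x :=
  exists_cycle (tensComplex Φ A) h hx

theorem d_cyc (i j : ℤ) (z : (tensComplex Φ A).cycles i) :
    Tens.map Φ (A.d i j).hom (cyc Φ A i z) = 0 :=
  d_iCycles (tensComplex Φ A) i j z

theorem cls_eq_zero_iff {i j : ℤ} (h : i + 1 = j) (z : (tensComplex Φ A).cycles j) :
    cls Φ A j z = 0 ↔ ∃ x, Tens.map Φ (A.d i j).hom x = cyc Φ A j z := by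
  have := ker_homologyπ (tensComplex Φ A) i j h
  exact (SetLike.ext_iff.mp this z)

variable (D : ∀ i, Connection θ (A.X i)) (hA : IsStrictlyPerfect A)

theorem exists_bockstein_cls {i j : ℤ} (h : i + 1 = j) (z : (tensComplex Φ A).cycles i) :
    ∃ y, cyc Φ A j y = Tens.map Φ (bocksteinMap D i j) (cyc Φ A i z) ∧
      bockstein Φ θ hA i j (cls Φ A i z) = cls Φ A j y := by
  obtain ⟨y, hy⟩ := exists_cyc_eq Φ (A := A) (i := j) rfl
    (x := Tens.map Φ (bocksteinMap D i j) (cyc Φ A i z)) (by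
      have := ((connectionBockstein D).tens Φ).d_β_apply i j (j + 1) (cyc Φ A i z)
      refine this.trans ?_
      have h2 : ((connectionBockstein D).tens Φ).d i j (cyc Φ A i z) = 0 := d_cyc Φ i j z
      rw [h2, _root_.map_zero, neg_zero])
  exact ⟨y, hy, bockstein_homologyπ Φ D hA h z y hy⟩

/-- On a cycle the square of `β` is a boundary, by its null-homotopy. The connections enter only the
proof. -/
theorem bockstein_bockstein (D : ∀ i, Connection θ (A.X i)) (hA : IsStrictlyPerfect A)
    (i j k : ℤ) (x : (tensComplex Φ A).homology i) :
    bockstein Φ θ hA j k (bockstein Φ θ hA i j x) = 0 := by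
  by_cases h : i + 1 = j
  swap
  · have : bockstein Φ θ hA i j = 0 := dif_neg h
    rw [this, LinearMap.zero_apply, _root_.map_zero]
  by_cases h' : j + 1 = k
  swap
  · have : bockstein Φ θ hA j k = 0 := dif_neg h'
    rw [this, LinearMap.zero_apply]
  obtain ⟨z, rfl⟩ := cls_surjective Φ i x
  obtain ⟨y, hy, e⟩ := exists_bockstein_cls Φ D hA h z
  obtain ⟨y', hy', e'⟩ := exists_bockstein_cls Φ D hA h' y
  rw [e, e', cls_eq_zero_iff Φ h', hy', hy]
  have := ((connectionBockstein D).tens Φ).β_β_apply i j k (cyc Φ A i z)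
  have h2 : ((connectionBockstein D).tens Φ).d i j (cyc Φ A i z) = 0 := d_cyc Φ i j z
  rw [h2, _root_.map_zero, add_zero] at this
  exact ⟨_, this.symm⟩

theorem bockstein_cls_eq_zero_iff {i j : ℤ} (h : i + 1 = j) (z : (tensComplex Φ A).cycles i) :
    bockstein Φ θ hA i j (cls Φ A i z) = 0 ↔
      cyc Φ A i z ∈ ((connectionBockstein D).tens Φ).kerB i j := by
  obtain ⟨y, hy, e⟩ := exists_bockstein_cls Φ D hA h z
  rw [e, cls_eq_zero_iff Φ h, hy]
  exact ⟨fun h => ⟨d_cyc Φ i j z, h⟩, fun h => h.2⟩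

theorem cls_mem_range_bockstein_iff {i j : ℤ} (h : i + 1 = j) (z : (tensComplex Φ A).cycles j) :
    cls Φ A j z ∈ LinearMap.range (bockstein Φ θ hA i j) ↔
      cyc Φ A j z ∈ ((connectionBockstein D).tens Φ).imB i j := by
  constructor
  · rintro ⟨x, hx⟩
    obtain ⟨w, rfl⟩ := cls_surjective Φ i x
    obtain ⟨y, hy, e⟩ := exists_bockstein_cls Φ D hA h w
    have h0 : cls Φ A j (z - y) = 0 := by rw [_root_.map_sub, ← hx, e, sub_self]
    obtain ⟨x, hx⟩ := (cls_eq_zero_iff Φ h _).mp h0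
    refine Submodule.mem_sup.mpr ⟨_, ⟨x, rfl⟩, _, ⟨_, d_cyc Φ i j w, rfl⟩, ?_⟩
    change Tens.map Φ (A.d i j).hom x + Tens.map Φ (bocksteinMap D i j) (cyc Φ A i w) = _
    rw [hx, ← hy, _root_.map_sub, sub_add_cancel]
  · intro hz
    obtain ⟨_, ⟨x, rfl⟩, _, ⟨w, hw, rfl⟩, e⟩ := Submodule.mem_sup.mp hz
    obtain ⟨w, rfl⟩ := exists_cyc_eq Φ h hw
    obtain ⟨y, hy, e'⟩ := exists_bockstein_cls Φ D hA h w
    refine ⟨cls Φ A i w, ?_⟩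
    rw [e', ← sub_eq_zero, ← _root_.map_sub, cls_eq_zero_iff Φ h]
    refine ⟨-x, ?_⟩
    rw [_root_.map_neg, _root_.map_sub, hy, ← e]
    change -(Tens.map Φ (A.d i j).hom x) = _ - (Tens.map Φ (A.d i j).hom x + _)
    simp [connectionBockstein, GradedBockstein.tens]

end BocksteinCohomology

/-! ### The length of the Bockstein cohomology -/

section BocksteinLength

universe u v w

variable {p : ℕ} [Fact p.Prime] {G : Type u} [Group G] [TopologicalSpace G]
  [IsTopologicalGroup G] [CompactSpace G] [T2Space G] {θ : G →ₜ* Multiplicative ℤ_[p]}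
  {A : CochainComplex (ModuleCat.{v} (Iwasawa ℤ_[p] G)) ℤ}
  {S : Type w} [CommRing S] {n : ℕ} (Φ : Iwasawa ℤ_[p] G →+* Matrix (Fin n) (Fin n) S)
  (D : ∀ i, Connection θ (A.X i)) (hA : IsStrictlyPerfect A)

/-- The subquotient of the cohomology is compared with its preimage in the module of cycles, and
that with its image in the complex. Neither step changes the length, because the kernels and images
of both maps are under control. -/
theorem length_bocksteinCohomology (i : ℤ) :
    Module.length S (BocksteinCohomology Φ θ hA i) =
      relLength (((connectionBockstein D).tens Φ).imB (i - 1) i)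
        (((connectionBockstein D).tens Φ).kerB i (i + 1)) := by
  set B := (connectionBockstein D).tens Φ
  have h1 : relLength ((B.imB (i - 1) i).comap (cyc Φ A i))
      ((B.kerB i (i + 1)).comap (cyc Φ A i)) =
      relLength (B.imB (i - 1) i) (B.kerB i (i + 1)) := by
    refine relLength_eq_of_map (cyc Φ A i) ?_ (fun x _ => Iff.rfl)
    refine le_antisymm (sup_le (Submodule.map_comap_le _ _) (B.imB_le_kerB _ _ _)) ?_
    refine le_sup_of_le_left fun x hx => ?_
    obtain ⟨z, rfl⟩ := exists_cyc_eq Φ rfl hx.1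
    exact ⟨z, hx, rfl⟩
  rw [← h1]
  have h2 : relLength ((B.imB (i - 1) i).comap (cyc Φ A i))
      ((B.kerB i (i + 1)).comap (cyc Φ A i)) =
      relLength (LinearMap.range (bockstein Φ θ hA (i - 1) i))
        (LinearMap.ker (bockstein Φ θ hA i (i + 1))) := by
    refine relLength_eq_of_map (cls Φ A i) ?_
      (fun x _ => cls_mem_range_bockstein_iff Φ D hA (by ring) x)
    refine le_antisymm (sup_le ?_ ?_) ?_
    · rintro _ ⟨z, hz, rfl⟩
      exact (bockstein_cls_eq_zero_iff Φ D hA rfl z).mpr hz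
    · rintro _ ⟨x, rfl⟩
      exact bockstein_bockstein Φ D hA _ _ _ x
    · refine le_sup_of_le_left fun x hx => ?_
      obtain ⟨z, rfl⟩ := cls_surjective Φ i x
      exact ⟨z, (bockstein_cls_eq_zero_iff Φ D hA rfl z).mp hx, rfl⟩
  rw [h2]
  rfl

end BocksteinLength

/-! ### Assembling a graded complex into one `ℤ/2`-graded module -/

/-- A decomposition of `V` into summands `X i`, almost all of which vanish, and a contractible
summand on which `n` and `n'` are inverse to each other; `ε` is the projector to the even part. -/
structure Decomp (R : Type*) [Ring R] (X : ℤ → Type*) [∀ i, AddCommGroup (X i)]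
    [∀ i, Module R (X i)] (V : Type*) [AddCommGroup V] [Module R V] where
  S : Finset ℤ
  J (i : ℤ) : X i →ₗ[R] V
  Q (i : ℤ) : V →ₗ[R] X i
  n : Module.End R V
  n' : Module.End R V
  ε : Module.End R V
  Q_J : ∀ i, Q i ∘ₗ J i = LinearMap.id
  Q_J_ne : ∀ i j, i ≠ j → Q j ∘ₗ J i = 0
  n_J : ∀ i, n ∘ₗ J i = 0
  n'_J : ∀ i, n' ∘ₗ J i = 0
  Q_n : ∀ i, Q i ∘ₗ n = 0
  Q_n' : ∀ i, Q i ∘ₗ n' = 0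
  n_n : n * n = 0
  n'_n' : n' * n' = 0
  sum_J_Q : ∑ i ∈ S, J i ∘ₗ Q i + (n * n' + n' * n) = 1
  subsingleton : ∀ i, i ∉ S → Subsingleton (X i)
  ε_J_even : ∀ i, Even i → ε ∘ₗ J i = J i
  ε_J_odd : ∀ i, Odd i → ε ∘ₗ J i = 0
  Q_ε_even : ∀ i, Even i → Q i ∘ₗ ε = Q i
  Q_ε_odd : ∀ i, Odd i → Q i ∘ₗ ε = 0
  n_ε : n * ε = n
  ε_n : ε * n = 0
  n'_ε : n' * ε = 0
  ε_n' : ε * n' = n'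

namespace Decomp

variable {R : Type*} [Ring R] {X : ℤ → Type*} [∀ i, AddCommGroup (X i)]
    [∀ i, Module R (X i)] {V : Type*} [AddCommGroup V] [Module R V] (Δ : Decomp R X V)

/-- The endomorphism of `V` with components `f i j`. -/
def asm (f : ∀ i j, X i →ₗ[R] X j) : Module.End R V :=
  ∑ i ∈ Δ.S, ∑ j ∈ Δ.S, Δ.J j ∘ₗ f i j ∘ₗ Δ.Q i

/-- The endomorphism of `V` with diagonal components `e i`. -/
def dg (e : ∀ i, X i →ₗ[R] X i) : Module.End R V := ∑ i ∈ Δ.S, Δ.J i ∘ₗ e i ∘ₗ Δ.Q i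

theorem Q_J_apply (i : ℤ) (x : X i) : Δ.Q i (Δ.J i x) = x := LinearMap.congr_fun (Δ.Q_J i) x

theorem Q_J_ne_apply {i j : ℤ} (h : i ≠ j) (x : X i) : Δ.Q j (Δ.J i x) = 0 :=
  LinearMap.congr_fun (Δ.Q_J_ne i j h) x

theorem asm_apply (f : ∀ i j, X i →ₗ[R] X j) (v : V) :
    Δ.asm f v = ∑ i ∈ Δ.S, ∑ j ∈ Δ.S, Δ.J j (f i j (Δ.Q i v)) := by
  simp [asm, LinearMap.sum_apply]

theorem dg_apply (e : ∀ i, X i →ₗ[R] X i) (v : V) :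
    Δ.dg e v = ∑ i ∈ Δ.S, Δ.J i (e i (Δ.Q i v)) := by
  simp [dg, LinearMap.sum_apply]

theorem Q_sum (x : ∀ i, X i) (j : ℤ) : Δ.Q j (∑ i ∈ Δ.S, Δ.J i (x i)) = x j := by
  by_cases hj : j ∈ Δ.S
  · rw [map_sum, Finset.sum_eq_single j, Δ.Q_J_apply]
    · exact fun i _ h => Δ.Q_J_ne_apply h _
    · exact fun h => absurd hj h
  · have := Δ.subsingleton j hj
    exact Subsingleton.elim _ _

theorem Q_asm (f : ∀ i j, X i →ₗ[R] X j) (j : ℤ) (v : V) :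
    Δ.Q j (Δ.asm f v) = ∑ i ∈ Δ.S, f i j (Δ.Q i v) := by
  rw [asm_apply, Finset.sum_comm]
  simp_rw [← map_sum]
  exact Δ.Q_sum (fun j => ∑ i ∈ Δ.S, f i j (Δ.Q i v)) j

theorem Q_dg (e : ∀ i, X i →ₗ[R] X i) (j : ℤ) (v : V) : Δ.Q j (Δ.dg e v) = e j (Δ.Q j v) := by
  rw [dg_apply]
  exact Δ.Q_sum (fun j => e j (Δ.Q j v)) j

theorem n_J_apply (i : ℤ) (x : X i) : Δ.n (Δ.J i x) = 0 := LinearMap.congr_fun (Δ.n_J i) x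

theorem n'_J_apply (i : ℤ) (x : X i) : Δ.n' (Δ.J i x) = 0 := LinearMap.congr_fun (Δ.n'_J i) x

theorem Q_n_apply (i : ℤ) (v : V) : Δ.Q i (Δ.n v) = 0 := LinearMap.congr_fun (Δ.Q_n i) v

theorem Q_n'_apply (i : ℤ) (v : V) : Δ.Q i (Δ.n' v) = 0 := LinearMap.congr_fun (Δ.Q_n' i) v

theorem n_mul_asm (f : ∀ i j, X i →ₗ[R] X j) : Δ.n * Δ.asm f = 0 := by
  refine LinearMap.ext fun v => ?_
  simp [asm_apply, n_J_apply]

theorem n'_mul_asm (f : ∀ i j, X i →ₗ[R] X j) : Δ.n' * Δ.asm f = 0 := by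
  refine LinearMap.ext fun v => ?_
  simp [asm_apply, n'_J_apply]

theorem asm_mul_n (f : ∀ i j, X i →ₗ[R] X j) : Δ.asm f * Δ.n = 0 := by
  refine LinearMap.ext fun v => ?_
  simp [asm_apply, Q_n_apply]

theorem asm_mul_n' (f : ∀ i j, X i →ₗ[R] X j) : Δ.asm f * Δ.n' = 0 := by
  refine LinearMap.ext fun v => ?_
  simp [asm_apply, Q_n'_apply]

theorem n_mul_dg (e : ∀ i, X i →ₗ[R] X i) : Δ.n * Δ.dg e = 0 := by
  refine LinearMap.ext fun v => ?_
  simp [dg_apply, n_J_apply]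

theorem n'_mul_dg (e : ∀ i, X i →ₗ[R] X i) : Δ.n' * Δ.dg e = 0 := by
  refine LinearMap.ext fun v => ?_
  simp [dg_apply, n'_J_apply]

theorem dg_mul_n (e : ∀ i, X i →ₗ[R] X i) : Δ.dg e * Δ.n = 0 := by
  refine LinearMap.ext fun v => ?_
  simp [dg_apply, Q_n_apply]

theorem dg_mul_n' (e : ∀ i, X i →ₗ[R] X i) : Δ.dg e * Δ.n' = 0 := by
  refine LinearMap.ext fun v => ?_
  simp [dg_apply, Q_n'_apply]

theorem asm_mul (g f : ∀ i j, X i →ₗ[R] X j) :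
    Δ.asm g * Δ.asm f = Δ.asm fun i k => ∑ j ∈ Δ.S, g j k ∘ₗ f i j := by
  refine LinearMap.ext fun v => ?_
  rw [Module.End.mul_apply, asm_apply _ g,
    asm_apply _ (fun i k => ∑ j ∈ Δ.S, g j k ∘ₗ f i j), Finset.sum_comm]
  conv_rhs => rw [Finset.sum_comm]
  refine Finset.sum_congr rfl fun k _ => ?_
  simp_rw [Q_asm, map_sum, LinearMap.sum_apply, LinearMap.comp_apply, map_sum]
  rw [Finset.sum_comm]

theorem dg_mul_asm (e : ∀ i, X i →ₗ[R] X i) (f : ∀ i j, X i →ₗ[R] X j) :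
    Δ.dg e * Δ.asm f = Δ.asm fun i j => e j ∘ₗ f i j := by
  refine LinearMap.ext fun v => ?_
  rw [Module.End.mul_apply, dg_apply, asm_apply _ (fun i j => e j ∘ₗ f i j), Finset.sum_comm]
  refine Finset.sum_congr rfl fun k _ => ?_
  simp_rw [Q_asm, map_sum, LinearMap.comp_apply]

theorem asm_mul_dg (f : ∀ i j, X i →ₗ[R] X j) (e : ∀ i, X i →ₗ[R] X i) :
    Δ.asm f * Δ.dg e = Δ.asm fun i j => f i j ∘ₗ e i := by
  refine LinearMap.ext fun v => ?_
  rw [Module.End.mul_apply, asm_apply, asm_apply]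
  simp_rw [Q_dg, LinearMap.comp_apply]

theorem asm_zero : Δ.asm (fun _ _ => 0) = 0 := by
  simp [asm]

theorem asm_add (f g : ∀ i j, X i →ₗ[R] X j) :
    Δ.asm f + Δ.asm g = Δ.asm fun i j => f i j + g i j := by
  refine LinearMap.ext fun v => ?_
  simp [asm_apply, Finset.sum_add_distrib]

theorem dg_add (e e' : ∀ i, X i →ₗ[R] X i) :
    Δ.dg e + Δ.dg e' = Δ.dg fun i => e i + e' i := by
  refine LinearMap.ext fun v => ?_
  simp [dg_apply, Finset.sum_add_distrib]

theorem dg_id : Δ.dg (fun _ => LinearMap.id) + (Δ.n * Δ.n' + Δ.n' * Δ.n) = 1 := by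
  have h := Δ.sum_J_Q
  simpa [dg] using h

/-- Only the index `i + 1` contributes. If it lies outside the finite set, both sides vanish because
that summand is trivial, so no boundary cases arise later. -/
theorem sum_up {M : Type*} [AddCommGroup M] (f : ∀ i j, X i →ₗ[R] X j)
    (hf : ∀ i j, i + 1 ≠ j → f i j = 0) (g : ∀ j, X j →+ M) (i : ℤ) (x : X i) :
    ∑ j ∈ Δ.S, g j (f i j x) = g (i + 1) (f i (i + 1) x) := by
  by_cases h : i + 1 ∈ Δ.S
  · rw [Finset.sum_eq_single (i + 1)]
    · intro j _ hj
      rw [hf i j hj.symm, LinearMap.zero_apply, map_zero]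
    · exact fun h' => absurd h h'
  · have := Δ.subsingleton _ h
    rw [Subsingleton.elim (f i (i + 1) x) 0, map_zero]
    refine Finset.sum_eq_zero fun j hj => ?_
    rw [hf i j (fun h' => h (h' ▸ hj)), LinearMap.zero_apply, map_zero]

theorem sum_down {M : Type*} [AddCommGroup M] (f : ∀ i j, X i →ₗ[R] X j)
    (hf : ∀ i j, j + 1 ≠ i → f i j = 0) (g : ∀ j, X j →+ M) (i : ℤ) (x : X i) :
    ∑ j ∈ Δ.S, g j (f i j x) = g (i - 1) (f i (i - 1) x) := by
  by_cases h : i - 1 ∈ Δ.S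
  · rw [Finset.sum_eq_single (i - 1)]
    · intro j _ hj
      rw [hf i j (fun h => hj (by omega)), LinearMap.zero_apply, map_zero]
    · exact fun h' => absurd h h'
  · have := Δ.subsingleton _ h
    rw [Subsingleton.elim (f i (i - 1) x) 0, map_zero]
    refine Finset.sum_eq_zero fun j hj => ?_
    rw [hf i j (fun h' => h (by rw [← h', add_sub_cancel_right]; exact hj)),
      LinearMap.zero_apply, map_zero]

theorem asm_eq_dg (f : ∀ i j, X i →ₗ[R] X j) (hf : ∀ i j, i ≠ j → f i j = 0) :
    Δ.asm f = Δ.dg fun i => f i i := by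
  refine Finset.sum_congr rfl fun i hi => ?_
  rw [Finset.sum_eq_single i]
  · intro j _ hj
    rw [hf i j hj.symm, LinearMap.zero_comp, LinearMap.comp_zero]
  · exact fun h => absurd hi h

theorem asm_mul_up (g f : ∀ i j, X i →ₗ[R] X j) (hf : ∀ i j, i + 1 ≠ j → f i j = 0)
    (hg : ∀ i j, j + 1 ≠ i → g i j = 0) :
    Δ.asm g * Δ.asm f = Δ.dg fun i => g (i + 1) i ∘ₗ f i (i + 1) := by
  rw [asm_mul, asm_eq_dg]
  · congr 1
    funext i
    ext x
    rw [LinearMap.sum_apply]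
    exact Δ.sum_up f hf (fun j => (g j i).toAddMonoidHom) i x
  · intro i k hik
    refine Finset.sum_eq_zero fun j _ => ?_
    by_cases h : i + 1 = j
    · rw [hg j k (fun h' => hik (by omega)), LinearMap.zero_comp]
    · rw [hf i j h, LinearMap.comp_zero]

theorem asm_mul_down (g f : ∀ i j, X i →ₗ[R] X j) (hf : ∀ i j, j + 1 ≠ i → f i j = 0)
    (hg : ∀ i j, i + 1 ≠ j → g i j = 0) :
    Δ.asm g * Δ.asm f = Δ.dg fun i => g (i - 1) i ∘ₗ f i (i - 1) := by
  rw [asm_mul, asm_eq_dg]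
  · congr 1
    funext i
    ext x
    rw [LinearMap.sum_apply]
    exact Δ.sum_down f hf (fun j => (g j i).toAddMonoidHom) i x
  · intro i k hik
    refine Finset.sum_eq_zero fun j _ => ?_
    by_cases h : j + 1 = i
    · rw [hg j k (fun h' => hik (by omega)), LinearMap.zero_comp]
    · rw [hf i j h, LinearMap.comp_zero]

theorem asm_mul_eq_zero (g f : ∀ i j, X i →ₗ[R] X j) (h : ∀ i j k, g j k ∘ₗ f i j = 0) :
    Δ.asm g * Δ.asm f = 0 := by
  rw [asm_mul]
  simp_rw [h, Finset.sum_const_zero]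
  exact Δ.asm_zero

theorem asm_mul_ε (f : ∀ i j, X i →ₗ[R] X j) (hf : ∀ i j, i + 1 ≠ j → j + 1 ≠ i → f i j = 0) :
    Δ.asm f * Δ.ε = (1 - Δ.ε) * Δ.asm f := by
  rw [asm, Finset.sum_mul, Finset.mul_sum]
  refine Finset.sum_congr rfl fun i _ => ?_
  rw [Finset.sum_mul, Finset.mul_sum]
  refine Finset.sum_congr rfl fun j _ => ?_
  by_cases hij : i + 1 = j ∨ j + 1 = i
  · rw [sub_mul, one_mul]
    change Δ.J j ∘ₗ f i j ∘ₗ (Δ.Q i ∘ₗ Δ.ε) =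
      Δ.J j ∘ₗ f i j ∘ₗ Δ.Q i - (Δ.ε ∘ₗ Δ.J j) ∘ₗ f i j ∘ₗ Δ.Q i
    rcases Int.even_or_odd i with hi | hi
    · have hj : Odd j := by
        rcases hij with rfl | rfl
        · exact hi.add_one
        · exact (Int.not_even_iff_odd).mp fun h => (Int.not_even_iff_odd.mpr h.add_one) hi
      rw [Δ.Q_ε_even i hi, Δ.ε_J_odd j hj, LinearMap.zero_comp, sub_zero]
    · have hj : Even j := by
        rcases hij with rfl | rfl
        · exact hi.add_one
        · exact (Int.not_odd_iff_even).mp fun h => (Int.not_odd_iff_even.mpr h.add_one) hi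
      rw [Δ.Q_ε_odd i hi, Δ.ε_J_even j hj, sub_self, LinearMap.comp_zero, LinearMap.comp_zero]
  · rw [hf i j (fun h => hij (Or.inl h)) (fun h => hij (Or.inr h)), LinearMap.zero_comp,
      LinearMap.comp_zero, zero_mul, mul_zero]

theorem n_mul_ε : Δ.n * Δ.ε = (1 - Δ.ε) * Δ.n := by
  rw [Δ.n_ε, sub_mul, one_mul, Δ.ε_n, sub_zero]

theorem n'_mul_ε : Δ.n' * Δ.ε = (1 - Δ.ε) * Δ.n' := by
  rw [Δ.n'_ε, sub_mul, one_mul, Δ.ε_n', sub_self]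

/-- The differential of the total complex. -/
def dTot (B : GradedBockstein R X) : Module.End R V := Δ.asm B.d + Δ.n

/-- The Bockstein operator of the total complex. -/
def βTot (B : GradedBockstein R X) : Module.End R V := Δ.asm B.β

/-- The homotopy from zero to the square of the Bockstein operator of the total complex. -/
def hTot (B : GradedBockstein R X) : Module.End R V := Δ.asm B.h

variable (B : GradedBockstein R X)

theorem dTot_mul_dTot : Δ.dTot B * Δ.dTot B = 0 := by
  rw [dTot, add_mul, mul_add, mul_add, Δ.asm_mul_eq_zero _ _ B.d_d, Δ.asm_mul_n, Δ.n_mul_asm,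
    Δ.n_n]
  simp

theorem dTot_βTot : Δ.dTot B * Δ.βTot B + Δ.βTot B * Δ.dTot B = 0 := by
  rw [dTot, βTot, add_mul, mul_add, Δ.n_mul_asm, Δ.asm_mul_n, add_zero, add_zero, asm_mul, asm_mul,
    asm_add]
  simp_rw [← Finset.sum_add_distrib, B.d_β, Finset.sum_const_zero]
  exact Δ.asm_zero

theorem βTot_mul_βTot : Δ.βTot B * Δ.βTot B = Δ.dTot B * Δ.hTot B + Δ.hTot B * Δ.dTot B := by
  rw [dTot, hTot, βTot, add_mul, mul_add, Δ.n_mul_asm, Δ.asm_mul_n, add_zero, add_zero, asm_mul,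
    asm_mul, asm_mul, asm_add]
  simp_rw [B.β_β, ← Finset.sum_add_distrib]

end Decomp

/-! ### Splittings of graded complexes -/

/-- A splitting of a complex into its cohomology and a contractible complex, together with a
contraction of the cohomology with respect to the Bockstein map. -/
structure GradedSplitting {K : Type*} [Ring K] {X : ℤ → Type*} [∀ i, AddCommGroup (X i)]
    [∀ i, Module K (X i)] (B : GradedBockstein K X) where
  s (i j : ℤ) : X i →ₗ[K] X j
  e (i : ℤ) : X i →ₗ[K] X i
  b (i j : ℤ) : X i →ₗ[K] X j
  τ (i j : ℤ) : X i →ₗ[K] X j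
  s_shape : ∀ i j, j + 1 ≠ i → s i j = 0
  τ_shape : ∀ i j, j + 1 ≠ i → τ i j = 0
  d_e : ∀ i j, B.d i j ∘ₗ e i = 0
  e_d : ∀ i j, e j ∘ₗ B.d i j = 0
  s_e : ∀ i j, s i j ∘ₗ e i = 0
  e_s : ∀ i j, e j ∘ₗ s i j = 0
  homotopy : ∀ i, B.d (i - 1) i ∘ₗ s i (i - 1) + s (i + 1) i ∘ₗ B.d i (i + 1) =
    LinearMap.id - e i
  s_s : ∀ i j k, s j k ∘ₗ s i j = 0
  b_eq : ∀ i j, b i j = e j ∘ₗ B.β i j ∘ₗ e i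
  e_τ : ∀ i j, e j ∘ₗ τ i j = τ i j
  τ_e : ∀ i j, τ i j ∘ₗ e i = τ i j
  τ_τ : ∀ i j k, τ j k ∘ₗ τ i j = 0
  b_τ : ∀ i, b (i - 1) i ∘ₗ τ i (i - 1) + τ (i + 1) i ∘ₗ b i (i + 1) = e i

namespace GradedSplitting

variable {K : Type*} [Ring K] {X : ℤ → Type*} [∀ i, AddCommGroup (X i)]
    [∀ i, Module K (X i)] {B : GradedBockstein K X} (U : GradedSplitting B)
    {V : Type*} [AddCommGroup V] [Module K V] (Δ : Decomp K X V)

theorem b_shape (i j : ℤ) (h : i + 1 ≠ j) : U.b i j = 0 := by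
  rw [U.b_eq, B.β_shape i j h, LinearMap.zero_comp, LinearMap.comp_zero]

/-- Each relation holds degree by degree. The extra summand is contracted by `n'`, so it contributes
neither to the projector nor to the Bockstein operator. -/
theorem ringSplitting : RingSplitting (Δ.dTot B) (Δ.βTot B) (Δ.asm U.s + Δ.n') (Δ.dg U.e)
    (Δ.asm U.b) (Δ.asm U.τ) where
  d_e := by
    rw [Decomp.dTot, add_mul, Δ.n_mul_dg, Δ.asm_mul_dg]
    simp_rw [U.d_e]
    rw [Δ.asm_zero, add_zero]
  e_d := by
    rw [Decomp.dTot, mul_add, Δ.dg_mul_n, Δ.dg_mul_asm]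
    simp_rw [U.e_d]
    rw [Δ.asm_zero, add_zero]
  s_e := by
    rw [add_mul, Δ.n'_mul_dg, Δ.asm_mul_dg]
    simp_rw [U.s_e]
    rw [Δ.asm_zero, add_zero]
  e_s := by
    rw [mul_add, Δ.dg_mul_n', Δ.dg_mul_asm]
    simp_rw [U.e_s]
    rw [Δ.asm_zero, add_zero]
  homotopy := by
    have h1 : Δ.asm B.d * Δ.asm U.s + Δ.asm U.s * Δ.asm B.d + Δ.dg U.e =
        Δ.dg (fun _ => LinearMap.id) := by
      rw [Δ.asm_mul_down _ _ U.s_shape B.d_shape, Δ.asm_mul_up _ _ B.d_shape U.s_shape,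
        Δ.dg_add, Δ.dg_add]
      congr 1
      funext i
      rw [U.homotopy, sub_add_cancel]
    rw [← Δ.dg_id, ← h1, Decomp.dTot]
    simp only [add_mul, mul_add, Δ.n_mul_asm, Δ.asm_mul_n', Δ.asm_mul_n, Δ.n'_mul_asm]
    abel
  s_s := by
    rw [add_mul, mul_add, mul_add, Δ.asm_mul_eq_zero _ _ U.s_s, Δ.n'_n', Δ.asm_mul_n',
      Δ.n'_mul_asm]
    simp
  b_eq := by
    rw [Decomp.βTot, Δ.dg_mul_asm, Δ.asm_mul_dg]
    congr 1
    funext i j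
    rw [U.b_eq, LinearMap.comp_assoc]
  e_τ := by
    rw [Δ.dg_mul_asm]
    simp_rw [U.e_τ]
  τ_e := by
    rw [Δ.asm_mul_dg]
    simp_rw [U.τ_e]
  τ_τ := Δ.asm_mul_eq_zero _ _ U.τ_τ
  b_τ := by
    rw [Δ.asm_mul_down _ _ U.τ_shape U.b_shape, Δ.asm_mul_up _ _ U.b_shape U.τ_shape, Δ.dg_add]
    congr 1
    funext i
    exact U.b_τ i

end GradedSplitting

/-- The components induce an isomorphism from `B / A` to the product of the `B' i / A' i`: `h2`
gives injectivity and `h3` gives surjectivity. -/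
theorem relLength_eq_sum {R : Type*} [CommRing R] {C : Type*} [AddCommGroup C] [Module R C]
    {ι : Type*} {X : ι → Type*} [∀ i, AddCommGroup (X i)] [∀ i, Module R (X i)]
    (T : Finset ι) (Q : ∀ i, C →ₗ[R] X i) (A B : Submodule R C) (A' B' : ∀ i, Submodule R (X i))
    (h1 : ∀ z ∈ B, ∀ i ∈ T, Q i z ∈ B' i)
    (h2 : ∀ z ∈ B, z ∈ A ↔ ∀ i ∈ T, Q i z ∈ A' i)
    (h3 : ∀ y : ∀ i, X i, (∀ i ∈ T, y i ∈ B' i) → ∃ z ∈ B, ∀ i ∈ T, Q i z = y i) :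
    relLength A B = ∑ i ∈ T, relLength (A' i) (B' i) := by
  classical
  let F : B →ₗ[R] ∀ i : T, (B' i ⧸ (A' i).submoduleOf (B' i)) :=
    LinearMap.pi fun i => ((A' i).submoduleOf (B' i)).mkQ ∘ₗ
      (Q i).restrict (fun z hz => h1 z hz i i.2)
  have hker : LinearMap.ker F = A.submoduleOf B := by
    ext x
    rw [LinearMap.mem_ker, funext_iff, Subtype.forall]
    refine Iff.trans ?_ (h2 x x.2).symm
    refine forall₂_congr fun i hi => ?_
    exact Submodule.Quotient.mk_eq_zero _
  have hsurj : Function.Surjective F := by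
    intro y
    choose y' hy' using fun i : T => Submodule.mkQ_surjective _ (y i)
    obtain ⟨z, hz, hzy⟩ := h3 (fun i => if h : i ∈ T then (y' ⟨i, h⟩ : X i) else 0) (by
      intro i hi
      rw [dif_pos hi]
      exact (y' ⟨i, hi⟩).2)
    refine ⟨⟨z, hz⟩, funext fun i => ?_⟩
    rw [← hy' i]
    change ((A' i).submoduleOf (B' i)).mkQ _ = _
    congr 1
    refine Subtype.ext ?_
    change Q i z = y' i
    rw [hzy i i.2, dif_pos i.2]
  unfold relLength
  rw [← hker, (F.quotKerEquivOfSurjective hsurj).length_eq, Module.length_pi_of_fintype]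
  exact Finset.sum_coe_sort T fun i => Module.length R (B' i ⧸ (A' i).submoduleOf (B' i))

namespace Decomp

section Components

variable {R : Type*} [Ring R] {X : ℤ → Type*} [∀ i, AddCommGroup (X i)]
    [∀ i, Module R (X i)] {V : Type*} [AddCommGroup V] [Module R V] (Δ : Decomp R X V)

theorem Q_asm_up {f : ∀ i j, X i →ₗ[R] X j} (hf : ∀ i j, i + 1 ≠ j → f i j = 0) {i j : ℤ}
    (h : i + 1 = j) (v : V) : Δ.Q j (Δ.asm f v) = f i j (Δ.Q i v) := by
  rw [Q_asm]
  by_cases hi : i ∈ Δ.S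
  · refine Finset.sum_eq_single i (fun k _ hk => ?_) (fun h => absurd hi h)
    rw [hf k j (by omega), LinearMap.zero_apply]
  · have := Δ.subsingleton i hi
    rw [Subsingleton.elim (Δ.Q i v) 0, map_zero]
    refine Finset.sum_eq_zero fun k hk => ?_
    rw [hf k j (fun h' => hi (by rwa [show i = k by omega])), LinearMap.zero_apply]

theorem asm_J_up {f : ∀ i j, X i →ₗ[R] X j} (hf : ∀ i j, i + 1 ≠ j → f i j = 0) {i j : ℤ}
    (h : i + 1 = j) (x : X i) : Δ.asm f (Δ.J i x) = Δ.J j (f i j x) := by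
  subst h
  rw [asm_apply]
  have : ∀ k ∈ Δ.S, ∑ j ∈ Δ.S, Δ.J j (f k j (Δ.Q k (Δ.J i x))) =
      Δ.J (k + 1) (f k (k + 1) (Δ.Q k (Δ.J i x))) :=
    fun k _ => Δ.sum_up f hf (fun j => (Δ.J j).toAddMonoidHom) k _
  rw [Finset.sum_congr rfl this]
  by_cases hi : i ∈ Δ.S
  · rw [Finset.sum_eq_single i, Δ.Q_J_apply]
    · intro k _ hk
      rw [Δ.Q_J_ne_apply hk.symm, map_zero, map_zero]
    · exact fun h => absurd hi h
  · have := Δ.subsingleton i hi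
    rw [Subsingleton.elim x 0]
    simp

variable (B : GradedBockstein R X)

theorem dTot_J {i j : ℤ} (h : i + 1 = j) (x : X i) :
    Δ.dTot B (Δ.J i x) = Δ.J j (B.d i j x) := by
  rw [dTot, LinearMap.add_apply, Δ.asm_J_up B.d_shape h, Δ.n_J_apply, add_zero]

theorem βTot_J {i j : ℤ} (h : i + 1 = j) (x : X i) :
    Δ.βTot B (Δ.J i x) = Δ.J j (B.β i j x) := Δ.asm_J_up B.β_shape h x

theorem Q_dTot {i j : ℤ} (h : i + 1 = j) (v : V) : Δ.Q j (Δ.dTot B v) = B.d i j (Δ.Q i v) := by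
  rw [dTot, LinearMap.add_apply, map_add, Δ.Q_asm_up B.d_shape h, Δ.Q_n_apply, add_zero]

theorem Q_βTot {i j : ℤ} (h : i + 1 = j) (v : V) : Δ.Q j (Δ.βTot B v) = B.β i j (Δ.Q i v) :=
  Δ.Q_asm_up B.β_shape h v

/-- On the contractible summand the differential is `n`, so a cycle satisfies `n v = 0`. Its part
there equals `n n' v`, which is the boundary of `n' v`. -/
theorem eq_sum_of_dTot_eq_zero {v : V} (h : Δ.dTot B v = 0) :
    v = ∑ i ∈ Δ.S, Δ.J i (Δ.Q i v) + Δ.dTot B (Δ.n' v) := by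
  have h1 : Δ.n v = 0 := by
    have e1 : Δ.n * Δ.n' * Δ.dTot B = Δ.n := by
      have e2 := congrArg (fun x => Δ.n * x) Δ.sum_J_Q
      have e3 : Δ.n * ∑ i ∈ Δ.S, Δ.J i ∘ₗ Δ.Q i = 0 := by
        rw [Finset.mul_sum]
        refine Finset.sum_eq_zero fun i _ => ?_
        change (Δ.n ∘ₗ Δ.J i) ∘ₗ Δ.Q i = 0
        rw [Δ.n_J, LinearMap.zero_comp]
      simp only [mul_add, mul_one, e3, zero_add, ← mul_assoc, Δ.n_n, zero_mul] at e2
      rw [dTot, mul_add, mul_assoc, Δ.n'_mul_asm, mul_zero, zero_add]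
      exact e2
    rw [← e1, Module.End.mul_apply, h, map_zero]
  have h2 := LinearMap.congr_fun Δ.sum_J_Q v
  have h3 : Δ.dTot B (Δ.n' v) = Δ.n (Δ.n' v) := by
    rw [dTot, LinearMap.add_apply, ← Module.End.mul_apply, Δ.asm_mul_n', LinearMap.zero_apply,
      zero_add]
  simp only [LinearMap.add_apply, LinearMap.sum_apply, LinearMap.comp_apply, Module.End.mul_apply,
    h1, map_zero, add_zero, Module.End.one_apply] at h2
  rw [h3, h2]

end Components

section Lengths

variable {R : Type*} [CommRing R] {X : ℤ → Type*} [∀ i, AddCommGroup (X i)]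
    [∀ i, Module R (X i)] {V : Type*} [AddCommGroup V] [Module R V] (Δ : Decomp R X V)
    (B : GradedBockstein R X)

/-- Up to boundaries every cycle is the sum of its homogeneous components, so membership in `kB` and
`iB` can be tested degree by degree. The maps `ι` and `r` stand for the inclusion of and the
projection to one half, so that the even and the odd case are treated together. -/
theorem relLength_eq_sum_of_parity {C : Type*} [AddCommGroup C] [Module R C] (ι : C →ₗ[R] V)
    (r : V →ₗ[R] C) (P : ℤ → Prop) [DecidablePred P]
    (hJ : ∀ i, P i → ∀ x, ι (r (Δ.J i x)) = Δ.J i x) (hQ : ∀ i, ¬ P i → ∀ z, Δ.Q i (ι z) = 0)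
    (iB kB : Submodule R C)
    (hk : ∀ z, z ∈ kB ↔ Δ.dTot B (ι z) = 0 ∧ ∃ w, Δ.βTot B (ι z) = Δ.dTot B w)
    (hi : ∀ z, z ∈ iB ↔ ι z ∈ LinearMap.range (Δ.dTot B) ⊔
      (LinearMap.ker (Δ.dTot B)).map (Δ.βTot B)) :
    relLength iB kB = ∑ i ∈ Δ.S with P i, relLength (B.imB (i - 1) i) (B.kerB i (i + 1)) := by
  refine relLength_eq_sum _ (fun i => Δ.Q i ∘ₗ ι) iB kB (fun i => B.imB (i - 1) i)
    (fun i => B.kerB i (i + 1)) ?_ ?_ ?_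
  · intro z hz i _
    obtain ⟨h1, w, h2⟩ := (hk z).mp hz
    refine ⟨?_, Δ.Q i w, ?_⟩
    · change B.d i (i + 1) (Δ.Q i (ι z)) = 0
      rw [← Δ.Q_dTot B rfl, h1, map_zero]
    · change B.d i (i + 1) (Δ.Q i w) = B.β i (i + 1) (Δ.Q i (ι z))
      rw [← Δ.Q_dTot B rfl, ← Δ.Q_βTot B rfl, h2]
  · intro z hz
    obtain ⟨h1, -⟩ := (hk z).mp hz
    rw [hi]
    constructor
    · intro h i _
      obtain ⟨_, ⟨x, rfl⟩, _, ⟨y, hy, rfl⟩, e⟩ := Submodule.mem_sup.mp h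
      change Δ.Q i (ι z) ∈ _
      rw [← e, map_add, Δ.Q_dTot B (sub_add_cancel i 1), Δ.Q_βTot B (sub_add_cancel i 1)]
      refine Submodule.add_mem_sup ⟨_, rfl⟩ ⟨_, ?_, rfl⟩
      change B.d (i - 1) i (Δ.Q (i - 1) y) = 0
      rw [← Δ.Q_dTot B (sub_add_cancel i 1), LinearMap.mem_ker.mp hy, map_zero]
    · intro h
      rw [Δ.eq_sum_of_dTot_eq_zero B h1]
      refine Submodule.add_mem _ (Submodule.sum_mem _ fun i hi => ?_)
        (Submodule.mem_sup_left ⟨_, rfl⟩)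
      by_cases hP : P i
      · obtain ⟨_, ⟨x, rfl⟩, _, ⟨y, hy, rfl⟩, e⟩ :=
          Submodule.mem_sup.mp (h i (Finset.mem_filter.mpr ⟨hi, hP⟩))
        have e' : Δ.Q i (ι z) = B.d (i - 1) i x + B.β (i - 1) i y := e.symm
        rw [e', map_add, ← Δ.dTot_J B (sub_add_cancel i 1), ← Δ.βTot_J B (sub_add_cancel i 1)]
        refine Submodule.add_mem_sup ⟨_, rfl⟩ ⟨_, ?_, rfl⟩
        change Δ.dTot B (Δ.J (i - 1) y) = 0
        rw [Δ.dTot_J B (sub_add_cancel i 1), LinearMap.mem_ker.mp hy, map_zero]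
      · rw [hQ i hP, map_zero]
        exact Submodule.zero_mem _
  · intro y hy
    have hz : ∀ i ∈ Δ.S.filter P, r (Δ.J i (y i)) ∈ kB := by
      intro i hi
      obtain ⟨h1, w, h2⟩ := hy i hi
      rw [hk, hJ i (Finset.mem_filter.mp hi).2, Δ.dTot_J B rfl, Δ.βTot_J B rfl]
      refine ⟨by rw [LinearMap.mem_ker.mp h1, map_zero], Δ.J i w, ?_⟩
      rw [Δ.dTot_J B rfl, h2]
    refine ⟨_, Submodule.sum_mem _ hz, fun j hj => ?_⟩
    rw [LinearMap.comp_apply, map_sum, map_sum]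
    rw [Finset.sum_eq_single j]
    · rw [hJ j (Finset.mem_filter.mp hj).2, Δ.Q_J_apply]
    · intro i hi hij
      rw [hJ i (Finset.mem_filter.mp hi).2, Δ.Q_J_ne_apply hij]
    · exact fun h => absurd hj h

end Lengths
end Decomp

/-! ### The total complex as a `ℤ/2`-graded complex -/

section TotalPair

variable {R C₀ C₁ : Type*} [CommRing R] [AddCommGroup C₀] [Module R C₀] [AddCommGroup C₁]
  [Module R C₁]

theorem offDiag_mul_offDiag (x₀ y₀ : C₀ →ₗ[R] C₁) (x₁ y₁ : C₁ →ₗ[R] C₀) :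
    offDiag x₀ x₁ * offDiag y₀ y₁ = LinearMap.prodMap (x₁ ∘ₗ y₀) (x₀ ∘ₗ y₁) := by
  ext v <;> simp [offDiag]

theorem prodMap_inj {x₀ y₀ : C₀ →ₗ[R] C₀} {x₁ y₁ : C₁ →ₗ[R] C₁}
    (h : x₀.prodMap x₁ = y₀.prodMap y₁) : x₀ = y₀ ∧ x₁ = y₁ := by
  constructor
  · ext v
    exact congrArg Prod.fst (LinearMap.congr_fun h (v, 0))
  · ext v
    exact congrArg Prod.snd (LinearMap.congr_fun h (0, v))

theorem prodMap_add_prodMap (x₀ y₀ : C₀ →ₗ[R] C₀) (x₁ y₁ : C₁ →ₗ[R] C₁) :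
    x₀.prodMap x₁ + y₀.prodMap y₁ = (x₀ + y₀).prodMap (x₁ + y₁) := by
  ext v <;> simp

/-- The `ℤ/2`-graded complex given by odd endomorphisms. -/
def BocksteinPair.ofEnd (d β h : Module.End R (C₀ × C₁)) (od : IsOddEnd d) (oβ : IsOddEnd β)
    (oh : IsOddEnd h) (hd : d * d = 0) (hβ : d * β + β * d = 0) (hh : β * β = d * h + h * d) :
    BocksteinPair R C₀ C₁ :=
  have key : ∀ {d β h : Module.End R (C₀ × C₁)}, IsOddEnd d → IsOddEnd β → IsOddEnd h →
      d * d = 0 → d * β + β * d = 0 → β * β = d * h + h * d →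
      (block₁₀ d ∘ₗ block₀₁ d = 0 ∧ block₀₁ d ∘ₗ block₁₀ d = 0) ∧
      (block₁₀ d ∘ₗ block₀₁ β + block₁₀ β ∘ₗ block₀₁ d = 0 ∧
        block₀₁ d ∘ₗ block₁₀ β + block₀₁ β ∘ₗ block₁₀ d = 0) ∧
      (block₁₀ β ∘ₗ block₀₁ β = block₁₀ d ∘ₗ block₀₁ h + block₁₀ h ∘ₗ block₀₁ d ∧
        block₀₁ β ∘ₗ block₁₀ β = block₀₁ d ∘ₗ block₁₀ h + block₀₁ h ∘ₗ block₁₀ d) := by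
    intro d β h od oβ oh hd hβ hh
    rw [← od.offDiag_block] at hd
    rw [← od.offDiag_block, ← oβ.offDiag_block] at hβ
    rw [← od.offDiag_block, ← oβ.offDiag_block, ← oh.offDiag_block] at hh
    simp only [offDiag_mul_offDiag, prodMap_add_prodMap] at hd hβ hh
    exact ⟨prodMap_inj (hd.trans LinearMap.prodMap_zero.symm),
      prodMap_inj (hβ.trans LinearMap.prodMap_zero.symm), prodMap_inj hh⟩
  { d₀ := block₀₁ d
    d₁ := block₁₀ d
    β₀ := block₀₁ β
    β₁ := block₁₀ β
    h₀ := block₀₁ h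
    h₁ := block₁₀ h
    d_d₀ := (key od oβ oh hd hβ hh).1.1
    d_d₁ := (key od oβ oh hd hβ hh).1.2
    d_β₀ := (key od oβ oh hd hβ hh).2.1.1
    d_β₁ := (key od oβ oh hd hβ hh).2.1.2
    β_β₀ := (key od oβ oh hd hβ hh).2.2.1
    β_β₁ := (key od oβ oh hd hβ hh).2.2.2 }

variable {X : ℤ → Type*} [∀ i, AddCommGroup (X i)]
    [∀ i, Module R (X i)] (Δ : Decomp R X (C₀ × C₁)) (hε : Δ.ε = evenProj)
    (B : GradedBockstein R X)

theorem Decomp.isOddEnd_asm_up (hε : Δ.ε = evenProj) {f : ∀ i j, X i →ₗ[R] X j}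
    (hf : ∀ i j, i + 1 ≠ j → f i j = 0) :
    IsOddEnd (Δ.asm f) := by
  unfold IsOddEnd
  rw [← hε]
  exact Δ.asm_mul_ε f fun i j h _ => hf i j h

theorem Decomp.isOddEnd_asm_down (hε : Δ.ε = evenProj) {f : ∀ i j, X i →ₗ[R] X j}
    (hf : ∀ i j, j + 1 ≠ i → f i j = 0) :
    IsOddEnd (Δ.asm f) := by
  unfold IsOddEnd
  rw [← hε]
  exact Δ.asm_mul_ε f fun i j _ h => hf i j h

theorem Decomp.isOddEnd_n (hε : Δ.ε = evenProj) : IsOddEnd Δ.n := by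
  unfold IsOddEnd
  rw [← hε]
  exact Δ.n_mul_ε

theorem Decomp.isOddEnd_n' (hε : Δ.ε = evenProj) : IsOddEnd Δ.n' := by
  unfold IsOddEnd
  rw [← hε]
  exact Δ.n'_mul_ε

/-- The total complex of a graded complex with Bockstein operator. -/
def Decomp.pair : BocksteinPair R C₀ C₁ :=
  BocksteinPair.ofEnd (Δ.dTot B) (Δ.βTot B) (Δ.hTot B)
    ((Δ.isOddEnd_asm_up hε B.d_shape).add (Δ.isOddEnd_n hε)) (Δ.isOddEnd_asm_up hε B.β_shape)
    (Δ.isOddEnd_asm_up hε B.h_shape) (Δ.dTot_mul_dTot B) (Δ.dTot_βTot B) (Δ.βTot_mul_βTot B)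

theorem Decomp.pair_d : (Δ.pair hε B).d = Δ.dTot B :=
  ((Δ.isOddEnd_asm_up hε B.d_shape).add (Δ.isOddEnd_n hε)).offDiag_block

theorem Decomp.pair_β : (Δ.pair hε B).β = Δ.βTot B :=
  (Δ.isOddEnd_asm_up hε B.β_shape).offDiag_block

theorem Decomp.dTot_eq (v : C₀ × C₁) :
    Δ.dTot B v = ((Δ.pair hε B).d₁ v.2, (Δ.pair hε B).d₀ v.1) := by
  rw [← Δ.pair_d hε B]
  rfl

theorem Decomp.βTot_eq (v : C₀ × C₁) :
    Δ.βTot B v = ((Δ.pair hε B).β₁ v.2, (Δ.pair hε B).β₀ v.1) := by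
  rw [← Δ.pair_β hε B]
  rfl

theorem Decomp.relLength_even : relLength (Δ.pair hε B).imB (Δ.pair hε B).kerB =
    ∑ i ∈ Δ.S with Even i, relLength (B.imB (i - 1) i) (B.kerB i (i + 1)) := by
  refine Δ.relLength_eq_sum_of_parity B (LinearMap.inl R C₀ C₁) (LinearMap.fst R C₀ C₁)
    Even ?_ ?_ _ _ ?_ ?_
  · intro i hi x
    have h := LinearMap.congr_fun (Δ.ε_J_even i hi) x
    rw [hε] at h
    exact h
  · intro i hi z
    have h := LinearMap.congr_fun (Δ.Q_ε_odd i (Int.not_even_iff_odd.mp hi)) (z, 0)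
    rw [hε] at h
    exact h
  · intro z
    rw [Δ.dTot_eq hε, Δ.βTot_eq hε]
    constructor
    · rintro ⟨h1, w, h2⟩
      refine ⟨Prod.ext (by simp) h1, (w, 0), ?_⟩
      rw [Δ.dTot_eq hε]
      exact Prod.ext (by simp) h2.symm
    · rintro ⟨h1, w, h2⟩
      rw [Δ.dTot_eq hε] at h2
      exact ⟨congrArg Prod.snd h1, w.1, (congrArg Prod.snd h2).symm⟩
  · intro z
    rw [BocksteinPair.imB, Submodule.mem_sup, Submodule.mem_sup]
    constructor
    · rintro ⟨_, ⟨x, rfl⟩, _, ⟨y, hy, rfl⟩, rfl⟩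
      refine ⟨_, ⟨(0, x), rfl⟩, _, ⟨(0, y), ?_, rfl⟩, ?_⟩
      · change Δ.dTot B (0, y) = 0
        rw [Δ.dTot_eq hε]
        exact Prod.ext hy (by simp)
      · rw [Δ.dTot_eq hε, Δ.βTot_eq hε]
        simp
    · rintro ⟨_, ⟨x, rfl⟩, _, ⟨y, hy, rfl⟩, e⟩
      rw [Δ.dTot_eq hε, Δ.βTot_eq hε] at e
      have hy' : Δ.dTot B y = 0 := hy
      rw [Δ.dTot_eq hε] at hy'
      exact ⟨_, ⟨x.2, rfl⟩, _, ⟨y.2, congrArg Prod.fst hy', rfl⟩, congrArg Prod.fst e⟩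

theorem Decomp.relLength_odd : relLength (Δ.pair hε B).swap.imB (Δ.pair hε B).swap.kerB =
    ∑ i ∈ Δ.S with ¬ Even i, relLength (B.imB (i - 1) i) (B.kerB i (i + 1)) := by
  refine Δ.relLength_eq_sum_of_parity B (LinearMap.inr R C₀ C₁) (LinearMap.snd R C₀ C₁)
    (fun i => ¬ Even i) ?_ ?_ _ _ ?_ ?_
  · intro i hi x
    have h := LinearMap.congr_fun (Δ.ε_J_odd i (Int.not_even_iff_odd.mp hi)) x
    rw [hε] at h
    exact Prod.ext (congrArg Prod.fst h).symm rfl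
  · intro i hi z
    have h := LinearMap.congr_fun (Δ.Q_ε_even i (not_not.mp hi)) (0, z)
    rw [hε] at h
    refine h.symm.trans ?_
    simp [evenProj, ← Prod.zero_eq_mk]
  · intro z
    rw [Δ.dTot_eq hε, Δ.βTot_eq hε]
    constructor
    · rintro ⟨h1, w, h2⟩
      refine ⟨Prod.ext h1 (by simp), (0, w), ?_⟩
      rw [Δ.dTot_eq hε]
      exact Prod.ext h2.symm (by simp)
    · rintro ⟨h1, w, h2⟩
      rw [Δ.dTot_eq hε] at h2
      exact ⟨congrArg Prod.fst h1, w.2, (congrArg Prod.fst h2).symm⟩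
  · intro z
    rw [BocksteinPair.imB, Submodule.mem_sup, Submodule.mem_sup]
    constructor
    · rintro ⟨_, ⟨x, rfl⟩, _, ⟨y, hy, rfl⟩, rfl⟩
      refine ⟨_, ⟨(x, 0), rfl⟩, _, ⟨(y, 0), ?_, rfl⟩, ?_⟩
      · change Δ.dTot B (y, 0) = 0
        rw [Δ.dTot_eq hε]
        exact Prod.ext (by simp) hy
      · rw [Δ.dTot_eq hε, Δ.βTot_eq hε]
        simp [BocksteinPair.swap]
    · rintro ⟨_, ⟨x, rfl⟩, _, ⟨y, hy, rfl⟩, e⟩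
      rw [Δ.dTot_eq hε, Δ.βTot_eq hε] at e
      have hy' : Δ.dTot B y = 0 := hy
      rw [Δ.dTot_eq hε] at hy'
      exact ⟨_, ⟨x.1, rfl⟩, _, ⟨y.1, congrArg Prod.snd hy', rfl⟩, congrArg Prod.snd e⟩

end TotalPair

/-! ### Tensor products of decompositions -/

section TensProduct

variable {Λ : Type*} [Ring Λ] {S : Type*} [Ring S] {n : ℕ}
  (Φ : Λ →+* Matrix (Fin n) (Fin n) S)

theorem Tens.map_map {M N Q : Type*} [AddCommGroup M] [Module Λ M] [AddCommGroup N] [Module Λ N]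
    [AddCommGroup Q] [Module Λ Q] (g : N →ₗ[Λ] Q) (f : M →ₗ[Λ] N) (x : Tens Φ M) :
    Tens.map Φ g (Tens.map Φ f x) = Tens.map Φ (g ∘ₗ f) x := by rw [Tens.map_comp]; rfl

variable (M N : Type*) [AddCommGroup M] [Module Λ M] [AddCommGroup N] [Module Λ N]

/-- The functor `S^n ⊗_Λ -` commutes with finite products. -/
def tensProd : Tens Φ (M × N) ≃ₗ[S] Tens Φ M × Tens Φ N :=
  LinearEquiv.ofLinearMap
    ((Tens.map Φ (LinearMap.fst Λ M N)).prod (Tens.map Φ (LinearMap.snd Λ M N)))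
    ((Tens.map Φ (LinearMap.inl Λ M N)).coprod (Tens.map Φ (LinearMap.inr Λ M N)))
    (by
      refine LinearMap.prod_ext ?_ ?_
      · refine LinearMap.ext fun x => Prod.ext ?_ ?_
        · simp [Tens.map_map, LinearMap.fst_comp_inl, Tens.map_id]
        · simp [Tens.map_map, LinearMap.snd_comp_inl, Tens.map_zero]
      · refine LinearMap.ext fun x => Prod.ext ?_ ?_
        · simp [Tens.map_map, LinearMap.fst_comp_inr, Tens.map_zero]
        · simp [Tens.map_map, LinearMap.snd_comp_inr, Tens.map_id])
    (by
      rw [LinearMap.coprod_comp_prod, ← Tens.map_comp, ← Tens.map_comp, ← Tens.map_add,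
        ← LinearMap.coprod_comp_prod, LinearMap.coprod_inl_inr, LinearMap.pair_fst_snd,
        LinearMap.id_comp, Tens.map_id])

theorem tensProd_apply (x : Tens Φ (M × N)) : tensProd Φ M N x =
    (Tens.map Φ (LinearMap.fst Λ M N) x, Tens.map Φ (LinearMap.snd Λ M N) x) := rfl

theorem tensProd_symm_apply (x : Tens Φ M × Tens Φ N) : (tensProd Φ M N).symm x =
    Tens.map Φ (LinearMap.inl Λ M N) x.1 + Tens.map Φ (LinearMap.inr Λ M N) x.2 := rfl

variable {M N}

/-- The functor `S^n ⊗_Λ -` on endomorphisms of `M × N`. -/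
def tensEnd (x : Module.End Λ (M × N)) : Module.End S (Tens Φ M × Tens Φ N) :=
  (tensProd Φ M N).toLinearMap ∘ₗ Tens.map Φ x ∘ₗ (tensProd Φ M N).symm.toLinearMap

theorem tensEnd_apply (x : Module.End Λ (M × N)) (v) :
    tensEnd Φ x v = tensProd Φ M N (Tens.map Φ x ((tensProd Φ M N).symm v)) := rfl

theorem tensEnd_mul (x y : Module.End Λ (M × N)) :
    tensEnd Φ (x * y) = tensEnd Φ x * tensEnd Φ y := by
  refine LinearMap.ext fun v => ?_
  rw [Module.End.mul_apply, tensEnd_apply, tensEnd_apply, tensEnd_apply,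
    LinearEquiv.symm_apply_apply, Tens.map_map]
  rfl

theorem tensEnd_add (x y : Module.End Λ (M × N)) :
    tensEnd Φ (x + y) = tensEnd Φ x + tensEnd Φ y := by
  rw [tensEnd, Tens.map_add, LinearMap.add_comp, LinearMap.comp_add]
  rfl

theorem tensEnd_zero : tensEnd Φ (0 : Module.End Λ (M × N)) = 0 := by
  rw [tensEnd, Tens.map_zero, LinearMap.zero_comp, LinearMap.comp_zero]

theorem tensEnd_one : tensEnd Φ (1 : Module.End Λ (M × N)) = 1 := by
  refine LinearMap.ext fun v => ?_
  rw [tensEnd_apply]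
  change tensProd Φ M N (Tens.map Φ LinearMap.id _) = v
  rw [Tens.map_id, LinearMap.id_apply, LinearEquiv.apply_symm_apply]

/-- `tensEnd` as an additive map. -/
def tensEndAddHom : Module.End Λ (M × N) →+ Module.End S (Tens Φ M × Tens Φ N) where
  toFun := tensEnd Φ
  map_zero' := tensEnd_zero Φ
  map_add' := tensEnd_add Φ

theorem tensEnd_sum {ι : Type*} (s : Finset ι) (x : ι → Module.End Λ (M × N)) :
    tensEnd Φ (∑ i ∈ s, x i) = ∑ i ∈ s, tensEnd Φ (x i) := map_sum (tensEndAddHom Φ) x s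

theorem tensEnd_comp {X Y : Type*} [AddCommGroup X] [Module Λ X] [AddCommGroup Y] [Module Λ Y]
    (J : Y →ₗ[Λ] M × N) (f : X →ₗ[Λ] Y) (Q : M × N →ₗ[Λ] X) :
    tensEnd Φ (J ∘ₗ f ∘ₗ Q) = ((tensProd Φ M N).toLinearMap ∘ₗ Tens.map Φ J) ∘ₗ Tens.map Φ f ∘ₗ
      (Tens.map Φ Q ∘ₗ (tensProd Φ M N).symm.toLinearMap) := by
  rw [tensEnd, Tens.map_comp, Tens.map_comp]
  rfl

/-- The functor `S^n ⊗_Λ -` applied to a decomposition. -/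
def Decomp.tens {X : ℤ → Type*} [∀ i, AddCommGroup (X i)] [∀ i, Module Λ (X i)]
    (Δ : Decomp Λ X (M × N)) : Decomp S (fun i => Tens Φ (X i)) (Tens Φ M × Tens Φ N) where
  S := Δ.S
  J i := (tensProd Φ M N).toLinearMap ∘ₗ Tens.map Φ (Δ.J i)
  Q i := Tens.map Φ (Δ.Q i) ∘ₗ (tensProd Φ M N).symm.toLinearMap
  n := tensEnd Φ Δ.n
  n' := tensEnd Φ Δ.n'
  ε := tensEnd Φ Δ.ε
  Q_J i := LinearMap.ext fun x => by simp [Tens.map_map, Δ.Q_J, Tens.map_id]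
  Q_J_ne i j h := LinearMap.ext fun x => by simp [Tens.map_map, Δ.Q_J_ne i j h, Tens.map_zero]
  n_J i := LinearMap.ext fun x => by simp [tensEnd_apply, Tens.map_map, Δ.n_J, Tens.map_zero]
  n'_J i := LinearMap.ext fun x => by simp [tensEnd_apply, Tens.map_map, Δ.n'_J, Tens.map_zero]
  Q_n i := LinearMap.ext fun x => by simp [tensEnd_apply, Tens.map_map, Δ.Q_n, Tens.map_zero]
  Q_n' i := LinearMap.ext fun x => by simp [tensEnd_apply, Tens.map_map, Δ.Q_n', Tens.map_zero]
  n_n := by rw [← tensEnd_mul, Δ.n_n, tensEnd_zero]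
  n'_n' := by rw [← tensEnd_mul, Δ.n'_n', tensEnd_zero]
  sum_J_Q := by
    rw [← tensEnd_mul, ← tensEnd_mul, ← tensEnd_add, ← tensEnd_one, ← Δ.sum_J_Q,
      tensEnd_add _ (∑ i ∈ Δ.S, _), tensEnd_sum]
    congr 1
    refine Finset.sum_congr rfl fun i _ => ?_
    rw [tensEnd, Tens.map_comp]
    rfl
  subsingleton i h := by
    have := Δ.subsingleton i h
    infer_instance
  ε_J_even i h := LinearMap.ext fun x => by simp [tensEnd_apply, Tens.map_map, Δ.ε_J_even i h]
  ε_J_odd i h := LinearMap.ext fun x => by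
    simp [tensEnd_apply, Tens.map_map, Δ.ε_J_odd i h, Tens.map_zero]
  Q_ε_even i h := LinearMap.ext fun x => by simp [tensEnd_apply, Tens.map_map, Δ.Q_ε_even i h]
  Q_ε_odd i h := LinearMap.ext fun x => by
    simp [tensEnd_apply, Tens.map_map, Δ.Q_ε_odd i h, Tens.map_zero]
  n_ε := by rw [← tensEnd_mul, Δ.n_ε]
  ε_n := by rw [← tensEnd_mul, Δ.ε_n, tensEnd_zero]
  n'_ε := by rw [← tensEnd_mul, Δ.n'_ε, tensEnd_zero]
  ε_n' := by rw [← tensEnd_mul, Δ.ε_n']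

variable {X : ℤ → Type*} [∀ i, AddCommGroup (X i)] [∀ i, Module Λ (X i)]
    (Δ : Decomp Λ X (M × N)) (B : GradedBockstein Λ X)

theorem Decomp.tens_asm (f : ∀ i j, X i →ₗ[Λ] X j) :
    (Δ.tens Φ).asm (fun i j => Tens.map Φ (f i j)) = tensEnd Φ (Δ.asm f) := by
  rw [asm, asm, tensEnd_sum]
  refine Finset.sum_congr rfl fun i _ => ?_
  rw [tensEnd_sum]
  exact Finset.sum_congr rfl fun j _ => (tensEnd_comp Φ _ _ _).symm

theorem Decomp.tens_dTot : (Δ.tens Φ).dTot (B.tens Φ) = tensEnd Φ (Δ.dTot B) := by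
  rw [dTot, dTot, tensEnd_add, ← Δ.tens_asm]
  rfl

theorem Decomp.tens_βTot : (Δ.tens Φ).βTot (B.tens Φ) = tensEnd Φ (Δ.βTot B) :=
  Δ.tens_asm Φ B.β

end TensProduct

/-! ### Finiteness and projectivity of `S^n ⊗_Λ M` -/

section TensProjective

variable {Λ : Type*} [Ring Λ] {S : Type*} [Ring S] {n : ℕ}
  (Φ : Λ →+* Matrix (Fin n) (Fin n) S)

theorem Tens.mk_vecMul {M : Type*} [AddCommGroup M] [Module Λ M] (v : Fin n → S) (l : Λ) (m : M) :
    (Submodule.Quotient.mk (Matrix.vecMul v (Φ l) ⊗ₜ m) : Tens Φ M) =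
      Submodule.Quotient.mk (v ⊗ₜ (l • m)) :=
  (Submodule.Quotient.eq _).mpr (Submodule.subset_span ⟨v, l, m, rfl⟩)

/-- The map `S^n ⊗_Λ Λ^k → (S^n)^k`, `v ⊗ x ↦ (v x_j)_j`. -/
def tensFree (k : ℕ) : Tens Φ (Fin k → Λ) →ₗ[S] (Fin k → Fin n → S) :=
  Submodule.liftQ _
    (TensorProduct.AlgebraTensorModule.lift
      { toFun := fun v =>
          { toFun := fun x j => Matrix.vecMul v (Φ (x j))
            map_add' := fun x y => by
              funext j
              rw [Pi.add_apply, map_add, Matrix.vecMul_add]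
              rfl
            map_smul' := fun c x => by
              funext j
              rw [Pi.smul_apply, map_zsmul, Matrix.vecMul_smul]
              rfl }
        map_add' := fun v w => by
          ext x j
          simp [Matrix.add_vecMul]
        map_smul' := fun c v => by
          ext x j
          simp [Matrix.smul_vecMul] })
    (by
      refine Submodule.span_le.mpr ?_
      rintro _ ⟨v, l, m, rfl⟩
      refine (map_sub _ _ _).trans (sub_eq_zero.mpr ?_)
      funext j
      change Matrix.vecMul (Matrix.vecMul v (Φ l)) (Φ (m j)) = Matrix.vecMul v (Φ (l * m j))
      rw [map_mul, Matrix.vecMul_vecMul])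

theorem tensFree_mk (k : ℕ) (v : Fin n → S) (x : Fin k → Λ) (j : Fin k) :
    tensFree Φ k (Submodule.Quotient.mk (v ⊗ₜ x)) j = Matrix.vecMul v (Φ (x j)) := rfl

/-- The map `(S^n)^k → S^n ⊗_Λ Λ^k`, `(v_j)_j ↦ ∑ v_j ⊗ e_j`. -/
def freeTens (k : ℕ) : (Fin k → Fin n → S) →ₗ[S] Tens Φ (Fin k → Λ) :=
  ∑ j, (balanced Φ (Fin k → Λ)).mkQ ∘ₗ
    ((TensorProduct.AlgebraTensorModule.mk ℤ S (Fin n → S) (Fin k → Λ)).flip (Pi.single j 1)) ∘ₗ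
      LinearMap.proj j

/-- This one composite suffices: a retract of `(S^n)^k` is already finitely generated and
projective. -/
theorem freeTens_comp_tensFree (k : ℕ) : freeTens Φ k ∘ₗ tensFree Φ k = LinearMap.id := by
  classical
  refine Tens.hom_ext Φ fun v x => ?_
  rw [LinearMap.comp_apply, freeTens, LinearMap.sum_apply, LinearMap.id_apply]
  have : ∀ j : Fin k, (Submodule.Quotient.mk (tensFree Φ k (Submodule.Quotient.mk (v ⊗ₜ x)) j ⊗ₜ
      Pi.single j 1) : Tens Φ (Fin k → Λ)) = (balanced Φ (Fin k → Λ)).mkQ (v ⊗ₜ Pi.single j (x j)) := by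
    intro j
    rw [tensFree_mk, Tens.mk_vecMul, ← Pi.single_smul', smul_eq_mul, mul_one]
    rfl
  refine (Finset.sum_congr rfl fun j _ => this j).trans ?_
  rw [← map_sum, ← TensorProduct.tmul_sum, Finset.univ_sum_single]
  rfl

variable (M : Type*) [AddCommGroup M] [Module Λ M]

theorem exists_tens_retract [Module.Finite Λ M] [Module.Projective Λ M] :
    ∃ (k : ℕ) (i : Tens Φ M →ₗ[S] (Fin k → Fin n → S)) (r : (Fin k → Fin n → S) →ₗ[S] Tens Φ M),
      r ∘ₗ i = LinearMap.id := by
  obtain ⟨k, f, g, -, -, h⟩ := Module.Finite.exists_comp_eq_id_of_projective Λ M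
  refine ⟨k, tensFree Φ k ∘ₗ Tens.map Φ g, Tens.map Φ f ∘ₗ freeTens Φ k, ?_⟩
  rw [LinearMap.comp_assoc, ← LinearMap.comp_assoc (Tens.map Φ g), freeTens_comp_tensFree,
    LinearMap.id_comp, ← Tens.map_comp, h, Tens.map_id]

theorem finite_tens [Module.Finite Λ M] [Module.Projective Λ M] : Module.Finite S (Tens Φ M) := by
  obtain ⟨k, i, r, h⟩ := exists_tens_retract Φ M
  exact Module.Finite.of_surjective r fun x => ⟨i x, LinearMap.congr_fun h x⟩

theorem projective_tens [Module.Finite Λ M] [Module.Projective Λ M] :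
    Module.Projective S (Tens Φ M) := by
  obtain ⟨k, i, r, h⟩ := exists_tens_retract Φ M
  exact Module.Projective.of_split i r h

end TensProjective

/-! ### Compatibility of `R^n ⊗_Λ M` with extension of scalars to `K` -/

section TensBaseChange

variable {Λ : Type*} [Ring Λ] {R : Type*} [CommRing R] (K : Type*) [Field K] [Algebra R K] {n : ℕ}
  (Φ : Λ →+* Matrix (Fin n) (Fin n) R)

/-- The ring homomorphism `Λ → M_n(R) → M_n(K)`. -/
abbrev baseHom : Λ →+* Matrix (Fin n) (Fin n) K := (algebraMap R K).mapMatrix.comp Φ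

variable (M : Type*) [AddCommGroup M] [Module Λ M]

/-- The map `R^n ⊗_Λ M → K^n ⊗_Λ M`. -/
def tensIncl : Tens Φ M →ₗ[R] Tens (baseHom K Φ) M :=
  Submodule.liftQ _
    (((balanced (baseHom K Φ) M).mkQ.restrictScalars R) ∘ₗ
      TensorProduct.AlgebraTensorModule.map ((Algebra.linearMap R K).compLeft (Fin n))
        (LinearMap.id : M →ₗ[ℤ] M))
    (by
      refine Submodule.span_le.mpr ?_
      rintro _ ⟨v, l, m, rfl⟩
      refine (map_sub _ _ _).trans (sub_eq_zero.mpr ?_)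
      have h := Tens.mk_vecMul (baseHom K Φ) (algebraMap R K ∘ v) l m
      refine Eq.trans ?_ h
      change (Submodule.Quotient.mk ((algebraMap R K ∘ (Matrix.vecMul v (Φ l))) ⊗ₜ m) :
        Tens (baseHom K Φ) M) = _
      congr 2
      funext j
      exact RingHom.map_vecMul (algebraMap R K) (Φ l) v j)

theorem tensIncl_mk (v : Fin n → R) (m : M) :
    tensIncl K Φ M (Submodule.Quotient.mk (v ⊗ₜ m)) =
      Submodule.Quotient.mk ((algebraMap R K ∘ v) ⊗ₜ m) := rfl

/-- The map `R^n ⊗_Λ M → K^n ⊗_Λ M`, extended to `K ⊗_R (R^n ⊗_Λ M)`. -/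
def tensBase : K ⊗[R] Tens Φ M →ₗ[K] Tens (baseHom K Φ) M :=
  TensorProduct.AlgebraTensorModule.lift
    ((LinearMap.toSpanSingleton K (Tens Φ M →ₗ[R] Tens (baseHom K Φ) M) (tensIncl K Φ M)))

theorem tensBase_tmul (c : K) (x : Tens Φ M) :
    tensBase K Φ M (c ⊗ₜ x) = c • tensIncl K Φ M x := rfl

/-- The map `K^n ⊗_Λ M → K ⊗_R (R^n ⊗_Λ M)`. -/
def tensBaseInv : Tens (baseHom K Φ) M →ₗ[K] K ⊗[R] Tens Φ M :=
  Submodule.liftQ _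
    (TensorProduct.AlgebraTensorModule.lift
      { toFun := fun w =>
          { toFun := fun m => ∑ i, w i ⊗ₜ (Submodule.Quotient.mk (Pi.single i 1 ⊗ₜ m) : Tens Φ M)
            map_add' := fun x y => by
              rw [← Finset.sum_add_distrib]
              refine Finset.sum_congr rfl fun i _ => ?_
              rw [TensorProduct.tmul_add, Submodule.Quotient.mk_add, TensorProduct.tmul_add]
            map_smul' := fun c x => by
              rw [Finset.smul_sum]
              refine Finset.sum_congr rfl fun i _ => ?_
              rw [TensorProduct.tmul_smul, RingHom.id_apply,
                ← TensorProduct.tmul_smul c (w i)]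
              rfl }
        map_add' := fun v w => by
          ext x
          simp [TensorProduct.add_tmul, Finset.sum_add_distrib]
        map_smul' := fun c v => by
          ext x
          simp [TensorProduct.smul_tmul', Finset.smul_sum] })
    (by
      refine Submodule.span_le.mpr ?_
      rintro _ ⟨v, l, m, rfl⟩
      refine (map_sub _ _ _).trans (sub_eq_zero.mpr ?_)
      change ∑ j, (Matrix.vecMul v (baseHom K Φ l)) j ⊗ₜ
          (Submodule.Quotient.mk (Pi.single j 1 ⊗ₜ m) : Tens Φ M) =
        ∑ i, v i ⊗ₜ (Submodule.Quotient.mk (Pi.single i 1 ⊗ₜ (l • m)) : Tens Φ M)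
      have h1 : ∀ i, (Submodule.Quotient.mk (Pi.single i 1 ⊗ₜ (l • m)) : Tens Φ M) =
          ∑ j, Φ l i j • (Submodule.Quotient.mk (Pi.single j 1 ⊗ₜ m) : Tens Φ M) := by
        intro i
        rw [← Tens.mk_vecMul, Matrix.single_one_vecMul]
        have : (Φ l).row i = ∑ j, Φ l i j • (Pi.single j 1 : Fin n → R) := by
          funext k
          simp [Finset.sum_apply, Pi.single_apply]
        rw [this, TensorProduct.sum_tmul]
        refine (map_sum (balanced Φ M).mkQ _ _).trans ?_
        rfl
      simp_rw [h1, TensorProduct.tmul_sum, TensorProduct.tmul_smul]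
      rw [Finset.sum_comm]
      refine Finset.sum_congr rfl fun j _ => ?_
      simp only [Matrix.vecMul, dotProduct, TensorProduct.sum_tmul]
      refine Finset.sum_congr rfl fun i _ => ?_
      refine Eq.trans ?_ (TensorProduct.smul_tmul' _ _ _).symm
      congr 1
      rw [Algebra.smul_def]
      exact mul_comm _ _)

theorem tensBaseInv_mk (w : Fin n → K) (m : M) :
    tensBaseInv K Φ M (Submodule.Quotient.mk (w ⊗ₜ m)) =
      ∑ i, w i ⊗ₜ (Submodule.Quotient.mk (Pi.single i 1 ⊗ₜ m) : Tens Φ M) := rfl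

/-- The isomorphism `K ⊗_R (R^n ⊗_Λ M) ≃ K^n ⊗_Λ M`. -/
def tensBaseEquiv : K ⊗[R] Tens Φ M ≃ₗ[K] Tens (baseHom K Φ) M :=
  LinearEquiv.ofLinearMap (tensBase K Φ M) (tensBaseInv K Φ M)
    (by
      refine Tens.hom_ext _ fun w m => ?_
      rw [LinearMap.comp_apply, tensBaseInv_mk, map_sum]
      simp_rw [tensBase_tmul, tensIncl_mk]
      simp_rw [← Submodule.Quotient.mk_smul]
      refine (map_sum (balanced (baseHom K Φ) M).mkQ _ _).symm.trans ?_
      simp_rw [TensorProduct.smul_tmul', ← TensorProduct.sum_tmul]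
      change (Submodule.Quotient.mk _ : Tens (baseHom K Φ) M) = Submodule.Quotient.mk _
      congr 2
      funext k
      simp [Finset.sum_apply, Pi.single_apply, apply_ite (algebraMap R K)])
    (by
      refine TensorProduct.AlgebraTensorModule.curry_injective (LinearMap.ext_ring ?_)
      refine Tens.hom_ext _ fun v m => ?_
      change tensBaseInv K Φ M (tensBase K Φ M
        ((1 : K) ⊗ₜ[R] (Submodule.Quotient.mk (v ⊗ₜ m) : Tens Φ M))) =
          (1 : K) ⊗ₜ[R] (Submodule.Quotient.mk (v ⊗ₜ m) : Tens Φ M)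
      rw [tensBase_tmul, one_smul, tensIncl_mk, tensBaseInv_mk]
      have : ∀ i, (algebraMap R K ∘ v) i ⊗ₜ[R] (Submodule.Quotient.mk (Pi.single i 1 ⊗ₜ m) : Tens Φ M) =
          1 ⊗ₜ[R] (balanced Φ M).mkQ (Pi.single i (v i) ⊗ₜ m) := by
        intro i
        rw [Function.comp_apply, Algebra.algebraMap_eq_smul_one, TensorProduct.smul_tmul]
        congr 1
        rw [← Submodule.Quotient.mk_smul, TensorProduct.smul_tmul', ← Pi.single_smul, smul_eq_mul,
          mul_one]
        rfl
      rw [Finset.sum_congr rfl fun i _ => this i, ← TensorProduct.tmul_sum, ← map_sum,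
        ← TensorProduct.sum_tmul, Finset.univ_sum_single]
      rfl)

variable {M} {N : Type*} [AddCommGroup N] [Module Λ N]

theorem tensBaseEquiv_naturality (f : M →ₗ[Λ] N) (x : K ⊗[R] Tens Φ M) :
    tensBaseEquiv K Φ N ((Tens.map Φ f).baseChange K x) =
      Tens.map (baseHom K Φ) f (tensBaseEquiv K Φ M x) := by
  have : (tensBaseEquiv K Φ N).toLinearMap ∘ₗ (Tens.map Φ f).baseChange K =
      Tens.map (baseHom K Φ) f ∘ₗ (tensBaseEquiv K Φ M).toLinearMap := by
    refine TensorProduct.AlgebraTensorModule.curry_injective (LinearMap.ext_ring ?_)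
    refine Tens.hom_ext _ fun v m => ?_
    change tensBase K Φ N ((1 : K) ⊗ₜ[R] (Submodule.Quotient.mk (v ⊗ₜ f m) : Tens Φ N)) =
      Tens.map (baseHom K Φ) f (tensBase K Φ M
        ((1 : K) ⊗ₜ[R] (Submodule.Quotient.mk (v ⊗ₜ m) : Tens Φ M)))
    rw [tensBase_tmul, tensBase_tmul, one_smul, one_smul]
    rfl
  exact LinearMap.congr_fun this x

variable (M N) in
/-- The isomorphism `(K ⊗_R (R^n ⊗_Λ M)) × (K ⊗_R (R^n ⊗_Λ N)) ≃ (K^n ⊗_Λ M) × (K^n ⊗_Λ N)`. -/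
def tensBaseProd : ((K ⊗[R] Tens Φ M) × (K ⊗[R] Tens Φ N)) ≃ₗ[K]
    (Tens (baseHom K Φ) M × Tens (baseHom K Φ) N) :=
  (tensBaseEquiv K Φ M).prodCongr (tensBaseEquiv K Φ N)

/-- Naturality for the two projections shows that the identifications through `Tens Φ (M × N)` agree
(`key`). The claim is then naturality for `x` itself. -/
theorem tensBaseProd_bcHom (x : Module.End Λ (M × N)) (v) :
    tensBaseProd K Φ M N (bcHom K (tensEnd Φ x) v) =
      tensEnd (baseHom K Φ) x (tensBaseProd K Φ M N v) := by
  have key : ∀ t : K ⊗[R] Tens Φ (M × N), tensBaseProd K Φ M N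
      (TensorProduct.prodRight R K K (Tens Φ M) (Tens Φ N)
        ((tensProd Φ M N).toLinearMap.baseChange K t)) =
      tensProd (baseHom K Φ) M N (tensBaseEquiv K Φ (M × N) t) := by
    intro t
    rw [tensProd_apply, ← tensBaseEquiv_naturality, ← tensBaseEquiv_naturality]
    have h1 : (LinearMap.fst K _ _ ∘ₗ
        (TensorProduct.prodRight R K K (Tens Φ M) (Tens Φ N)).toLinearMap) ∘ₗ
        (tensProd Φ M N).toLinearMap.baseChange K =
        (Tens.map Φ (LinearMap.fst Λ M N)).baseChange K := by
      refine TensorProduct.AlgebraTensorModule.curry_injective (LinearMap.ext_ring ?_)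
      rfl
    have h2 : (LinearMap.snd K _ _ ∘ₗ
        (TensorProduct.prodRight R K K (Tens Φ M) (Tens Φ N)).toLinearMap) ∘ₗ
        (tensProd Φ M N).toLinearMap.baseChange K =
        (Tens.map Φ (LinearMap.snd Λ M N)).baseChange K := by
      refine TensorProduct.AlgebraTensorModule.curry_injective (LinearMap.ext_ring ?_)
      rfl
    rw [← h1, ← h2]
    rfl
  obtain ⟨u, rfl⟩ := (TensorProduct.prodRight R K K (Tens Φ M) (Tens Φ N)).surjective v
  obtain ⟨t, rfl⟩ : ∃ t, (tensProd Φ M N).toLinearMap.baseChange K t = u := by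
    refine ⟨(tensProd Φ M N).symm.toLinearMap.baseChange K u, ?_⟩
    rw [← LinearMap.comp_apply, ← LinearMap.baseChange_comp, LinearEquiv.comp_symm,
      LinearMap.baseChange_id, LinearMap.id_apply]
  rw [key, bcHom_apply, LinearEquiv.symm_apply_apply, tensEnd_apply, LinearEquiv.symm_apply_apply,
    ← tensBaseEquiv_naturality, ← key]
  congr 2
  rw [← LinearMap.comp_apply, ← LinearMap.comp_apply, ← LinearMap.baseChange_comp,
    ← LinearMap.baseChange_comp]
  congr 2
  refine LinearMap.ext fun y => ?_
  simp [tensEnd_apply]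

end TensBaseChange

/-! ### Even and odd integers -/

section Parity

/-- The integers as the disjoint union of the even and the odd integers. -/
def parityEquiv : ℤ ⊕ ℤ ≃ ℤ :=
  Equiv.ofBijective (Sum.elim (fun k => 2 * k) fun k => 2 * k + 1) (by
    constructor
    · rintro (a | a) (b | b) h <;> simp only [Sum.elim_inl, Sum.elim_inr] at h
      · exact congrArg Sum.inl (by omega)
      · omega
      · omega
      · exact congrArg Sum.inr (by omega)
    · intro i
      obtain ⟨k, h | h⟩ := Int.even_or_odd' i
      · exact ⟨Sum.inl k, h.symm⟩
      · exact ⟨Sum.inr k, h.symm⟩)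

/-- A family over the integers from its even and odd members. -/
def parityRec {P : ℤ → Type*} (f : ∀ k, P (2 * k)) (g : ∀ k, P (2 * k + 1)) : ∀ i, P i :=
  parityEquiv.piCongrLeft P fun a => match a with
    | Sum.inl k => f k
    | Sum.inr k => g k

theorem parityRec_even {P : ℤ → Type*} (f : ∀ k, P (2 * k)) (g : ∀ k, P (2 * k + 1)) (k : ℤ) :
    parityRec f g (2 * k) = f k :=
  parityEquiv.piCongrLeft_apply_apply P _ (Sum.inl k)

theorem parityRec_odd {P : ℤ → Type*} (f : ∀ k, P (2 * k)) (g : ∀ k, P (2 * k + 1)) (k : ℤ) :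
    parityRec f g (2 * k + 1) = g k :=
  parityEquiv.piCongrLeft_apply_apply P _ (Sum.inr k)

/-- The integers `2 k` and `2 k + 1` with `k` in a given finite set. -/
def paritySet (S : Finset ℤ) : Finset ℤ := (S.disjSum S).map parityEquiv.toEmbedding

theorem sum_paritySet {M : Type*} [AddCommMonoid M] (S : Finset ℤ) (f : ℤ → M) :
    ∑ i ∈ paritySet S, f i = ∑ k ∈ S, f (2 * k) + ∑ k ∈ S, f (2 * k + 1) := by
  rw [paritySet, Finset.sum_map, Finset.sum_disjSum]
  rfl

theorem even_mem_paritySet {S : Finset ℤ} {k : ℤ} : 2 * k ∈ paritySet S ↔ k ∈ S := by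
  have h : parityEquiv.toEmbedding (Sum.inl k) = 2 * k := rfl
  rw [paritySet, ← h, Finset.mem_map', Finset.inl_mem_disjSum]

theorem odd_mem_paritySet {S : Finset ℤ} {k : ℤ} : 2 * k + 1 ∈ paritySet S ↔ k ∈ S := by
  have h : parityEquiv.toEmbedding (Sum.inr k) = 2 * k + 1 := rfl
  rw [paritySet, ← h, Finset.mem_map', Finset.inr_mem_disjSum]

end Parity

/-! ### The even and odd parts of a bounded complex with a free summand added -/

section ParityDecomp

variable {Λ : Type*} [Ring Λ] (X : ℤ → Type*) [∀ i, AddCommGroup (X i)] [∀ i, Module Λ (X i)]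
  (F : Type*) [AddCommGroup F] [Module Λ F]

theorem sum_lof_component {Y : ℤ → Type*} [∀ i, AddCommGroup (Y i)] [∀ i, Module Λ (Y i)]
    (S : Finset ℤ) (hS : ∀ k, k ∉ S → Subsingleton (Y k)) (x : DirectSum ℤ Y) :
    ∑ k ∈ S, DirectSum.lof Λ ℤ Y k (DirectSum.component Λ ℤ Y k x) = x := by
  refine DirectSum.ext_component Λ fun j => ?_
  by_cases hj : j ∈ S
  · rw [map_sum, Finset.sum_eq_single j, DirectSum.component.lof_self]
    · intro k _ hk
      rw [DirectSum.component.of, dif_neg hk]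
    · exact fun h => absurd hj h
  · have := hS j hj
    exact Subsingleton.elim _ _

variable (S : Finset ℤ) (hS : ∀ k, k ∉ S → Subsingleton (X (2 * k)) ∧ Subsingleton (X (2 * k + 1)))

/-- The inclusion of a summand. -/
def parityJ : ∀ i, X i →ₗ[Λ] ((DirectSum ℤ fun k => X (2 * k)) × F) ×
    ((DirectSum ℤ fun k => X (2 * k + 1)) × F) :=
  parityRec
    (fun k => LinearMap.inl Λ _ _ ∘ₗ LinearMap.inl Λ _ _ ∘ₗ
      DirectSum.lof Λ ℤ (fun k => X (2 * k)) k)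
    (fun k => LinearMap.inr Λ _ _ ∘ₗ LinearMap.inl Λ _ _ ∘ₗ
      DirectSum.lof Λ ℤ (fun k => X (2 * k + 1)) k)

/-- The projection to a summand. -/
def parityQ : ∀ i, ((DirectSum ℤ fun k => X (2 * k)) × F) ×
    ((DirectSum ℤ fun k => X (2 * k + 1)) × F) →ₗ[Λ] X i :=
  parityRec
    (fun k => DirectSum.component Λ ℤ (fun k => X (2 * k)) k ∘ₗ
      LinearMap.fst Λ _ _ ∘ₗ LinearMap.fst Λ _ _)
    (fun k => DirectSum.component Λ ℤ (fun k => X (2 * k + 1)) k ∘ₗ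
      LinearMap.fst Λ _ _ ∘ₗ LinearMap.snd Λ _ _)

theorem parityJ_even (k : ℤ) : parityJ (Λ := Λ) X F (2 * k) =
    LinearMap.inl Λ _ _ ∘ₗ LinearMap.inl Λ _ _ ∘ₗ DirectSum.lof Λ ℤ (fun k => X (2 * k)) k :=
  parityRec_even _ _ k

theorem parityJ_odd (k : ℤ) : parityJ (Λ := Λ) X F (2 * k + 1) =
    LinearMap.inr Λ _ _ ∘ₗ LinearMap.inl Λ _ _ ∘ₗ DirectSum.lof Λ ℤ (fun k => X (2 * k + 1)) k :=
  parityRec_odd _ _ k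

theorem parityQ_even (k : ℤ) : parityQ (Λ := Λ) X F (2 * k) =
    DirectSum.component Λ ℤ (fun k => X (2 * k)) k ∘ₗ
      LinearMap.fst Λ _ _ ∘ₗ LinearMap.fst Λ _ _ :=
  parityRec_even _ _ k

theorem parityQ_odd (k : ℤ) : parityQ (Λ := Λ) X F (2 * k + 1) =
    DirectSum.component Λ ℤ (fun k => X (2 * k + 1)) k ∘ₗ
      LinearMap.fst Λ _ _ ∘ₗ LinearMap.snd Λ _ _ :=
  parityRec_odd _ _ k

/-- The decomposition of the even and the odd part of a bounded complex, with a free summand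
added to both. -/
def parityDecomp : Decomp Λ X (((DirectSum ℤ fun k => X (2 * k)) × F) ×
    ((DirectSum ℤ fun k => X (2 * k + 1)) × F)) where
  S := paritySet S
  J := parityJ X F
  Q := parityQ X F
  -- The two copies of `F` are matched by the identity. This is the stabilization by `Λ^m` in a
  -- trivialization, on which the total map acts as the identity.
  n := LinearMap.inr Λ _ _ ∘ₗ LinearMap.inr Λ _ _ ∘ₗ LinearMap.snd Λ _ _ ∘ₗ LinearMap.fst Λ _ _
  n' := LinearMap.inl Λ _ _ ∘ₗ LinearMap.inr Λ _ _ ∘ₗ LinearMap.snd Λ _ _ ∘ₗ LinearMap.snd Λ _ _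
  ε := LinearMap.inl Λ _ _ ∘ₗ LinearMap.fst Λ _ _
  Q_J i := by
    obtain ⟨k, rfl | rfl⟩ := Int.even_or_odd' i
    · rw [parityJ_even, parityQ_even]
      exact LinearMap.ext fun x => DirectSum.component.lof_self Λ _ _
    · rw [parityJ_odd, parityQ_odd]
      exact LinearMap.ext fun x => DirectSum.component.lof_self Λ _ _
  Q_J_ne i j hij := by
    obtain ⟨k, rfl | rfl⟩ := Int.even_or_odd' i <;> obtain ⟨l, rfl | rfl⟩ := Int.even_or_odd' j
    · rw [parityJ_even, parityQ_even]
      refine LinearMap.ext fun x => ?_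
      change DirectSum.component Λ ℤ (fun k => X (2 * k)) l
        (DirectSum.lof Λ ℤ (fun k => X (2 * k)) k x) = 0
      rw [DirectSum.component.of, dif_neg (fun h => hij (by rw [h]))]
    · rw [parityJ_even, parityQ_odd]
      exact LinearMap.ext fun x => map_zero (DirectSum.component Λ ℤ (fun k => X (2 * k + 1)) l)
    · rw [parityJ_odd, parityQ_even]
      exact LinearMap.ext fun x => map_zero (DirectSum.component Λ ℤ (fun k => X (2 * k)) l)
    · rw [parityJ_odd, parityQ_odd]
      refine LinearMap.ext fun x => ?_
      change DirectSum.component Λ ℤ (fun k => X (2 * k + 1)) l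
        (DirectSum.lof Λ ℤ (fun k => X (2 * k + 1)) k x) = 0
      rw [DirectSum.component.of, dif_neg (fun h => hij (by rw [h]))]
  n_J i := by
    obtain ⟨k, rfl | rfl⟩ := Int.even_or_odd' i
    · rw [parityJ_even]; rfl
    · rw [parityJ_odd]; rfl
  n'_J i := by
    obtain ⟨k, rfl | rfl⟩ := Int.even_or_odd' i
    · rw [parityJ_even]; rfl
    · rw [parityJ_odd]; rfl
  Q_n i := by
    obtain ⟨k, rfl | rfl⟩ := Int.even_or_odd' i
    · rw [parityQ_even]; exact LinearMap.ext fun x =>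
        map_zero (DirectSum.component Λ ℤ (fun k => X (2 * k)) k)
    · rw [parityQ_odd]; exact LinearMap.ext fun x =>
        map_zero (DirectSum.component Λ ℤ (fun k => X (2 * k + 1)) k)
  Q_n' i := by
    obtain ⟨k, rfl | rfl⟩ := Int.even_or_odd' i
    · rw [parityQ_even]; exact LinearMap.ext fun x =>
        map_zero (DirectSum.component Λ ℤ (fun k => X (2 * k)) k)
    · rw [parityQ_odd]; exact LinearMap.ext fun x =>
        map_zero (DirectSum.component Λ ℤ (fun k => X (2 * k + 1)) k)
  n_n := rfl
  n'_n' := rfl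
  sum_J_Q := by
    rw [sum_paritySet]
    simp_rw [parityJ_even, parityJ_odd, parityQ_even, parityQ_odd]
    refine LinearMap.ext fun v => ?_
    have h0 := sum_lof_component (Λ := Λ) S (fun k hk => (hS k hk).1) v.1.1
    have h1 := sum_lof_component (Λ := Λ) S (fun k hk => (hS k hk).2) v.2.1
    simp only [LinearMap.add_apply, LinearMap.sum_apply, LinearMap.comp_apply, ← map_sum,
      LinearMap.fst_apply, LinearMap.snd_apply, h0, h1, Module.End.mul_apply]
    refine Prod.ext (Prod.ext ?_ ?_) (Prod.ext ?_ ?_) <;> simp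
  subsingleton i hi := by
    obtain ⟨k, rfl | rfl⟩ := Int.even_or_odd' i
    · exact (hS k fun h => hi (even_mem_paritySet.mpr h)).1
    · exact (hS k fun h => hi (odd_mem_paritySet.mpr h)).2
  ε_J_even i hi := by
    obtain ⟨k, rfl | rfl⟩ := Int.even_or_odd' i
    · rw [parityJ_even]; rfl
    · exact absurd hi (Int.not_even_two_mul_add_one k)
  ε_J_odd i hi := by
    obtain ⟨k, rfl | rfl⟩ := Int.even_or_odd' i
    · exact absurd (even_two_mul k) (Int.not_even_iff_odd.mpr hi)
    · rw [parityJ_odd]; rfl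
  Q_ε_even i hi := by
    obtain ⟨k, rfl | rfl⟩ := Int.even_or_odd' i
    · rw [parityQ_even]; rfl
    · exact absurd hi (Int.not_even_two_mul_add_one k)
  Q_ε_odd i hi := by
    obtain ⟨k, rfl | rfl⟩ := Int.even_or_odd' i
    · exact absurd (even_two_mul k) (Int.not_even_iff_odd.mpr hi)
    · rw [parityQ_odd]; exact LinearMap.ext fun x =>
        map_zero (DirectSum.component Λ ℤ (fun k => X (2 * k + 1)) k)
  n_ε := rfl
  ε_n := rfl
  n'_ε := LinearMap.ext fun x => by simp
  ε_n' := rfl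

theorem tensProd_apply_snd {Λ : Type*} [Ring Λ] {S : Type*} [Ring S] {n : ℕ}
    (Φ : Λ →+* Matrix (Fin n) (Fin n) S) {M N : Type*} [AddCommGroup M] [Module Λ M]
    [AddCommGroup N] [Module Λ N] (x : Tens Φ (M × N)) :
    (tensProd Φ M N x).2 = Tens.map Φ (LinearMap.snd Λ M N) x := rfl

variable {n : ℕ} {R : Type*} [CommRing R] (Φ : Λ →+* Matrix (Fin n) (Fin n) R)

theorem parityDecomp_tens_ε : ((parityDecomp X F S hS).tens Φ).ε = evenProj := by
  refine LinearMap.ext fun v => ?_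
  change tensEnd Φ (LinearMap.inl Λ _ _ ∘ₗ LinearMap.fst Λ _ _) v = (v.1, 0)
  rw [tensEnd_apply, tensProd_symm_apply, map_add, Tens.map_map, Tens.map_map, LinearMap.comp_assoc,
    LinearMap.comp_assoc, LinearMap.fst_comp_inl, LinearMap.fst_comp_inr, LinearMap.comp_id,
    LinearMap.comp_zero, Tens.map_zero, LinearMap.zero_apply, add_zero, tensProd_apply,
    Tens.map_map, Tens.map_map, LinearMap.fst_comp_inl, LinearMap.snd_comp_inl, Tens.map_id,
    Tens.map_zero]
  rfl

theorem block₀₁_tens_n : block₀₁ ((parityDecomp X F S hS).tens Φ).n =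
    Tens.map Φ (LinearMap.inr Λ _ _ ∘ₗ LinearMap.snd Λ _ _) := by
  refine LinearMap.ext fun v => ?_
  change (tensEnd Φ _ (v, 0)).2 = _
  rw [tensEnd_apply, tensProd_symm_apply, tensProd_apply_snd, map_zero, add_zero, Tens.map_map,
    Tens.map_map]
  rfl

theorem block₀₁_tens_n' : block₀₁ ((parityDecomp X F S hS).tens Φ).n' = 0 := by
  refine LinearMap.ext fun v => ?_
  change (tensEnd Φ _ (v, 0)).2 = _
  rw [tensEnd_apply, tensProd_symm_apply, tensProd_apply_snd, map_zero, add_zero, Tens.map_map,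
    Tens.map_map]
  have h : (LinearMap.snd Λ _ _ ∘ₗ (parityDecomp X F S hS).n') ∘ₗ LinearMap.inl Λ _ _ = 0 := rfl
  rw [h, Tens.map_zero]

/-- Outside `S` the source or the target of a component is trivial, so the double `finsum` is a sum
over `S × S`. The even-to-odd block picks from the assembled map exactly the components from degree
`2i` to degree `2j + 1`. -/
theorem block₀₁_tens_asm (t : ∀ i j, Tens Φ (X i) →ₗ[R] Tens Φ (X j)) :
    block₀₁ (((parityDecomp X F S hS).tens Φ).asm t) =
      ∑ᶠ (i : ℤ) (j : ℤ),
        Tens.map Φ (LinearMap.inl Λ _ F ∘ₗ DirectSum.lof Λ ℤ (fun k => X (2 * k + 1)) j) ∘ₗ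
        t (2 * i) (2 * j + 1) ∘ₗ
        Tens.map Φ (DirectSum.component Λ ℤ (fun k => X (2 * k)) i ∘ₗ LinearMap.fst Λ _ F) := by
  have h0 : ∀ i ∉ S, ∀ j, Tens.map Φ (LinearMap.inl Λ _ F ∘ₗ
      DirectSum.lof Λ ℤ (fun k => X (2 * k + 1)) j) ∘ₗ t (2 * i) (2 * j + 1) ∘ₗ
        Tens.map Φ (DirectSum.component Λ ℤ (fun k => X (2 * k)) i ∘ₗ LinearMap.fst Λ _ F) = 0 := by
    intro i hi j
    have := (hS i hi).1
    refine LinearMap.ext fun v => ?_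
    rw [LinearMap.comp_apply, LinearMap.comp_apply, Subsingleton.elim
      (Tens.map Φ (DirectSum.component Λ ℤ (fun k => X (2 * k)) i ∘ₗ LinearMap.fst Λ _ F) v) 0,
      map_zero, map_zero, LinearMap.zero_apply]
  have h1 : ∀ j ∉ S, ∀ i, Tens.map Φ (LinearMap.inl Λ _ F ∘ₗ
      DirectSum.lof Λ ℤ (fun k => X (2 * k + 1)) j) ∘ₗ t (2 * i) (2 * j + 1) ∘ₗ
        Tens.map Φ (DirectSum.component Λ ℤ (fun k => X (2 * k)) i ∘ₗ LinearMap.fst Λ _ F) = 0 := by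
    intro j hj i
    have := (hS j hj).2
    refine LinearMap.ext fun v => ?_
    rw [LinearMap.comp_apply, Subsingleton.elim ((t (2 * i) (2 * j + 1) ∘ₗ
        Tens.map Φ (DirectSum.component Λ ℤ (fun k => X (2 * k)) i ∘ₗ LinearMap.fst Λ _ F)) v) 0,
      map_zero, LinearMap.zero_apply]
  rw [finsum_eq_sum_of_support_subset (s := S)]
  swap
  · intro i hi
    by_contra h
    refine hi ?_
    simp_rw [h0 i h]
    exact finsum_zero
  have h2 : ∀ i, (∑ᶠ (j : ℤ), Tens.map Φ (LinearMap.inl Λ _ F ∘ₗ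
      DirectSum.lof Λ ℤ (fun k => X (2 * k + 1)) j) ∘ₗ t (2 * i) (2 * j + 1) ∘ₗ
        Tens.map Φ (DirectSum.component Λ ℤ (fun k => X (2 * k)) i ∘ₗ LinearMap.fst Λ _ F)) =
      ∑ j ∈ S, Tens.map Φ (LinearMap.inl Λ _ F ∘ₗ
      DirectSum.lof Λ ℤ (fun k => X (2 * k + 1)) j) ∘ₗ t (2 * i) (2 * j + 1) ∘ₗ
        Tens.map Φ (DirectSum.component Λ ℤ (fun k => X (2 * k)) i ∘ₗ LinearMap.fst Λ _ F) := by
    intro i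
    refine finsum_eq_sum_of_support_subset _ ?_
    intro j hj
    by_contra h
    exact hj (h1 j h i)
  simp_rw [h2]
  have hQe : ∀ k v, ((parityDecomp X F S hS).tens Φ).Q (2 * k) (v, 0) =
      Tens.map Φ (DirectSum.component Λ ℤ (fun k => X (2 * k)) k ∘ₗ LinearMap.fst Λ _ F) v := by
    intro k v
    change Tens.map Φ (parityQ X F (2 * k)) ((tensProd Φ _ _).symm (v, 0)) = _
    rw [parityQ_even, tensProd_symm_apply, map_zero, add_zero, Tens.map_map]
    rfl
  have hQo : ∀ k v, ((parityDecomp X F S hS).tens Φ).Q (2 * k + 1) (v, 0) = 0 := by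
    intro k v
    change Tens.map Φ (parityQ X F (2 * k + 1)) ((tensProd Φ _ _).symm (v, 0)) = _
    rw [parityQ_odd, tensProd_symm_apply, map_zero, add_zero, Tens.map_map]
    have : (DirectSum.component Λ ℤ (fun k => X (2 * k + 1)) k ∘ₗ LinearMap.fst Λ _ F ∘ₗ
      LinearMap.snd Λ ((DirectSum ℤ fun k => X (2 * k)) × F) _) ∘ₗ LinearMap.inl Λ _ _ = 0 :=
      LinearMap.ext fun x => map_zero (DirectSum.component Λ ℤ (fun k => X (2 * k + 1)) k)
    rw [this, Tens.map_zero, LinearMap.zero_apply]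
  have hJe : ∀ k v, (((parityDecomp X F S hS).tens Φ).J (2 * k) v).2 = 0 := by
    intro k v
    change (tensProd Φ _ _ (Tens.map Φ (parityJ X F (2 * k)) v)).2 = 0
    rw [parityJ_even, tensProd_apply_snd, Tens.map_map, ← LinearMap.comp_assoc,
      LinearMap.snd_comp_inl, LinearMap.zero_comp, Tens.map_zero, LinearMap.zero_apply]
  have hJo : ∀ k v, (((parityDecomp X F S hS).tens Φ).J (2 * k + 1) v).2 =
      Tens.map Φ (LinearMap.inl Λ _ F ∘ₗ DirectSum.lof Λ ℤ (fun k => X (2 * k + 1)) k) v := by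
    intro k v
    change (tensProd Φ _ _ (Tens.map Φ (parityJ X F (2 * k + 1)) v)).2 = _
    rw [parityJ_odd, tensProd_apply_snd, Tens.map_map]
    rfl
  refine LinearMap.ext fun v => ?_
  change ((((parityDecomp X F S hS).tens Φ).asm t) (v, 0)).2 = _
  have e := Decomp.asm_apply ((parityDecomp X F S hS).tens Φ) t (v, 0)
  have e' : ((parityDecomp X F S hS).tens Φ).S = paritySet S := rfl
  rw [e, e', sum_paritySet]
  simp_rw [sum_paritySet, hQo, hQe, map_zero, Finset.sum_const_zero, add_zero]
  simp only [LinearMap.sum_apply, LinearMap.comp_apply, Prod.snd_add, Prod.snd_sum, hJe, hJo,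
    Finset.sum_const_zero, zero_add, add_zero]

end ParityDecomp

/-! ### From the splitting data of the leading term to graded splittings -/

section SplittingToGraded

universe u v w

variable {p : ℕ} [Fact p.Prime] {L : Type w} [NontriviallyNormedField L] [IsUltrametricDist L]
  [NormedAlgebra ℚ_[p] L] [FiniteDimensional ℚ_[p] L]
  {G : Type u} [Group G] [TopologicalSpace G] [IsTopologicalGroup G] [CompactSpace G] [T2Space G]
  {n : ℕ} {ρ : G →ₜ* GL (Fin n) 𝒪[L]} {θ : G →ₜ* Multiplicative ℤ_[p]}
  {A : CochainComplex (ModuleCat.{v} (Iwasawa ℤ_[p] G)) ℤ} {hA : IsStrictlyPerfect A}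

namespace Splitting

variable (D : Splitting ρ θ hA)

/-- The map `c` of a splitting, with values in `L^n ⊗ A`. -/
def cE (i : ℤ) : (tensComplex (fieldHom p ρ) A).homology i →ₗ[L] Tens (fieldHom p ρ) (A.X i) :=
  cyc (fieldHom p ρ) A i ∘ₗ D.c i

/-- The map `π` of a splitting. -/
def πE (i : ℤ) : Tens (fieldHom p ρ) (A.X i) →ₗ[L] (tensComplex (fieldHom p ρ) A).homology i :=
  D.π i

/-- The map `s` of a splitting. -/
def sE (i j : ℤ) : Tens (fieldHom p ρ) (A.X i) →ₗ[L] Tens (fieldHom p ρ) (A.X j) := D.s i j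

theorem πE_cyc (i : ℤ) (z : (tensComplex (fieldHom p ρ) A).cycles i) :
    D.πE i (cyc (fieldHom p ρ) A i z) = cls (fieldHom p ρ) A i z :=
  LinearMap.congr_fun (D.π_iCycles i) z

theorem cls_c (i : ℤ) (x : (tensComplex (fieldHom p ρ) A).homology i) :
    cls (fieldHom p ρ) A i (D.c i x) = x :=
  LinearMap.congr_fun (D.homologyπ_c i) x

theorem πE_cE (i : ℤ) : D.πE i ∘ₗ D.cE i = LinearMap.id :=
  LinearMap.ext fun x => (D.πE_cyc i (D.c i x)).trans (D.cls_c i x)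

theorem d_cE (i j : ℤ) : Tens.map (fieldHom p ρ) (A.d i j).hom ∘ₗ D.cE i = 0 :=
  LinearMap.ext fun x => d_cyc (fieldHom p ρ) i j (D.c i x)

theorem πE_d (i j : ℤ) : D.πE j ∘ₗ Tens.map (fieldHom p ρ) (A.d i j).hom = 0 := by
  by_cases h : i + 1 = j
  · refine LinearMap.ext fun x => ?_
    have hdd : Tens.map (fieldHom p ρ) (A.d j (j + 1)).hom
        (Tens.map (fieldHom p ρ) (A.d i j).hom x) = 0 := by
      rw [Tens.map_map, ← ModuleCat.hom_comp, A.d_comp_d]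
      exact LinearMap.congr_fun (Tens.map_zero (fieldHom p ρ)) x
    obtain ⟨z, hz⟩ := exists_cyc_eq (fieldHom p ρ) (A := A) rfl hdd
    rw [LinearMap.comp_apply, ← hz, D.πE_cyc]
    exact (cls_eq_zero_iff (fieldHom p ρ) h z).mpr ⟨x, hz.symm⟩
  · have : (A.d i j).hom = 0 := by rw [A.shape i j h]; rfl
    rw [this, Tens.map_zero, LinearMap.comp_zero]

/-- The cochain-level operator, compressed to the cohomology, recovers the Bockstein map itself. In
particular the compression does not depend on the connections. -/
theorem πE_β_cE (Dn : ∀ i, Connection θ (A.X i)) (i j : ℤ) :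
    D.πE j ∘ₗ Tens.map (fieldHom p ρ) (bocksteinMap Dn i j) ∘ₗ D.cE i =
      bockstein (fieldHom p ρ) θ hA i j := by
  by_cases h : i + 1 = j
  · refine LinearMap.ext fun x => ?_
    obtain ⟨y, hy, e⟩ := exists_bockstein_cls (fieldHom p ρ) Dn hA h (D.c i x)
    rw [D.cls_c] at e
    rw [e, ← D.πE_cyc, hy]
    rfl
  · have h1 : bockstein (fieldHom p ρ) θ hA i j = 0 := dif_neg h
    have h2 : bocksteinMap Dn i j = 0 := (connectionBockstein Dn).β_shape i j h
    rw [h1, h2, Tens.map_zero, LinearMap.zero_comp, LinearMap.comp_zero]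

theorem sE_cE (i j : ℤ) : D.sE i j ∘ₗ D.cE i = 0 := D.s_c i j

theorem πE_sE (i j : ℤ) : D.πE j ∘ₗ D.sE i j = 0 := D.π_s i j

theorem cE_comp_πE_cE_comp {M N : Type*} [AddCommGroup M] [Module L M] [AddCommGroup N] [Module L N]
    (i : ℤ) (f : (tensComplex (fieldHom p ρ) A).homology i →ₗ[L] M)
    (g : N →ₗ[L] (tensComplex (fieldHom p ρ) A).homology i) :
    (f ∘ₗ D.πE i) ∘ₗ (D.cE i ∘ₗ g) = f ∘ₗ g := by
  rw [LinearMap.comp_assoc, ← LinearMap.comp_assoc g, D.πE_cE, LinearMap.id_comp]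

/-- The splitting of the complex `L^n ⊗ A` as a graded splitting. -/
def graded (Dn : ∀ i, Connection θ (A.X i)) :
    GradedSplitting ((connectionBockstein Dn).tens (fieldHom p ρ)) where
  s := D.sE
  e i := D.cE i ∘ₗ D.πE i
  b i j := D.cE j ∘ₗ bockstein (fieldHom p ρ) θ hA i j ∘ₗ D.πE i
  τ i j := D.cE j ∘ₗ D.σ i j ∘ₗ D.πE i
  s_shape := D.s_shape
  τ_shape i j h := by rw [D.σ_shape i j h, LinearMap.zero_comp, LinearMap.comp_zero]
  d_e i j := by
    rw [← LinearMap.comp_assoc]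
    change (Tens.map (fieldHom p ρ) (A.d i j).hom ∘ₗ D.cE i) ∘ₗ D.πE i = 0
    rw [D.d_cE, LinearMap.zero_comp]
  e_d i j := by
    change D.cE j ∘ₗ (D.πE j ∘ₗ Tens.map (fieldHom p ρ) (A.d i j).hom) = 0
    rw [D.πE_d, LinearMap.comp_zero]
  s_e i j := by rw [← LinearMap.comp_assoc, D.sE_cE, LinearMap.zero_comp]
  e_s i j := by rw [LinearMap.comp_assoc, D.πE_sE, LinearMap.comp_zero]
  homotopy := D.s_homotopy
  s_s := D.s_s
  b_eq i j := by
    rw [← D.πE_β_cE Dn i j]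
    rfl
  e_τ i j := D.cE_comp_πE_cE_comp j _ _
  τ_e i j := D.cE_comp_πE_cE_comp i (D.cE j ∘ₗ D.σ i j) (D.πE i)
  τ_τ i j k := by
    refine (D.cE_comp_πE_cE_comp j (D.cE k ∘ₗ D.σ j k) (D.σ i j ∘ₗ D.πE i)).trans ?_
    rw [LinearMap.comp_assoc, ← LinearMap.comp_assoc (D.πE i), D.σ_σ, LinearMap.zero_comp,
      LinearMap.comp_zero]
  b_τ i := by
    have h1 := D.cE_comp_πE_cE_comp (i - 1) (D.cE i ∘ₗ bockstein (fieldHom p ρ) θ hA (i - 1) i)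
      (D.σ i (i - 1) ∘ₗ D.πE i)
    have h2 := D.cE_comp_πE_cE_comp (i + 1) (D.cE i ∘ₗ D.σ (i + 1) i)
      (bockstein (fieldHom p ρ) θ hA i (i + 1) ∘ₗ D.πE i)
    refine (congrArg₂ (· + ·) h1 h2).trans ?_
    have h3 := congrArg (fun f => D.cE i ∘ₗ f ∘ₗ D.πE i) (D.σ_homotopy i)
    simp only [LinearMap.add_comp, LinearMap.comp_add, LinearMap.id_comp] at h3
    exact h3

theorem t_eq (Dn : ∀ i, Connection θ (A.X i)) (i j : ℤ) :
    D.t i j = ((connectionBockstein Dn).tens (fieldHom p ρ)).d i j + (D.graded Dn).s i j +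
      (D.graded Dn).b i j + (D.graded Dn).τ i j := by
  have h : D.t i j = Tens.map (fieldHom p ρ) (A.d i j).hom + D.sE i j +
    D.cE j ∘ₗ (bockstein (fieldHom p ρ) θ hA i j + D.σ i j) ∘ₗ D.πE i := rfl
  rw [h, LinearMap.add_comp, LinearMap.comp_add, ← add_assoc]
  rfl

end Splitting
end SplittingToGraded

/-! ### Contractions of complexes over a field -/

section Contractions

variable {K : Type*} [Field K]

theorem exists_pseudo_inverse {V W : Type*} [AddCommGroup V] [Module K V] [AddCommGroup W]
    [Module K W] (f : V →ₗ[K] W) : ∃ u : W →ₗ[K] V, f ∘ₗ u ∘ₗ f = f := by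
  obtain ⟨g, hg⟩ := f.rangeRestrict.exists_rightInverse_of_surjective f.range_rangeRestrict
  obtain ⟨r, hr⟩ := (LinearMap.range f).subtype.exists_leftInverse_of_injective
    (Submodule.ker_subtype _)
  refine ⟨g ∘ₗ r, LinearMap.ext fun x => ?_⟩
  have h1 : r (f x) = f.rangeRestrict x := LinearMap.congr_fun hr (f.rangeRestrict x)
  have h2 : f.rangeRestrict (g (f.rangeRestrict x)) = f.rangeRestrict x :=
    LinearMap.congr_fun hg _
  change f (g (r (f x))) = f x
  rw [h1]
  exact congrArg Subtype.val h2

theorem exists_linear_section {V W : Type*} [AddCommGroup V] [Module K V] [AddCommGroup W]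
    [Module K W] (f : V →ₗ[K] W) (hf : Function.Surjective f) :
    ∃ g : W →ₗ[K] V, f ∘ₗ g = LinearMap.id :=
  f.exists_rightInverse_of_surjective (LinearMap.range_eq_top.mpr hf)

variable {X : ℤ → Type*} [∀ i, AddCommGroup (X i)] [∀ i, Module K (X i)]

theorem exists_contraction (d : ∀ i j, X i →ₗ[K] X j) (hd : ∀ i j k x, d j k (d i j x) = 0) :
    ∃ s : ∀ i j, X i →ₗ[K] X j, (∀ i j, j + 1 ≠ i → s i j = 0) ∧
      (∀ i j k x, s j k (s i j x) = 0) ∧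
      (∀ i j x, i + 1 = j → d i j (s j i (d i j x)) = d i j x) ∧
      (∀ i j x, i + 1 = j → s j i (d i j (s j i x)) = s j i x) := by
  classical
  choose u hu using fun i j => exists_pseudo_inverse (d i j)
  have hu' : ∀ i j x, d i j (u i j (d i j x)) = d i j x := fun i j x =>
    LinearMap.congr_fun (hu i j) x
  -- Here `u` is any pseudo-inverse of `d`. Passing to `udu` gives `sds = s`, and the factor `1 -
  -- ud`, which kills the image of `udu` from the next degree, gives `s² = 0` without destroying
  -- `dsd = d`.
  let s : ∀ i j, X i →ₗ[K] X j := fun i j =>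
    if j + 1 = i then (u j i ∘ₗ d j i ∘ₗ u j i) ∘ₗ
      (LinearMap.id - u i (i + 1) ∘ₗ d i (i + 1)) else 0
  have hs : ∀ i j, j + 1 = i → ∀ x, s i j x =
      u j i (d j i (u j i (x - u i (i + 1) (d i (i + 1) x)))) := by
    intro i j h x
    simp only [s, if_pos h]
    rfl
  have hs0 : ∀ i j, j + 1 ≠ i → s i j = 0 := fun i j h => if_neg h
  refine ⟨s, hs0, ?_, ?_, ?_⟩
  · intro i j k x
    by_cases h : j + 1 = i
    swap
    · rw [hs0 i j h, LinearMap.zero_apply, map_zero]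
    by_cases h' : k + 1 = j
    swap
    · rw [hs0 j k h', LinearMap.zero_apply]
    rw [hs j k h']
    subst h
    rw [hs (j + 1) j rfl, hu', sub_self, map_zero, map_zero, map_zero]
  · intro i j x h
    rw [hs j i h, hd, map_zero, sub_zero, hu', hu']
  · intro i j x h
    rw [hs j i h (d i j _), hd, map_zero, sub_zero, hs j i h, hu', hu']

theorem exists_contraction_of_exact (d : ∀ i j, X i →ₗ[K] X j)
    (hd : ∀ i j k x, d j k (d i j x) = 0)
    (hex : ∀ i x, d i (i + 1) x = 0 → ∃ y, d (i - 1) i y = x) :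
    ∃ s : ∀ i j, X i →ₗ[K] X j, (∀ i j, j + 1 ≠ i → s i j = 0) ∧
      (∀ i j k x, s j k (s i j x) = 0) ∧
      (∀ i x, d (i - 1) i (s i (i - 1) x) + s (i + 1) i (d i (i + 1) x) = x) := by
  obtain ⟨s, h1, h2, h3, h4⟩ := exists_contraction d hd
  refine ⟨s, h1, h2, fun i x => ?_⟩
  -- The element `x - dsx - sdx` is a cycle, hence a boundary `dy`, and `dsd = d` recovers `dy` as
  -- `ds(dy)`. But `s` annihilates the element, by `sds = s` and `s² = 0`, so it is zero.
  have h5 : d i (i + 1) (x - d (i - 1) i (s i (i - 1) x) - s (i + 1) i (d i (i + 1) x)) = 0 := by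
    rw [map_sub, map_sub, hd, h3 i (i + 1) x rfl, sub_zero, sub_self]
  obtain ⟨y, hy⟩ := hex i _ h5
  have h6 : d (i - 1) i (s i (i - 1) (d (i - 1) i y)) = d (i - 1) i y :=
    h3 (i - 1) i y (sub_add_cancel i 1)
  rw [hy, map_sub (s i (i - 1)), map_sub (s i (i - 1)), h4 (i - 1) i x (sub_add_cancel i 1), h2,
    sub_self, sub_zero, map_zero] at h6
  rw [sub_sub] at h6
  exact (sub_eq_zero.mp h6.symm).symm

end Contractions

/-! ### Existence of splittings -/

section ExistenceOfSplittings

universe u v w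

variable {p : ℕ} [Fact p.Prime] {L : Type w} [NontriviallyNormedField L] [IsUltrametricDist L]
  [NormedAlgebra ℚ_[p] L] [FiniteDimensional ℚ_[p] L]
  {G : Type u} [Group G] [TopologicalSpace G] [IsTopologicalGroup G] [CompactSpace G] [T2Space G]
  {n : ℕ} {ρ : G →ₜ* GL (Fin n) 𝒪[L]} {θ : G →ₜ* Multiplicative ℤ_[p]}
  {A : CochainComplex (ModuleCat.{v} (Iwasawa ℤ_[p] G)) ℤ} (hA : IsStrictlyPerfect A)

theorem nonempty_splitting_of_exact (Dn : ∀ i, Connection θ (A.X i))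
    (hex : ∀ i x, bockstein (fieldHom p ρ) θ hA i (i + 1) x = 0 →
      ∃ y, bockstein (fieldHom p ρ) θ hA (i - 1) i y = x) : Nonempty (Splitting ρ θ hA) := by
  set Φ := fieldHom p ρ with hΦ
  obtain ⟨σ, σ1, σ2, σ3⟩ := exists_contraction_of_exact
    (fun i j => bockstein Φ θ hA i j)
    (fun i j k x => bockstein_bockstein Φ Dn hA i j k x) hex
  let d : ∀ i j, Tens Φ (A.X i) →ₗ[L] Tens Φ (A.X j) := fun i j => Tens.map Φ (A.d i j).hom
  have hdd : ∀ i j k x, d j k (d i j x) = 0 :=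
    ((connectionBockstein Dn).tens Φ).d_d_apply
  obtain ⟨s, s1, s2, s3, s4⟩ := exists_contraction (X := fun i => Tens Φ (A.X i)) d hdd
  let e : ∀ i, Tens Φ (A.X i) →ₗ[L] Tens Φ (A.X i) := fun i =>
    LinearMap.id - (d (i - 1) i ∘ₗ s i (i - 1) + s (i + 1) i ∘ₗ d i (i + 1))
  have he : ∀ i x, e i x = x - (d (i - 1) i (s i (i - 1) x) + s (i + 1) i (d i (i + 1) x)) :=
    fun i x => rfl
  have de : ∀ i x, d i (i + 1) (e i x) = 0 := by
    intro i x
    rw [he, map_sub, map_add, hdd, s3 i (i + 1) x rfl, zero_add, sub_self]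
  have ed : ∀ i x, e i (d (i - 1) i x) = 0 := by
    intro i x
    rw [he, hdd, map_zero, add_zero, s3 (i - 1) i x (sub_add_cancel i 1), sub_self]
  have se : ∀ i j x, s i j (e i x) = 0 := by
    intro i j x
    by_cases h : j + 1 = i
    · obtain rfl : j = i - 1 := by omega
      rw [he, map_sub, map_add, s2, add_zero, s4 (i - 1) i x h, sub_self]
    · rw [s1 i j h, LinearMap.zero_apply]
  have es : ∀ i j x, e j (s i j x) = 0 := by
    intro i j x
    by_cases h : j + 1 = i
    · subst h
      rw [he, s2, map_zero, zero_add, s4 j (j + 1) x rfl, sub_self]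
    · rw [s1 i j h, LinearMap.zero_apply, map_zero]
  have ee : ∀ i x, e i (e i x) = e i x := by
    intro i x
    rw [he i (e i x), se, de, map_zero, map_zero, add_zero, sub_zero]
  -- Over a field the inclusion of the cycles has a retraction `r` and the projection to cohomology
  -- has a section `q`. These are arbitrary.
  choose r hr using fun i => (cyc Φ A i).exists_leftInverse_of_injective
    (LinearMap.ker_eq_bot.mpr (cyc_injective Φ i))
  have hr' : ∀ i z, r i (cyc Φ A i z) = z := fun i z => LinearMap.congr_fun (hr i) z
  have cycr : ∀ i x, cyc Φ A i (r i (e i x)) = e i x := by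
    intro i x
    obtain ⟨z, hz⟩ := exists_cyc_eq Φ (A := A) rfl (de i x)
    rw [← hz, hr']
  choose q hq using fun i => exists_linear_section (cls Φ A i) (cls_surjective Φ i)
  have hq' : ∀ i x, cls Φ A i (q i x) = x := fun i x => LinearMap.congr_fun (hq i) x
  have clse : ∀ i z, cls Φ A i (r i (e i (cyc Φ A i z))) = cls Φ A i z := by
    intro i z
    rw [← sub_eq_zero, ← map_sub, cls_eq_zero_iff Φ (sub_add_cancel i 1)]
    refine ⟨-s i (i - 1) (cyc Φ A i z), ?_⟩
    rw [map_sub, cycr, he]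
    have h0 : d i (i + 1) (cyc Φ A i z) = 0 := d_cyc Φ i (i + 1) z
    rw [h0, map_zero, add_zero, map_neg]
    change -(d (i - 1) i _) = _
    abel
  have ccls : ∀ i z, e i (cyc Φ A i (q i (cls Φ A i z))) = e i (cyc Φ A i z) := by
    intro i z
    have h0 : cls Φ A i (q i (cls Φ A i z) - z) = 0 := by rw [map_sub, hq', sub_self]
    obtain ⟨x, hx⟩ := (cls_eq_zero_iff Φ (sub_add_cancel i 1) _).mp h0
    rw [← sub_eq_zero, ← map_sub, ← map_sub, ← hx]
    exact ed i x
  -- Composition with the projector `e` normalizes the arbitrary `r` and `q`. It leaves classes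
  -- unchanged, and it makes the side conditions `s c = 0` and `π s = 0` follow from `s e = 0` and
  -- `e s = 0`.
  let c : ∀ i, (tensComplex Φ A).homology i →ₗ[L] (tensComplex Φ A).cycles i := fun i =>
    r i ∘ₗ e i ∘ₗ cyc Φ A i ∘ₗ q i
  let π : ∀ i, Tens Φ (A.X i) →ₗ[L] (tensComplex Φ A).homology i := fun i =>
    cls Φ A i ∘ₗ r i ∘ₗ e i
  have hc : ∀ i x, cyc Φ A i (c i x) = e i (cyc Φ A i (q i x)) := fun i x => cycr i _
  have hom : ∀ i (x : Tens Φ (A.X i)), d (i - 1) i (s i (i - 1) x) + s (i + 1) i (d i (i + 1) x) =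
      x - cyc Φ A i (c i (π i x)) := by
    intro i x
    have h1 : cyc Φ A i (c i (π i x)) = e i x := by
      rw [hc]
      change e i (cyc Φ A i (q i (cls Φ A i (r i (e i x))))) = e i x
      rw [ccls, cycr, ee]
    rw [h1, he, sub_sub_cancel]
  have πs : ∀ i j (x : Tens Φ (A.X i)), π j (s i j x) = 0 := by
    intro i j x
    change cls Φ A j (r j (e j (s i j x))) = 0
    rw [es, map_zero, map_zero]
  refine ⟨{ c := c, π := π, s := s, σ := σ, homologyπ_c := ?_, π_iCycles := ?_, s_shape := s1,
            s_homotopy := ?_, s_s := ?_, s_c := ?_, π_s := ?_, σ_shape := σ1, σ_homotopy := ?_,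
            σ_σ := ?_ }⟩
  · exact fun i => LinearMap.ext fun x => (clse i (q i x)).trans (hq' i x)
  · exact fun i => LinearMap.ext fun z => clse i z
  · exact fun i => LinearMap.ext fun x => hom i x
  · exact fun i j k => LinearMap.ext fun x => s2 i j k x
  · intro i j
    refine LinearMap.ext fun x => ?_
    change s i j (cyc Φ A i (c i x)) = 0
    rw [hc, se]
  · exact fun i j => LinearMap.ext fun x => πs i j x
  · exact fun i => LinearMap.ext fun x => σ3 i x
  · exact fun i j k => LinearMap.ext fun x => σ2 i j k x

end ExistenceOfSplittings

/-! ### Clearing denominators -/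

section Denominators

set_option linter.unusedSectionVars false

variable {Λ : Type*} [Ring Λ] {R : Type*} [CommRing R] [IsDomain R] (K : Type*) [Field K]
  [Algebra R K] [IsFractionRing R K] {n : ℕ} (Φ : Λ →+* Matrix (Fin n) (Fin n) R)

theorem exists_smul_eq_one_tmul {M : Type*} [AddCommGroup M] [Module R M] (z : K ⊗[R] M) :
    ∃ a : R, a ≠ 0 ∧ ∃ m : M, a • z = 1 ⊗ₜ m := by
  induction z using TensorProduct.induction_on with
  | zero => exact ⟨1, one_ne_zero, 0, by simp⟩
  | tmul c m =>
    obtain ⟨r, s, hs, rfl⟩ := IsFractionRing.div_surjective R c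
    have hs' : algebraMap R K s ≠ 0 := by
      simpa using nonZeroDivisors.ne_zero hs
    refine ⟨s, nonZeroDivisors.ne_zero hs, r • m, ?_⟩
    rw [TensorProduct.smul_tmul', Algebra.smul_def, mul_div_cancel₀ _ hs',
      Algebra.algebraMap_eq_smul_one, TensorProduct.smul_tmul]
  | add x y hx hy =>
    obtain ⟨a, ha, m, hm⟩ := hx
    obtain ⟨b, hb, k, hk⟩ := hy
    refine ⟨a * b, mul_ne_zero ha hb, b • m + a • k, ?_⟩
    rw [smul_add, mul_comm, mul_smul, hm, mul_comm, mul_smul, hk, TensorProduct.tmul_add,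
      TensorProduct.tmul_smul, TensorProduct.tmul_smul]

variable (M : Type*) [AddCommGroup M] [Module Λ M]

theorem exists_smul_eq_tensIncl (z : Tens (baseHom K Φ) M) :
    ∃ a : R, a ≠ 0 ∧ ∃ m, algebraMap R K a • z = tensIncl K Φ M m := by
  obtain ⟨t, rfl⟩ := (tensBaseEquiv K Φ M).surjective z
  obtain ⟨a, ha, m, hm⟩ := exists_smul_eq_one_tmul K t
  refine ⟨a, ha, m, ?_⟩
  rw [← map_smul, algebraMap_smul, hm]
  exact (tensBase_tmul K Φ M 1 m).trans (one_smul _ _)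

theorem tensIncl_injective [Module.Flat R (Tens Φ M)] : Function.Injective (tensIncl K Φ M) := by
  have h1 : Function.Injective ((Algebra.linearMap R K).rTensor (Tens Φ M)) :=
    Module.Flat.rTensor_preserves_injective_linearMap _ (IsFractionRing.injective R K)
  intro x y h
  have h2 : (1 : K) ⊗ₜ[R] x = 1 ⊗ₜ y := by
    apply (tensBaseEquiv K Φ M).injective
    change tensBase K Φ M _ = tensBase K Φ M _
    rw [tensBase_tmul, tensBase_tmul, h]
  have h3 : (1 : R) ⊗ₜ[R] x = 1 ⊗ₜ y := by
    apply h1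
    simpa using h2
  simpa using congrArg (TensorProduct.lid R (Tens Φ M)) h3

variable {M} in
theorem tensIncl_map {N : Type*} [AddCommGroup N] [Module Λ N] (f : M →ₗ[Λ] N) (x : Tens Φ M) :
    tensIncl K Φ N (Tens.map Φ f x) = Tens.map (baseHom K Φ) f (tensIncl K Φ M x) := by
  have h := tensBaseEquiv_naturality K Φ f (1 ⊗ₜ x)
  rw [LinearMap.baseChange_tmul] at h
  change tensBase K Φ N _ = Tens.map (baseHom K Φ) f (tensBase K Φ M _) at h
  rwa [tensBase_tmul, tensBase_tmul, one_smul, one_smul] at h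

variable {X : ℤ → Type*} [∀ i, AddCommGroup (X i)] [∀ i, Module Λ (X i)]

/-- Integral Bockstein cohomology that is torsion forces the rational one to vanish. An element of
the rational kernel and its witness have integral multiples, the integral hypothesis applies to
these, and the scalars are invertible over `K`. Flatness in the last degree allows the integral
relations to be checked over `K`. -/
theorem kerB_le_imB_of_torsion (B : GradedBockstein Λ X) (i j k : ℤ)
    (hflat : Module.Flat R (Tens Φ (X k)))
    (h : ∀ z ∈ (B.tens Φ).kerB j k, ∃ a : R, a ≠ 0 ∧ a • z ∈ (B.tens Φ).imB i j) :
    (B.tens (baseHom K Φ)).kerB j k ≤ (B.tens (baseHom K Φ)).imB i j := by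
  rintro z ⟨hz, w, hw⟩
  have hz' : Tens.map (baseHom K Φ) (B.d j k) z = 0 := hz
  have hw' : Tens.map (baseHom K Φ) (B.d j k) w = Tens.map (baseHom K Φ) (B.β j k) z := hw
  obtain ⟨a, ha, z₁, hz₁⟩ := exists_smul_eq_tensIncl K Φ _ z
  obtain ⟨b, hb, w₁, hw₁⟩ := exists_smul_eq_tensIncl K Φ _ w
  -- Since `z₁` represents `a z` and `w₁` represents `b w`, both relations acquire the common factor
  -- `ab`, which is why `a w₁` is the witness for `b z₁`.
  have hk : b • z₁ ∈ (B.tens Φ).kerB j k := by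
    refine Submodule.mem_inf.mpr ⟨?_, a • w₁, ?_⟩
    · change Tens.map Φ (B.d j k) (b • z₁) = 0
      apply tensIncl_injective K Φ
      rw [tensIncl_map, map_zero, map_smul, ← hz₁, ← algebraMap_smul K b, map_smul, map_smul, hz',
        smul_zero, smul_zero]
    · change Tens.map Φ (B.d j k) (a • w₁) = Tens.map Φ (B.β j k) (b • z₁)
      apply tensIncl_injective K Φ
      rw [tensIncl_map, tensIncl_map, map_smul (tensIncl K Φ (X j)),
        map_smul (tensIncl K Φ (X j)), ← hz₁, ← hw₁, ← algebraMap_smul K b, ← algebraMap_smul K a]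
      simp only [map_smul, hw']
      exact smul_comm _ _ _
  obtain ⟨c, hc, h1⟩ := h _ hk
  obtain ⟨_, ⟨x, rfl⟩, _, ⟨y, hy, rfl⟩, e⟩ := Submodule.mem_sup.mp h1
  have hy' : Tens.map Φ (B.d i j) y = 0 := hy
  have e' : Tens.map Φ (B.d i j) x + Tens.map Φ (B.β i j) y = c • b • z₁ := e
  have h2 : (algebraMap R K (c * b * a)) • z ∈ (B.tens (baseHom K Φ)).imB i j := by
    rw [map_mul, mul_smul, hz₁, algebraMap_smul, ← map_smul, mul_smul, ← e', map_add, tensIncl_map,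
      tensIncl_map]
    refine Submodule.add_mem_sup ⟨_, rfl⟩ ⟨_, ?_, rfl⟩
    change Tens.map (baseHom K Φ) (B.d i j) _ = 0
    rw [← tensIncl_map, hy', map_zero]
  have hne : algebraMap R K (c * b * a) ≠ 0 := by
    simpa using ⟨⟨hc, hb⟩, ha⟩
  exact (Submodule.smul_mem_iff _ hne).mp h2

end Denominators

/-! ### Semisimplicity yields a splitting -/

section Semisimple

universe u v w

variable {p : ℕ} [Fact p.Prime] {L : Type w} [NontriviallyNormedField L] [IsUltrametricDist L]
  [NormedAlgebra ℚ_[p] L] [FiniteDimensional ℚ_[p] L]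
  {G : Type u} [Group G] [TopologicalSpace G] [IsTopologicalGroup G] [CompactSpace G] [T2Space G]
  {n : ℕ} {ρ : G →ₜ* GL (Fin n) 𝒪[L]} {θ : G →ₜ* Multiplicative ℤ_[p]}
  {A : CochainComplex (ModuleCat.{v} (Iwasawa ℤ_[p] G)) ℤ} (hA : IsStrictlyPerfect A)

theorem natCast_prime_ne_zero (p : ℕ) [Fact p.Prime] (L : Type*) [NontriviallyNormedField L]
    [IsUltrametricDist L] [NormedAlgebra ℚ_[p] L] : (p : 𝒪[L]) ≠ 0 := by
  intro h
  have h1 : (algebraMap ℚ_[p] L p) = 0 := by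
    rw [map_natCast]
    have h2 := congrArg (algebraMap 𝒪[L] L) h
    rwa [map_natCast, map_zero] at h2
  rw [map_eq_zero] at h1
  exact (Fact.out : p.Prime).ne_zero (by exact_mod_cast h1)

theorem IsSemisimpleAt.exists_smul_mem_imB (hss : IsSemisimpleAt ρ θ hA)
    (Dn : ∀ i, Connection θ (A.X i)) (i : ℤ)
    (z : Tens (intHom p ρ) (A.X i))
    (hz : z ∈ ((connectionBockstein Dn).tens (intHom p ρ)).kerB i (i + 1)) :
    ∃ a : 𝒪[L], a ≠ 0 ∧ a • z ∈ ((connectionBockstein Dn).tens (intHom p ρ)).imB (i - 1) i := by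
  obtain ⟨z, rfl⟩ := exists_cyc_eq (intHom p ρ) (A := A) rfl hz.1
  have hx := (bockstein_cls_eq_zero_iff (intHom p ρ) Dn hA rfl z).mpr hz
  obtain ⟨k, hk⟩ := hss i (Submodule.Quotient.mk ⟨_, hx⟩)
  refine ⟨(p : 𝒪[L]) ^ k, pow_ne_zero _ (natCast_prime_ne_zero p L), ?_⟩
  rw [← map_smul, ← cls_mem_range_bockstein_iff (intHom p ρ) Dn hA (sub_add_cancel i 1), map_smul]
  rw [← Submodule.Quotient.mk_smul] at hk
  exact (Submodule.Quotient.mk_eq_zero ((LinearMap.range (bockstein (intHom p ρ) θ hA (i - 1)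
    i)).submoduleOf (LinearMap.ker (bockstein (intHom p ρ) θ hA i (i + 1))))).mp hk

/-- Semisimplicity says that the integral Bockstein cohomology is torsion. After clearing
denominators the Bockstein complex over `L` is exact, hence contractible. -/
theorem IsSemisimpleAt.nonempty_splitting (hss : IsSemisimpleAt ρ θ hA) :
    Nonempty (Splitting ρ θ hA) := by
  have Dn : ∀ i, Connection θ (A.X i) := fun i =>
    haveI := hA.projective i
    (nonempty_connection θ).some
  refine nonempty_splitting_of_exact hA Dn fun i x hx => ?_
  obtain ⟨z, rfl⟩ := cls_surjective (fieldHom p ρ) i x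
  rw [bockstein_cls_eq_zero_iff (fieldHom p ρ) Dn hA rfl] at hx
  have h1 := kerB_le_imB_of_torsion L (intHom p ρ) (connectionBockstein Dn) (i - 1) i (i + 1)
    (by
      have := hA.projective (i + 1)
      have := hA.finite (i + 1)
      have := projective_tens (intHom p ρ) (A.X (i + 1))
      exact Module.Flat.of_projective)
    (fun z hz => hss.exists_smul_mem_imB hA Dn i z hz)
  exact (cls_mem_range_bockstein_iff (fieldHom p ρ) Dn hA (sub_add_cancel i 1) z).mpr (h1 hx)

end Semisimple

/-! ### Auxiliary isomorphisms, finite direct sums and conjugation -/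

section TensEquiv

variable {Λ : Type*} [Ring Λ] {S : Type*} [Ring S] {n : ℕ} (Φ : Λ →+* Matrix (Fin n) (Fin n) S)
  {M N : Type*} [AddCommGroup M] [Module Λ M] [AddCommGroup N] [Module Λ N]

/-- The functor `S^n ⊗_Λ -` on isomorphisms. -/
def Tens.mapEquiv (a : M ≃ₗ[Λ] N) : Tens Φ M ≃ₗ[S] Tens Φ N :=
  LinearEquiv.ofLinearMap (Tens.map Φ a.toLinearMap) (Tens.map Φ a.symm.toLinearMap)
    (by rw [← Tens.map_comp, LinearEquiv.comp_symm, Tens.map_id])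
    (by rw [← Tens.map_comp, LinearEquiv.symm_comp, Tens.map_id])

theorem Tens.mapEquiv_toLinearMap (a : M ≃ₗ[Λ] N) :
    (Tens.mapEquiv Φ a).toLinearMap = Tens.map Φ a.toLinearMap := rfl

end TensEquiv

section FiniteDirectSum

variable {Λ : Type*} [Ring Λ]

theorem finite_directSum {Y : ℤ → Type*} [∀ i, AddCommGroup (Y i)] [∀ i, Module Λ (Y i)]
    (S : Finset ℤ) (hS : ∀ k, k ∉ S → Subsingleton (Y k)) [∀ k, Module.Finite Λ (Y k)] :
    Module.Finite Λ (DirectSum ℤ Y) := by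
  refine Module.Finite.of_surjective
    (∑ k : S, DirectSum.lof Λ ℤ Y k ∘ₗ LinearMap.proj (φ := fun k : S => Y k) k) fun x => ?_
  refine ⟨fun k => DirectSum.component Λ ℤ Y k x, ?_⟩
  rw [LinearMap.sum_apply]
  exact (Finset.sum_coe_sort S
    (fun k => DirectSum.lof Λ ℤ Y k (DirectSum.component Λ ℤ Y k x))).trans
    (sum_lof_component S hS x)

end FiniteDirectSum

section Conjugation

variable {K : Type*} [Field K] {V₀ V₁ W₀ W₁ : Type*} [AddCommGroup V₀] [Module K V₀]
  [AddCommGroup V₁] [Module K V₁] [AddCommGroup W₀] [Module K W₀] [AddCommGroup W₁] [Module K W₁]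
  (e₀ : V₀ ≃ₗ[K] W₀) (e₁ : V₁ ≃ₗ[K] W₁)

theorem conj_evenProj : (e₀.prodCongr e₁).conjRingEquiv evenProj = evenProj := by
  refine LinearMap.ext fun v => ?_
  change (e₀ (e₀.symm v.1), e₁ 0) = (v.1, 0)
  rw [LinearEquiv.apply_symm_apply, map_zero]

theorem IsOddEnd.conj {x : Module.End K (V₀ × V₁)} (hx : IsOddEnd x) :
    IsOddEnd ((e₀.prodCongr e₁).conjRingEquiv x) := by
  unfold IsOddEnd
  rw [← conj_evenProj e₀ e₁, ← map_mul, hx, map_mul, map_sub, map_one]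

theorem block₀₁_conj (x : Module.End K (V₀ × V₁)) :
    block₀₁ ((e₀.prodCongr e₁).conjRingEquiv x) = e₁.toLinearMap ∘ₗ block₀₁ x ∘ₗ e₀.symm.toLinearMap := by
  refine LinearMap.ext fun v => ?_
  change e₁ (x (e₀.symm v, e₁.symm 0)).2 = e₁ (x (e₀.symm v, 0)).2
  rw [map_zero]

end Conjugation

/-! ### The determinant attached to a graded splitting -/

section TotalDeterminant

variable {Λ : Type*} [Ring Λ] {R : Type*} [CommRing R] (K : Type*) [Field K] [Algebra R K] {n : ℕ}
  (Φ : Λ →+* Matrix (Fin n) (Fin n) R)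
  {X : ℤ → Type*} [∀ i, AddCommGroup (X i)] [∀ i, Module Λ (X i)]
  {M N : Type*} [AddCommGroup M] [Module Λ M] [AddCommGroup N] [Module Λ N]
  (Δ : Decomp Λ X (M × N)) {B : GradedBockstein Λ X}

/-- The isomorphism between the even and the odd part of a complex that a splitting defines. -/
def GradedSplitting.blockTot {S : Type*} [CommRing S] {X : ℤ → Type*} [∀ i, AddCommGroup (X i)]
    [∀ i, Module S (X i)] {B : GradedBockstein S X} (U : GradedSplitting B) {V₀ V₁ : Type*}
    [AddCommGroup V₀] [Module S V₀] [AddCommGroup V₁] [Module S V₁] (Δ : Decomp S X (V₀ × V₁)) :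
    V₀ →ₗ[S] V₁ :=
  block₀₁ (Δ.dTot B + (Δ.asm U.s + Δ.n') + Δ.asm U.b + Δ.asm U.τ)

theorem GradedSplitting.det_blockTot_eq {X : ℤ → Type*} [∀ i, AddCommGroup (X i)]
    [∀ i, Module K (X i)] {B : GradedBockstein K X} (U U' : GradedSplitting B) {V₀ V₁ : Type*}
    [AddCommGroup V₀] [Module K V₀] [AddCommGroup V₁] [Module K V₁] [FiniteDimensional K V₀]
    [FiniteDimensional K V₁] (Δ : Decomp K X (V₀ × V₁)) (hε : Δ.ε = evenProj) (α : V₁ ≃ₗ[K] V₀) :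
    LinearMap.det (U.blockTot Δ ∘ₗ α.toLinearMap) =
      LinearMap.det (U'.blockTot Δ ∘ₗ α.toLinearMap) :=
  (U.ringSplitting Δ).det_block_eq (U'.ringSplitting Δ) (Δ.dTot_mul_dTot B) (Δ.dTot_βTot B)
    (Δ.βTot_mul_βTot B) ((Δ.isOddEnd_asm_up hε B.d_shape).add (Δ.isOddEnd_n hε))
    ((Δ.isOddEnd_asm_down hε U.s_shape).add (Δ.isOddEnd_n' hε))
    (Δ.isOddEnd_asm_up hε U.b_shape) (Δ.isOddEnd_asm_down hε U.τ_shape)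
    ((Δ.isOddEnd_asm_down hε U'.s_shape).add (Δ.isOddEnd_n' hε))
    (Δ.isOddEnd_asm_down hε U'.τ_shape) α

theorem tensBaseProd_conj (x : Module.End Λ (M × N)) :
    (tensBaseProd K Φ M N).symm.conjRingEquiv (tensEnd (baseHom K Φ) x) =
      bcHom K (tensEnd Φ x) := by
  refine LinearMap.ext fun v => ?_
  change (tensBaseProd K Φ M N).symm (tensEnd (baseHom K Φ) x (tensBaseProd K Φ M N v)) = _
  rw [← tensBaseProd_bcHom, LinearEquiv.symm_apply_apply]

variable [IsDomain R] [IsPrincipalIdealRing R] [IsFractionRing R K]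
  [Module.Finite Λ M] [Module.Projective Λ M] [Module.Finite Λ N] [Module.Projective Λ N]

/-- The splitting over `K` is transported to `K ⊗_R (R^n ⊗ -)`, where its differential and Bockstein
operator come from `R`. The result for integral pairs then applies, and conjugation does not change
the determinant. -/
theorem GradedSplitting.exists_ord_det_blockTot (hε : (Δ.tens Φ).ε = evenProj)
    (hε' : (Δ.tens (baseHom K Φ)).ε = evenProj)
    (U : GradedSplitting (B.tens (baseHom K Φ))) (a : N ≃ₗ[Λ] M) :
    ∃ (x₀ x₁ : R) (t : ℕ∞), x₀ ≠ 0 ∧ x₁ ≠ 0 ∧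
      Ring.ord R x₀ = (∑ i ∈ Δ.S with Even i,
        relLength ((B.tens Φ).imB (i - 1) i) ((B.tens Φ).kerB i (i + 1))) + t ∧
      Ring.ord R x₁ = (∑ i ∈ Δ.S with ¬ Even i,
        relLength ((B.tens Φ).imB (i - 1) i) ((B.tens Φ).kerB i (i + 1))) + t ∧
      LinearMap.det (U.blockTot (Δ.tens (baseHom K Φ)) ∘ₗ
        Tens.map (baseHom K Φ) a.toLinearMap) * algebraMap R K x₀ = algebraMap R K x₁ := by
  have := finite_tens Φ M
  have := finite_tens Φ N
  have := projective_tens Φ M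
  have := projective_tens Φ N
  have : Module.Free R (Tens Φ M) := Module.free_of_finite_type_torsion_free'
  have : Module.Free R (Tens Φ N) := Module.free_of_finite_type_torsion_free'
  let Δ' := Δ.tens (baseHom K Φ)
  let f := (tensBaseProd K Φ M N).symm.conjRingEquiv
  have H := RingSplitting.map
    (R' := Module.End K ((K ⊗[R] Tens Φ M) × (K ⊗[R] Tens Φ N))) f.toRingHom (U.ringSplitting Δ')
  have hd : f (Δ'.dTot (B.tens (baseHom K Φ))) = bcHom K ((Δ.tens Φ).pair hε (B.tens Φ)).d := by
    rw [Decomp.pair_d, Decomp.tens_dTot, Decomp.tens_dTot]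
    exact tensBaseProd_conj K Φ _
  have hβ : f (Δ'.βTot (B.tens (baseHom K Φ))) = bcHom K ((Δ.tens Φ).pair hε (B.tens Φ)).β := by
    rw [Decomp.pair_β, Decomp.tens_βTot, Decomp.tens_βTot]
    exact tensBaseProd_conj K Φ _
  change RingSplitting (f _) (f _) (f _) (f _) (f _) (f _) at H
  rw [hd, hβ] at H
  have odd : ∀ x, IsOddEnd x → IsOddEnd (f x) := fun x hx =>
    hx.conj (tensBaseEquiv K Φ M).symm (tensBaseEquiv K Φ N).symm
  obtain ⟨x₀, x₁, t, h0, h1, h2, h3, h4⟩ :=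
    ((Δ.tens Φ).pair hε (B.tens Φ)).exists_ord_det_of_ringSplitting K H
      (odd _ ((Δ'.isOddEnd_asm_down hε' U.s_shape).add (Δ'.isOddEnd_n' hε')))
      (odd _ (Δ'.isOddEnd_asm_up hε' U.b_shape)) (odd _ (Δ'.isOddEnd_asm_down hε' U.τ_shape))
      (Tens.mapEquiv Φ a)
  refine ⟨x₀, x₁, t, h0, h1, ?_, ?_, ?_⟩
  · rw [h2, Decomp.relLength_even]
    rfl
  · rw [h3, Decomp.relLength_odd]
    rfl
  · rw [← h4]
    congr 1
    rw [← hd, ← map_add, ← map_add, ← map_add, Tens.mapEquiv_toLinearMap]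
    have h5 : block₀₁ (f (Δ'.dTot (B.tens (baseHom K Φ)) + (Δ'.asm U.s + Δ'.n') + Δ'.asm U.b +
        Δ'.asm U.τ)) = (tensBaseEquiv K Φ N).symm.toLinearMap ∘ₗ U.blockTot Δ' ∘ₗ
          (tensBaseEquiv K Φ M).toLinearMap :=
      block₀₁_conj (tensBaseEquiv K Φ M).symm (tensBaseEquiv K Φ N).symm _
    rw [h5]
    have h6 : (tensBaseEquiv K Φ M).toLinearMap ∘ₗ (Tens.map Φ a.toLinearMap).baseChange K =
        Tens.map (baseHom K Φ) a.toLinearMap ∘ₗ (tensBaseEquiv K Φ N).toLinearMap :=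
      LinearMap.ext fun x => tensBaseEquiv_naturality K Φ _ x
    rw [LinearMap.comp_assoc, LinearMap.comp_assoc, h6]
    exact (LinearMap.det_conj _ (tensBaseEquiv K Φ N).symm).symm

end TotalDeterminant

/-! ### Order, valuation and absolute value on `𝒪` and `L` -/

section Valuations

variable (p : ℕ) [Fact p.Prime] (L : Type*) [NontriviallyNormedField L] [IsUltrametricDist L]
  [NormedAlgebra ℚ_[p] L]

theorem finrank_int : Module.finrank ℤ_[p] 𝒪[L] = Module.finrank ℚ_[p] L := by
  let : Algebra ℤ_[p] L := ((algebraMap ℚ_[p] L).comp (algebraMap ℤ_[p] ℚ_[p])).toAlgebra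
  have : IsScalarTower ℤ_[p] ℚ_[p] L := IsScalarTower.of_algebraMap_eq fun _ => rfl
  have : IsScalarTower ℤ_[p] 𝒪[L] L := IsScalarTower.of_algebraMap_eq fun _ => rfl
  exact (IsFractionRing.finrank_eq ℤ_[p] ℚ_[p] 𝒪[L] L).symm

variable [FiniteDimensional ℚ_[p] L]

/-- Reduction modulo `p` of the coordinates in a `ℤ_p`-basis identifies `𝒪 / p` with a vector space
over `𝔽_p`, of dimension `[L : ℚ_p]`. -/
theorem cardQuot_span_prime :
    Submodule.cardQuot (Ideal.span {(p : 𝒪[L])}) = p ^ Module.finrank ℚ_[p] L := by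
  let φ : 𝒪[L] →+ (Fin (Module.finrank ℤ_[p] 𝒪[L]) → ZMod p) :=
    (AddMonoidHom.compLeft (PadicInt.toZMod (p := p)).toAddMonoidHom _).comp
      (intBasis p L).equivFun.toLinearMap.toAddMonoidHom
  have hφ : ∀ x i, φ x i = PadicInt.toZMod ((intBasis p L).equivFun x i) := fun _ _ => rfl
  have hsurj : Function.Surjective φ := by
    intro y
    choose z hz using fun i => ZMod.ringHom_surjective (PadicInt.toZMod (p := p)) (y i)
    refine ⟨(intBasis p L).equivFun.symm z, ?_⟩
    funext i
    rw [hφ, LinearEquiv.apply_symm_apply, hz]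
  have hker : (Ideal.span {(p : 𝒪[L])}).toAddSubgroup = φ.ker := by
    ext x
    rw [Submodule.mem_toAddSubgroup, Ideal.mem_span_singleton, AddMonoidHom.mem_ker]
    constructor
    · rintro ⟨y, rfl⟩
      funext i
      rw [hφ, ← nsmul_eq_mul, map_nsmul, Pi.smul_apply, map_nsmul, nsmul_eq_mul, CharP.cast_eq_zero,
        zero_mul]
      rfl
    · intro hx
      have h1 : ∀ i, ∃ c, (intBasis p L).equivFun x i = p * c := by
        intro i
        have h2 : (intBasis p L).equivFun x i ∈ RingHom.ker (PadicInt.toZMod (p := p)) :=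
          (hφ x i).symm.trans (congrFun hx i)
        rw [PadicInt.ker_toZMod, PadicInt.maximalIdeal_eq_span_p, Ideal.mem_span_singleton] at h2
        exact h2
      choose c hc using h1
      refine ⟨(intBasis p L).equivFun.symm c, ?_⟩
      apply (intBasis p L).equivFun.injective
      rw [← nsmul_eq_mul, map_nsmul, LinearEquiv.apply_symm_apply]
      funext i
      rw [hc, Pi.smul_apply, nsmul_eq_mul]
  change AddSubgroup.index _ = _
  rw [hker, AddSubgroup.index_ker, AddMonoidHom.range_eq_top.mpr hsurj]
  rw [Nat.card_congr AddSubgroup.topEquiv.toEquiv, Nat.card_fun, Nat.card_zmod, Nat.card_fin,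
    finrank_int]


/-- Write `(p) = (ϖ)^k`. Counting `𝒪 / p` gives `(#κ_L)^k = p^[L:ℚ_p]`, and taking absolute values
gives `|ϖ|^k = p⁻¹`. Hence the two sides have equal `k`-th powers, and they are equal because they
are nonnegative and `k ≠ 0`. -/
theorem norm_irreducible_pow {ϖ : 𝒪[L]} (hϖ : Irreducible ϖ) :
    ‖(ϖ : L)‖ ^ Module.finrank ℚ_[p] L = (Nat.card (IsLocalRing.ResidueField 𝒪[L]) : ℝ)⁻¹ := by
  have := isDiscreteValuationRing_int p L
  obtain ⟨k, u, hk⟩ := IsDiscreteValuationRing.eq_unit_mul_pow_irreducible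
    (natCast_prime_ne_zero p L) hϖ
  have hspan : Ideal.span {(p : 𝒪[L])} = IsLocalRing.maximalIdeal 𝒪[L] ^ k := by
    rw [hϖ.maximalIdeal_eq, Ideal.span_singleton_pow, hk, mul_comm, Ideal.span_singleton_mul_right_unit u.isUnit]
  have hm : IsLocalRing.maximalIdeal 𝒪[L] ≠ ⊥ := IsDiscreteValuationRing.not_a_field _
  have hcard := cardQuot_span_prime p L
  rw [hspan, cardQuot_pow_of_prime hm, Submodule.cardQuot_apply] at hcard
  change Nat.card (IsLocalRing.ResidueField 𝒪[L]) ^ k = _ at hcard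
  have hu : ‖((u : 𝒪[L]) : L)‖ = 1 := Valued.integer.isUnit_iff_norm_eq_one.mp u.isUnit
  have hn : ‖(ϖ : L)‖ ^ k = (p : ℝ)⁻¹ := by
    have h1 : ‖((p : 𝒪[L]) : L)‖ = (p : ℝ)⁻¹ := by
      have h2 : ((p : 𝒪[L]) : L) = algebraMap ℚ_[p] L p := by simp
      rw [h2, norm_algebraMap', Padic.norm_p]
    rw [hk] at h1
    simpa [hu] using h1
  have hp : 1 < p := (Fact.out : p.Prime).one_lt
  have hk0 : k ≠ 0 := by
    rintro rfl
    rw [pow_zero] at hn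
    have : (p : ℝ) = 1 := inv_eq_one.mp hn.symm
    exact hp.ne' (by exact_mod_cast this)
  refine (pow_left_inj₀ (by positivity) (by positivity) hk0).mp ?_
  rw [← pow_mul, mul_comm, pow_mul, hn, inv_pow, inv_pow]
  congr 1
  exact_mod_cast hcard.symm

theorem ordL_mul {x y : L} (hx : x ≠ 0) (hy : y ≠ 0) : ordL p (x * y) = ordL p x + ordL p y := by
  have := isDiscreteValuationRing_int p L
  unfold ordL
  rw [map_mul, WithZero.log_mul ((Valuation.ne_zero_iff _).mpr hx) ((Valuation.ne_zero_iff _).mpr hy)]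
  ring

theorem ordL_neg (x : L) : ordL p (-x) = ordL p x := by
  unfold ordL
  rw [Valuation.map_neg]

/-- The order, the valuation and the absolute value of an element of `𝒪`. -/
theorem exists_ord_eq {a : 𝒪[L]} (ha : a ≠ 0) : ∃ k : ℕ, Ring.ord 𝒪[L] a = k ∧
    ordL p (algebraMap 𝒪[L] L a) = k ∧ ‖algebraMap 𝒪[L] L a‖ ^ Module.finrank ℚ_[p] L =
      ((Nat.card (IsLocalRing.ResidueField 𝒪[L]) : ℝ) ^ k)⁻¹ := by
  have := isDiscreteValuationRing_int p L
  obtain ⟨ϖ, hϖ⟩ := IsDiscreteValuationRing.exists_irreducible 𝒪[L]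
  obtain ⟨k, u, rfl⟩ := IsDiscreteValuationRing.eq_unit_mul_pow_irreducible ha hϖ
  refine ⟨k, ?_, ?_, ?_⟩
  · rw [Ring.ord_mul_of_isUnit_left u.isUnit,
      Ring.ord_pow (mem_nonZeroDivisors_of_ne_zero hϖ.ne_zero), Ring.ord_of_irreducible hϖ, nsmul_one]
  · unfold ordL
    have h1 : (IsDiscreteValuationRing.maximalIdeal 𝒪[L]).intValuation (u : 𝒪[L]) = 1 := by
      simp [IsDiscreteValuationRing.maximalIdeal]
    rw [IsDedekindDomain.HeightOneSpectrum.valuation_of_algebraMap, map_mul, map_pow, h1, one_mul,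
      (IsDiscreteValuationRing.maximalIdeal 𝒪[L]).intValuation_singleton hϖ.ne_zero
        hϖ.maximalIdeal_eq, WithZero.log_pow, WithZero.log_exp]
    simp
  · have hu : ‖((u : 𝒪[L]) : L)‖ = 1 := Valued.integer.isUnit_iff_norm_eq_one.mp u.isUnit
    have h2 : algebraMap 𝒪[L] L (u * ϖ ^ k) = (u : 𝒪[L]) * (ϖ : L) ^ k := by
      rw [map_mul, map_pow]
      rfl
    rw [h2, norm_mul, hu, one_mul, norm_pow, ← pow_mul, mul_comm, pow_mul, norm_irreducible_pow p L hϖ,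
      inv_pow]

/-- The valuation and the absolute value of a quotient of two elements of `𝒪`. -/
theorem ordL_and_norm_of_mul_eq {y : L} {x₀ x₁ : 𝒪[L]} (h₀ : x₀ ≠ 0) (h₁ : x₁ ≠ 0)
    (h : y * algebraMap 𝒪[L] L x₀ = algebraMap 𝒪[L] L x₁) : y ≠ 0 ∧
    ∃ k₀ k₁ : ℕ, Ring.ord 𝒪[L] x₀ = k₀ ∧ Ring.ord 𝒪[L] x₁ = k₁ ∧ ordL p y = k₁ - k₀ ∧
      ‖y‖ ^ Module.finrank ℚ_[p] L =
        (Nat.card (IsLocalRing.ResidueField 𝒪[L]) : ℝ) ^ ((k₀ : ℤ) - k₁) := by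
  have hx₀ : algebraMap 𝒪[L] L x₀ ≠ 0 := fun e => h₀ (Subtype.ext e)
  have hx₁ : algebraMap 𝒪[L] L x₁ ≠ 0 := fun e => h₁ (Subtype.ext e)
  have hy : y ≠ 0 := by
    rintro rfl
    rw [zero_mul] at h
    exact hx₁ h.symm
  obtain ⟨k₀, a₀, b₀, c₀⟩ := exists_ord_eq p L h₀
  obtain ⟨k₁, a₁, b₁, c₁⟩ := exists_ord_eq p L h₁
  have hq : (Nat.card (IsLocalRing.ResidueField 𝒪[L]) : ℝ) ≠ 0 := by
    have := isDiscreteValuationRing_int p L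
    obtain ⟨ϖ, hϖ⟩ := IsDiscreteValuationRing.exists_irreducible 𝒪[L]
    have h2 := norm_irreducible_pow p L hϖ
    intro h3
    rw [h3, inv_zero] at h2
    have h4 := norm_eq_zero.mp (eq_zero_of_pow_eq_zero h2)
    exact hϖ.ne_zero (Subtype.ext h4)
  refine ⟨hy, k₀, k₁, a₀, a₁, ?_, ?_⟩
  · have h2 := ordL_mul p L hy hx₀
    rw [h, b₀, b₁] at h2
    linarith
  · rw [← h, norm_mul, mul_pow, c₀] at c₁
    rw [zpow_sub₀ hq, zpow_natCast, zpow_natCast]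
    field_simp at c₁ ⊢
    linarith

end Valuations

/-! ### Cancellation of the torsion correction -/

section AlternatingSum

/-- The finite totals `k₀` and `k₁` force `t` and every length to be finite. Only then may the
common term `t` be subtracted. -/
theorem ne_top_and_alternating_sum_eq {l : ℤ → ℕ∞} {S : Finset ℤ} (hl : ∀ i ∉ S, l i = 0) {t : ℕ∞}
    {k₀ k₁ : ℕ} (h₀ : (∑ i ∈ S with Even i, l i) + t = k₀)
    (h₁ : (∑ i ∈ S with ¬ Even i, l i) + t = k₁) :
    (∀ i, l i ≠ ⊤) ∧ ∑ᶠ i : ℤ, (i.negOnePow : ℤ) * (l i).toNat = k₀ - k₁ := by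
  have ht : t ≠ ⊤ := by
    rintro rfl
    rw [add_top] at h₀
    exact ENat.top_ne_natCast k₀ h₀
  have e₀ : (∑ i ∈ S with Even i, l i) ≠ ⊤ := by
    intro h
    rw [h, top_add] at h₀
    exact ENat.top_ne_natCast k₀ h₀
  have e₁ : (∑ i ∈ S with ¬ Even i, l i) ≠ ⊤ := by
    intro h
    rw [h, top_add] at h₁
    exact ENat.top_ne_natCast k₁ h₁
  have hfin : ∀ i, l i ≠ ⊤ := by
    intro i
    by_cases hi : i ∈ S
    · by_cases he : Even i
      · exact ne_top_of_le_ne_top e₀ (Finset.single_le_sum (f := l) (fun _ _ => zero_le)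
          (Finset.mem_filter.mpr ⟨hi, he⟩))
      · exact ne_top_of_le_ne_top e₁ (Finset.single_le_sum (f := l) (fun _ _ => zero_le)
          (Finset.mem_filter.mpr ⟨hi, he⟩))
    · rw [hl i hi]
      exact ENat.zero_ne_top
  refine ⟨hfin, ?_⟩
  have hlift : ∀ i, ((l i).toNat : ℕ∞) = l i := fun i => ENat.natCast_toNat (hfin i)
  obtain ⟨t, rfl⟩ := ENat.ne_top_iff_exists.mp ht
  have f₀ : (∑ i ∈ S with Even i, (l i).toNat) + t = k₀ := by
    rw [← ENat.natCast_inj, ← h₀]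
    push_cast
    simp_rw [hlift]
  have f₁ : (∑ i ∈ S with ¬ Even i, (l i).toNat) + t = k₁ := by
    rw [← ENat.natCast_inj, ← h₁]
    push_cast
    simp_rw [hlift]
  rw [finsum_eq_sum_of_support_subset (s := S)]
  swap
  · intro i hi
    by_contra h
    exact hi (by simp [hl i h])
  rw [← Finset.sum_filter_add_sum_filter_not S Even]
  have g₀ : ∑ i ∈ S with Even i, (i.negOnePow : ℤ) * (l i).toNat =
      ∑ i ∈ S with Even i, ((l i).toNat : ℤ) := by
    refine Finset.sum_congr rfl fun i hi => ?_
    rw [Int.negOnePow_even i (Finset.mem_filter.mp hi).2, Units.val_one, one_mul]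
  have g₁ : ∑ i ∈ S with ¬ Even i, (i.negOnePow : ℤ) * (l i).toNat =
      -∑ i ∈ S with ¬ Even i, ((l i).toNat : ℤ) := by
    rw [← Finset.sum_neg_distrib]
    refine Finset.sum_congr rfl fun i hi => ?_
    rw [Int.negOnePow_odd i (Int.not_even_iff_odd.mp (Finset.mem_filter.mp hi).2), Units.val_neg,
      Units.val_one, neg_one_mul]
  rw [g₀, g₁, ← f₀, ← f₁]
  push_cast
  ring

end AlternatingSum

/-! ### The total map of a splitting in the parity decomposition -/

section BlockTotParity

variable {Λ : Type*} [Ring Λ] (X : ℤ → Type*) [∀ i, AddCommGroup (X i)] [∀ i, Module Λ (X i)]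
  (F : Type*) [AddCommGroup F] [Module Λ F] (S : Finset ℤ)
  (hS : ∀ k, k ∉ S → Subsingleton (X (2 * k)) ∧ Subsingleton (X (2 * k + 1)))
  {n : ℕ} {R : Type*} [CommRing R] (Φ : Λ →+* Matrix (Fin n) (Fin n) R)

theorem GradedSplitting.blockTot_parityDecomp {B : GradedBockstein R fun i => Tens Φ (X i)}
    (U : GradedSplitting B) (t : ∀ i j, Tens Φ (X i) →ₗ[R] Tens Φ (X j))
    (ht : ∀ i j, t i j = B.d i j + U.s i j + U.b i j + U.τ i j) :
    U.blockTot ((parityDecomp X F S hS).tens Φ) =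
      (∑ᶠ (i : ℤ) (j : ℤ),
        Tens.map Φ (LinearMap.inl Λ _ F ∘ₗ DirectSum.lof Λ ℤ (fun k => X (2 * k + 1)) j) ∘ₗ
        t (2 * i) (2 * j + 1) ∘ₗ
        Tens.map Φ (DirectSum.component Λ ℤ (fun k => X (2 * k)) i ∘ₗ LinearMap.fst Λ _ F)) +
      Tens.map Φ (LinearMap.inr Λ _ _ ∘ₗ LinearMap.snd Λ _ _) := by
  rw [← block₀₁_tens_asm X F S hS Φ t, ← block₀₁_tens_n X F S hS Φ]
  have h0 := block₀₁_tens_n' X F S hS Φ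
  generalize (parityDecomp X F S hS).tens Φ = Δ at *
  have h1 : Δ.dTot B + (Δ.asm U.s + Δ.n') + Δ.asm U.b + Δ.asm U.τ = Δ.asm t + Δ.n + Δ.n' := by
    have h2 : Δ.asm t = Δ.asm B.d + Δ.asm U.s + Δ.asm U.b + Δ.asm U.τ := by
      rw [Δ.asm_add, Δ.asm_add, Δ.asm_add]
      exact congrArg Δ.asm (funext fun i => funext fun j => ht i j)
    rw [h2, Decomp.dTot]
    abel
  unfold GradedSplitting.blockTot
  rw [h1]
  refine Eq.trans ?_ (add_zero _)
  rw [← h0]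
  rfl

end BlockTotParity

/-! ### The leading term -/

section LeadingTermDet

universe u v w

variable {p : ℕ} [Fact p.Prime] {L : Type w} [NontriviallyNormedField L] [IsUltrametricDist L]
  [NormedAlgebra ℚ_[p] L] [FiniteDimensional ℚ_[p] L]
  {G : Type u} [Group G] [TopologicalSpace G] [IsTopologicalGroup G] [CompactSpace G] [T2Space G]
  {n : ℕ} {ρ : G →ₜ* GL (Fin n) 𝒪[L]} {θ : G →ₜ* Multiplicative ℤ_[p]}
  {A : CochainComplex (ModuleCat.{v} (Iwasawa ℤ_[p] G)) ℤ} {hA : IsStrictlyPerfect A}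

theorem IsStrictlyPerfect.exists_finset {Λ : Type*} [Ring Λ]
    {A : CochainComplex (ModuleCat.{v} Λ) ℤ} (hA : IsStrictlyPerfect A) :
    ∃ S : Finset ℤ, ∀ k, k ∉ S → Subsingleton (A.X (2 * k)) ∧ Subsingleton (A.X (2 * k + 1)) := by
  obtain ⟨a, b, h⟩ := hA.bounded
  -- The margins by one absorb the rounding of the division and the shift from `2k` to `2k + 1`.
  refine ⟨Finset.Icc (a / 2 - 1) (b / 2 + 1), fun k hk => ?_⟩
  rw [Finset.mem_Icc, not_and_or, not_le, not_le] at hk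
  exact ⟨h _ (by omega), h _ (by omega)⟩

/-- This identifies the map in the definition of the leading term with the block of an assembled
splitting, to which the comparison and order results apply. -/
theorem Splitting.total_eq (D : Splitting ρ θ hA) (Dn : ∀ i, Connection θ (A.X i)) (m : ℕ)
    (S : Finset ℤ)
    (hS : ∀ k, k ∉ S → Subsingleton (A.X (2 * k)) ∧ Subsingleton (A.X (2 * k + 1))) :
    D.total m = (D.graded Dn).blockTot
      ((parityDecomp (fun i => A.X i) (Fin m → Iwasawa ℤ_[p] G) S hS).tens (fieldHom p ρ)) :=
  ((D.graded Dn).blockTot_parityDecomp (fun i => A.X i) (Fin m → Iwasawa ℤ_[p] G) S hS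
    (fieldHom p ρ) D.t (D.t_eq Dn)).symm

theorem IsStrictlyPerfect.finite_projective_directSum {Λ : Type*} [Ring Λ]
    {A : CochainComplex (ModuleCat.{v} Λ) ℤ} (hA : IsStrictlyPerfect A) (m : ℕ)
    (f : ℤ → ℤ) (S : Finset ℤ) (hS : ∀ k, k ∉ S → Subsingleton (A.X (f k))) :
    Module.Finite Λ ((DirectSum ℤ fun k => A.X (f k)) × (Fin m → Λ)) ∧
      Module.Projective Λ ((DirectSum ℤ fun k => A.X (f k)) × (Fin m → Λ)) := by
  have := fun k => hA.finite (f k)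
  have := fun k => hA.projective (f k)
  have := finite_directSum (Λ := Λ) (Y := fun k => A.X (f k)) S hS
  exact ⟨inferInstance, inferInstance⟩

end LeadingTermDet

section LeadingTermDet

universe u v w

variable {p : ℕ} [Fact p.Prime] {L : Type w} [NontriviallyNormedField L] [IsUltrametricDist L]
  [NormedAlgebra ℚ_[p] L] [FiniteDimensional ℚ_[p] L]
  {G : Type u} [Group G] [TopologicalSpace G] [IsTopologicalGroup G] [CompactSpace G] [T2Space G]
  {n : ℕ} {ρ : G →ₜ* GL (Fin n) 𝒪[L]} {θ : G →ₜ* Multiplicative ℤ_[p]}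
  {A : CochainComplex (ModuleCat.{v} (Iwasawa ℤ_[p] G)) ℤ} {hA : IsStrictlyPerfect A}

/-- Independence of the leading term from the splitting: two splittings of the same complex are
related by a unipotent operator. -/
theorem Splitting.det_total_eq (D D' : Splitting ρ θ hA) (a : Trivialization A) :
    LinearMap.det (D.total a.m ∘ₗ Tens.map (fieldHom p ρ) a.equiv.toLinearMap) =
      LinearMap.det (D'.total a.m ∘ₗ Tens.map (fieldHom p ρ) a.equiv.toLinearMap) := by
  obtain ⟨S, hS⟩ := hA.exists_finset
  have Dn : ∀ i, Connection θ (A.X i) := fun i =>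
    haveI := hA.projective i
    (nonempty_connection θ).some
  obtain ⟨_, _⟩ := hA.finite_projective_directSum a.m (fun k => 2 * k) S fun k hk => (hS k hk).1
  obtain ⟨_, _⟩ := hA.finite_projective_directSum a.m (fun k => 2 * k + 1) S fun k hk => (hS k hk).2
  have := finite_tens (fieldHom p ρ) ((DirectSum ℤ fun k => A.X (2 * k)) × (Fin a.m → Iwasawa ℤ_[p] G))
  have := finite_tens (fieldHom p ρ)
    ((DirectSum ℤ fun k => A.X (2 * k + 1)) × (Fin a.m → Iwasawa ℤ_[p] G))
  have e1 := congrArg (fun f => LinearMap.det (f ∘ₗ Tens.map (fieldHom p ρ) a.equiv.toLinearMap))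
    (D.total_eq Dn a.m S hS)
  have e2 := congrArg (fun f => LinearMap.det (f ∘ₗ Tens.map (fieldHom p ρ) a.equiv.toLinearMap))
    (D'.total_eq Dn a.m S hS)
  refine e1.trans (Eq.trans ?_ e2.symm)
  exact GradedSplitting.det_blockTot_eq L (D.graded Dn) (D'.graded Dn)
    ((parityDecomp (fun i => A.X i) (Fin a.m → Iwasawa ℤ_[p] G) S hS).tens (fieldHom p ρ))
    (parityDecomp_tens_ε (fun i => A.X i) (Fin a.m → Iwasawa ℤ_[p] G) S hS (fieldHom p ρ))
    (Tens.mapEquiv (fieldHom p ρ) a.equiv)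
-- The determinant is a fraction whose denominator carries the even lengths and whose numerator
-- carries the odd ones, with a common correction `t`. The integral isomorphism `a.equiv` serves as
-- the identification of the two parities.
theorem Splitting.exists_det_total_mul_eq (D : Splitting ρ θ hA) (Dn : ∀ i, Connection θ (A.X i))
    (a : Trivialization A) (S : Finset ℤ)
    (hS : ∀ k, k ∉ S → Subsingleton (A.X (2 * k)) ∧ Subsingleton (A.X (2 * k + 1))) :
    ∃ (x₀ x₁ : 𝒪[L]) (t : ℕ∞), x₀ ≠ 0 ∧ x₁ ≠ 0 ∧
      Ring.ord 𝒪[L] x₀ = (∑ i ∈ paritySet S with Even i,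
        Module.length 𝒪[L] (BocksteinCohomology (intHom p ρ) θ hA i)) + t ∧
      Ring.ord 𝒪[L] x₁ = (∑ i ∈ paritySet S with ¬ Even i,
        Module.length 𝒪[L] (BocksteinCohomology (intHom p ρ) θ hA i)) + t ∧
      LinearMap.det (D.total a.m ∘ₗ Tens.map (fieldHom p ρ) a.equiv.toLinearMap) *
        algebraMap 𝒪[L] L x₀ = algebraMap 𝒪[L] L x₁ := by
  obtain ⟨_, _⟩ := hA.finite_projective_directSum a.m (fun k => 2 * k) S fun k hk => (hS k hk).1
  obtain ⟨_, _⟩ := hA.finite_projective_directSum a.m (fun k => 2 * k + 1) S fun k hk => (hS k hk).2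
  have := isDiscreteValuationRing_int p L
  obtain ⟨x₀, x₁, t, h₀, h₁, e₀, e₁, hdet⟩ := GradedSplitting.exists_ord_det_blockTot L (intHom p ρ)
    (parityDecomp (fun i => A.X i) (Fin a.m → Iwasawa ℤ_[p] G) S hS)
    (parityDecomp_tens_ε (fun i => A.X i) (Fin a.m → Iwasawa ℤ_[p] G) S hS (intHom p ρ))
    (parityDecomp_tens_ε (fun i => A.X i) (Fin a.m → Iwasawa ℤ_[p] G) S hS (fieldHom p ρ))
    (D.graded Dn) a.equiv
  have e := congrArg (fun f => LinearMap.det (f ∘ₗ Tens.map (fieldHom p ρ) a.equiv.toLinearMap))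
    (D.total_eq Dn a.m S hS)
  refine ⟨x₀, x₁, t, h₀, h₁, e₀.trans ?_, e₁.trans ?_,
    (congrArg (· * algebraMap 𝒪[L] L x₀) e).trans hdet⟩
  · exact congrArg (· + t) (Finset.sum_congr rfl fun i _ =>
      (length_bocksteinCohomology (intHom p ρ) Dn hA i).symm)
  · exact congrArg (· + t) (Finset.sum_congr rfl fun i _ =>
      (length_bocksteinCohomology (intHom p ρ) Dn hA i).symm)

/-- Outside the bounds of `A` there is no contribution, so the `finsum` in `chiAdd` is a finite sum.
-/
theorem length_bocksteinCohomology_eq_zero (hA : IsStrictlyPerfect A) (i : ℤ)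
    (hi : Subsingleton (A.X i)) :
    Module.length 𝒪[L] (BocksteinCohomology (intHom p ρ) θ hA i) = 0 := by
  have Dn : ∀ i, Connection θ (A.X i) := fun i =>
    haveI := hA.projective i
    (nonempty_connection θ).some
  rw [length_bocksteinCohomology (intHom p ρ) Dn hA, relLength, Module.length_eq_zero_iff]
  have : Subsingleton (Tens (intHom p ρ) (A.X i)) := inferInstance
  infer_instance

theorem Splitting.ord_det_total (D : Splitting ρ θ hA) (a : Trivialization A) {y : L}
    (hy : y = LinearMap.det (D.total a.m ∘ₗ Tens.map (fieldHom p ρ) a.equiv.toLinearMap)) :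
    (∀ i, Module.length 𝒪[L] (BocksteinCohomology (intHom p ρ) θ hA i) ≠ ⊤) ∧
    y ≠ 0 ∧
    ordL p y = -chiAdd ρ θ hA ∧
    ‖y‖ ^ Module.finrank ℚ_[p] L = chiMult ρ θ hA := by
  obtain ⟨S, hS⟩ := hA.exists_finset
  have Dn : ∀ i, Connection θ (A.X i) := fun i =>
    haveI := hA.projective i
    (nonempty_connection θ).some
  obtain ⟨x₀, x₁, t, h₀, h₁, e₀, e₁, hdet⟩ := D.exists_det_total_mul_eq Dn a S hS
  rw [← hy] at hdet
  obtain ⟨hy₀, k₀, k₁, o₀, o₁, hord, hnorm⟩ := ordL_and_norm_of_mul_eq p L h₀ h₁ hdet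
  have hl : ∀ i ∉ paritySet S,
      Module.length 𝒪[L] (BocksteinCohomology (intHom p ρ) θ hA i) = 0 := by
    intro i hi
    refine length_bocksteinCohomology_eq_zero hA i ?_
    obtain ⟨k, rfl | rfl⟩ := Int.even_or_odd' i
    · exact (hS k fun h => hi (even_mem_paritySet.mpr h)).1
    · exact (hS k fun h => hi (odd_mem_paritySet.mpr h)).2
  obtain ⟨hfin, hsum⟩ := ne_top_and_alternating_sum_eq hl (e₀.symm.trans o₀) (e₁.symm.trans o₁)
  have hchi : chiAdd ρ θ hA = k₀ - k₁ := hsum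
  refine ⟨hfin, hy₀, hord.trans ?_, hnorm.trans ?_⟩
  · rw [hchi, neg_sub]
  · rw [chiMult, hchi]

end LeadingTermDet

end LeadingTerms

end

theorem mainTheorem9 (p : ℕ) [Fact p.Prime]
    {L : Type*} [NontriviallyNormedField L] [IsUltrametricDist L] [NormedAlgebra ℚ_[p] L]
    [FiniteDimensional ℚ_[p] L]
    {E : Type*} [NormedAddCommGroup E] [NormedSpace ℚ_[p] E] [FiniteDimensional ℚ_[p] E]
    {G : Type*} [Group G] [TopologicalSpace G] [IsTopologicalGroup G] [CompactSpace G]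
    [T2Space G] [ChartedSpace E G] [LieGroup 𝓘(ℚ_[p], E) ω G]
    (H : Subgroup G) [H.Normal] (_hH : IsClosed (H : Set G))
    (e : (G ⧸ H) ≃ₜ* Multiplicative ℤ_[p])
    {n : ℕ} (ρ : G →ₜ* GL (Fin n) 𝒪[L])
    (A : CochainComplex (ModuleCat (Iwasawa ℤ_[p] G)) ℤ) (hA : IsStrictlyPerfect A)
    (_hss : IsSemisimpleAt ρ (quotientHom H e) hA) (a : Trivialization A) :
    (∃! x : L, IsLeadingTerm ρ (quotientHom H e) hA a x) ∧
    (∀ i, Module.length 𝒪[L]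
      (BocksteinCohomology (intHom p ρ) (quotientHom H e) hA i) ≠ ⊤) ∧
    ∀ x : L, IsLeadingTerm ρ (quotientHom H e) hA a x →
      x ≠ 0 ∧
      chiAdd ρ (quotientHom H e) hA = -ordL p x ∧
      chiMult ρ (quotientHom H e) hA = ‖x‖ ^ Module.finrank ℚ_[p] L := by

  -- Nothing about `rG` is needed beyond the fact that its sign is `1` or `-1`, and both leave the
  -- valuation and the absolute value unchanged.
  have hsign : ((rG ρ (quotientHom H e) A).negOnePow : ℤ) = 1 ∨
      ((rG ρ (quotientHom H e) A).negOnePow : ℤ) = -1 := by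
    rcases Int.units_eq_one_or (rG ρ (quotientHom H e) A).negOnePow with h | h
    · exact Or.inl (by rw [h]; rfl)
    · exact Or.inr (by rw [h]; rfl)
  obtain ⟨D⟩ := _hss.nonempty_splitting hA
  refine ⟨⟨_, ⟨D, rfl⟩, ?_⟩, (D.ord_det_total a rfl).1, ?_⟩
  · rintro _ ⟨D', rfl⟩
    exact congrArg ((((rG ρ (quotientHom H e) A).negOnePow : ℤ) : L) * ·) (D'.det_total_eq D a)
  · rintro x ⟨D', hx⟩
    obtain ⟨y, hy⟩ : ∃ y, y = LinearMap.det
      (D'.total a.m ∘ₗ Tens.map (fieldHom p ρ) a.equiv.toLinearMap) := ⟨_, rfl⟩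
    obtain ⟨-, h1, h2, h3⟩ := D'.ord_det_total a hy
    rw [← hy] at hx
    rcases hsign with h | h
    · rw [h, Int.cast_one, one_mul] at hx
      rw [hx]
      exact ⟨h1, by rw [h2, neg_neg], h3.symm⟩
    · rw [h, Int.cast_neg, Int.cast_one, neg_one_mul] at hx
      rw [hx, ordL_neg, norm_neg]
      exact ⟨neg_ne_zero.mpr h1, by rw [h2, neg_neg], h3.symm⟩
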